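/- **Theorem 1.** Let $d\ge 2$ and $n_1,\dots,n_d\in\mathbb Z_{\ge0}$. Write $s_d(j)=s_j+s_{j+1}+\cdots+s_d$ and $p_d(j)=p_j+\cdots+p_d$, and let $$\zeta_d(s_1,\dots,s_d)=\sum_{m_1=1}^\infty\cdots\sum_{m_d=1}^\infty\frac1{m_1^{s_1}(m_1+m_2)^{s_2}\cdots(m_1+\cdots+m_d)^{s_d}}$$ be the Euler–Zagier multiple zeta function on its domain of absolute convergence $D=\{s\in\mathbb C^d : \Re s_d(j)>d-j+1\ (j=1,\dots,d)\}$. Put $$\Omega=\{s\in\mathbb C^d : \Re s_d(j)>d-j-n_j\ (1\le j\le d),\ \Re s_{j-1}>-n_j-1\ (2\le j\le d)\},$$ and let $\mathcal S$ be the union of the hyperplanes $s_d(j)=l$ with $l\in\mathbb Z_{\le d-j+1}$ and $s_j=l$ with $l\in\mathbb Z_{\le0}$, for $j=1,\dots,d$. Then $\zeta_d$ continues meromorphically to $\Omega$: there is a meromorphic function on $\Omega$, again written $\zeta_d$, that is the sum of the absolutely convergent series on $\Omega\cap D$. It is holomorphic on $\Omega\setminus\mathcal S$ (its possible singularities lie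 on $\mathcal S$). For every $s\in\Omega\setminus\mathcal S$ all series, derivatives and integrals below exist (the $\varphi_a$ and $\psi_a$ being $C^\infty$ in $x_2,\dots,x_d$, and the integrals absolutely convergent), and $$\begin{aligned}\zeta_d(s)={}&\frac1{\Gamma(s_1)\cdots\Gamma(s_d)}\sum_{k=0}^{n_1}\ \sum_{p_1+\cdots+p_d=k}\frac{B_{p_1}\cdots B_{p_d}}{p_1!\cdots p_d!}\,\frac1{s_d(1)-d+k}\prod_{j=2}^d B\bigl(s_d(j)-d+j+p_d(j)-1,\ s_{j-1}\bigr)\\&+\frac1{\Gamma(s_1)\cdots\Gamma(s_d)}\int_0^1x_1^{s_d(1)-d+n_1}F_{\varphi_a}(x_1)\,dx_1+\frac1{\Gamma(s_1)\cdots\Gamma(s_d)}\int_1^\infty\frac{x_1^{s_d(1)-d}}{e^{x_1}-1}F_{\psi_a}(x_1)\,dx_1.\end{aligned}$$ Here $B_m$ are the Bernoulli numbers, $x/(e^x-1)=\sum_m B_mx^m/m!$; the $p_j$ range over non-negative integers; $B(x,y)=\Gamma(x)\Gamma(y)/\Gamma(x+y)$ is the meromorphically continued beta function; $(b)_m=b(b+1)\cdots(b+m-1)$.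 For a family of functions $f_a(x_1,\dots,x_d)$ indexed by $a=(a_2,\dots,a_d)\in\{0,1\}^{d-1}$, $$\begin{aligned}F_{f_a}(x_1)=\sum_{a}\ \sum_{S\subseteq\{2,\dots,d\}}\ \sum_{\substack{0\le k_j\le n_j\\ (j\in S)}}&\Bigl\{\prod_{j\in S}(-1)^{k_j}\frac{(1/2)^{u_j+k_j+1}}{(u_j+1)_{k_j+1}}\Bigr\}\Bigl\{\prod_{\substack{2\le j\le d\\ j\notin S}}\frac{(-1)^{n_j+1}}{(u_j+1)_{n_j+1}}\Bigr\}\\&\times\int_{[0,1/2]^{\{2,\dots,d\}\setminus S}}\Bigl(\prod_{j\notin S}x_j^{u_j+n_j+1}\Bigr)\Bigl[\prod_{j\in S}\partial_{x_j}^{k_j}\prod_{j\notin S}\partial_{x_j}^{n_j+1}f_a(x_1,\dots,x_d)\Bigr]_{x_j=1/2\ (j\in S)}\ \prod_{j\notin S}dx_j,\end{aligned}$$ where $u_j=s_d(j)-d+j-2$, $v_j=s_{j-1}-1$, $t_j=x_j$ if $a_j=0$, and $u_j=s_{j-1}-1$, $v_j=s_d(j)-d+j-2$, $t_j=1-x_j$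 if $a_j=1$, and $$\varphi_a=\Bigl(\prod_{j=2}^d(1-x_j)^{v_j}\Bigr)\sum_{k=n_1+1}^\infty\ \sum_{p_1+\cdots+p_d=k}\frac{B_{p_1}\cdots B_{p_d}}{p_1!\cdots p_d!}\,x_1^{k-n_1-1}t_2^{p_d(2)}\cdots t_d^{p_d(d)},$$ $$\psi_a=\prod_{j=2}^d(1-x_j)^{v_j}\,\frac{x_1t_2\cdots t_j}{e^{x_1t_2\cdots t_j}-1},$$ the quotient $y/(e^y-1)$ being read as $1$ at $y=0$. -/

import Mathlib

open scoped BigOperators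

namespace EulerZagier

/- Throughout, the depth is `d = e + 1`.  A vector indexed by `1, …, d` is a function on
`Fin (e + 1)` (the index `j` of the usual notation is `i + 1` for `i : Fin (e + 1)`), and a vector
indexed by `2, …, d` is a function on `Fin e` (the index `j` is `i + 2` for `i : Fin e`; then
`s_j` is `s i.succ` and `s_{j-1}` is `s i.castSucc`). -/

/-- `s_d(j) = s_j + s_{j+1} + ⋯ + s_d`. -/
def tailSum {M : Type*} [AddCommMonoid M] {e : ℕ} (s : Fin (e + 1) → M) (i : Fin (e + 1)) : M :=
  ∑ l ∈ Finset.Ici i, s l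

/-- The general term
`m_1^{-s_1} (m_1 + m_2)^{-s_2} ⋯ (m_1 + ⋯ + m_d)^{-s_d}` of the Euler–Zagier series, where
`m_j = m i + 1 ≥ 1`. -/
noncomputable def zetaTerm {e : ℕ} (s : Fin (e + 1) → ℂ) (m : Fin (e + 1) → ℕ) : ℂ :=
  ∏ i, 1 / ((∑ l ∈ Finset.Iic i, (m l + 1) : ℕ) : ℂ) ^ s i

/-- The domain of absolute convergence: `Re s_d(j) > d - j + 1` for `j = 1, …, d`. -/
def convergenceRegion (e : ℕ) : Set (Fin (e + 1) → ℂ) :=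
  {s | ∀ i : Fin (e + 1), (((e : ℝ) + 1) - ((i : ℝ) + 1) + 1) < (tailSum s i).re}

/-- `Re s_d(j) > d - j - n_j` for `j = 1, …, d`, and `Re s_{j-1} > - n_j - 1` for
`j = 2, …, d`. -/
def region {e : ℕ} (n : Fin (e + 1) → ℕ) : Set (Fin (e + 1) → ℂ) :=
  {s | (∀ i : Fin (e + 1), ((e : ℝ) + 1) - ((i : ℝ) + 1) - (n i : ℝ) < (tailSum s i).re) ∧
    ∀ i : Fin e, -(n i.succ : ℝ) - 1 < (s i.castSucc).re}

/-- The union of the hyperplanes `s_d(j) = l` (`l` an integer `≤ d - j + 1`) and `s_j = l`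
(`l` an integer `≤ 0`), for `j = 1, …, d`. -/
def singularLocus (e : ℕ) : Set (Fin (e + 1) → ℂ) :=
  {s | ∃ i : Fin (e + 1),
    (∃ l : ℤ, l ≤ ((e : ℤ) + 1) - ((i : ℤ) + 1) + 1 ∧ tailSum s i = (l : ℂ)) ∨
    (∃ l : ℤ, l ≤ 0 ∧ s i = (l : ℂ))}

/-- Meromorphic functions of several complex variables: near every point of `Ω`, `f` is a quotient
`g / h` of holomorphic functions, where `h` does not vanish identically near that point; the values
of `f` on the zero set of the denominator are irrelevant. -/
def IsMeromorphicOn {E : Type*} [NormedAddCommGroup E] [NormedSpace ℂ E] (f : E → ℂ)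
    (Ω : Set E) : Prop :=
  ∀ z ∈ Ω, ∃ g h : E → ℂ, AnalyticAt ℂ g z ∧ AnalyticAt ℂ h z ∧
    (¬ ∀ᶠ w in nhds z, h w = 0) ∧ ∀ᶠ w in nhds z, h w ≠ 0 → f w = g w / h w

/-- The (meromorphically continued) beta function. -/
noncomputable def betaFun (x y : ℂ) : ℂ :=
  Complex.Gamma x * Complex.Gamma y / Complex.Gamma (x + y)

/-- The coefficient `(B_{p_1} ⋯ B_{p_d}) / (p_1! ⋯ p_d!)`. -/
noncomputable def bernoulliCoeff {e : ℕ} (p : Fin (e + 1) → ℕ) : ℂ :=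
  (∏ i, (bernoulli (p i) : ℂ)) / ∏ i, ((p i).factorial : ℂ)

/-- The finite sum of Bernoulli numbers times beta functions. -/
noncomputable def bernoulliSum {e : ℕ} (n : Fin (e + 1) → ℕ) (s : Fin (e + 1) → ℂ) : ℂ :=
  ∑ k ∈ Finset.range (n 0 + 1), ∑ p ∈ Finset.piAntidiag (Finset.univ : Finset (Fin (e + 1))) k,
    bernoulliCoeff p * (1 / (tailSum s 0 - ((e : ℂ) + 1) + k)) *
      ∏ i : Fin e, betaFun
        (tailSum s i.succ - ((e : ℂ) + 1) + ((i : ℂ) + 2) + ((tailSum p i.succ : ℕ) : ℂ) - 1)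
        (s i.castSucc)

/-- `u_j = s_d(j) - d + j - 2` if `a_j = 0`, and `u_j = s_{j-1} - 1` if `a_j = 1`. -/
noncomputable def uExp {e : ℕ} (s : Fin (e + 1) → ℂ) (a : Fin e → Fin 2) (i : Fin e) : ℂ :=
  if a i = 0 then tailSum s i.succ - ((e : ℂ) + 1) + ((i : ℂ) + 2) - 2 else s i.castSucc - 1

/-- `v_j = s_{j-1} - 1` if `a_j = 0`, and `v_j = s_d(j) - d + j - 2` if `a_j = 1`. -/
noncomputable def vExp {e : ℕ} (s : Fin (e + 1) → ℂ) (a : Fin e → Fin 2) (i : Fin e) : ℂ :=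
  if a i = 0 then s i.castSucc - 1 else tailSum s i.succ - ((e : ℂ) + 1) + ((i : ℂ) + 2) - 2

/-- `t_j = x_j` if `a_j = 0`, and `t_j = 1 - x_j` if `a_j = 1`. -/
noncomputable def tVar {e : ℕ} (a : Fin e → Fin 2) (x : Fin e → ℝ) (i : Fin e) : ℝ :=
  if a i = 0 then x i else 1 - x i

/-- The function `y / (e^y - 1)`, with its removable singularity at `y = 0` removed. -/
noncomputable def todd (y : ℝ) : ℝ :=
  if y = 0 then 1 else y / (Real.exp y - 1)

/-- The terms of the series in `φ_a`; the summation index `k = n_1 + 1, n_1 + 2, …` of the usual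
notation is `k + (n_1 + 1)` here, with `k : ℕ`. -/
noncomputable def phiTerm {e : ℕ} (n : Fin (e + 1) → ℕ) (a : Fin e → Fin 2) (x₁ : ℝ)
    (x : Fin e → ℝ) (k : ℕ) : ℂ :=
  ∑ p ∈ Finset.piAntidiag (Finset.univ : Finset (Fin (e + 1))) (k + (n 0 + 1)),
    bernoulliCoeff p * (x₁ : ℂ) ^ k * ∏ i : Fin e, (tVar a x i : ℂ) ^ tailSum p i.succ

/-- The function `φ_a(x_1, x_2, …, x_d)`. -/
noncomputable def phi {e : ℕ} (n : Fin (e + 1) → ℕ) (s : Fin (e + 1) → ℂ) (a : Fin e → Fin 2)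
    (x₁ : ℝ) (x : Fin e → ℝ) : ℂ :=
  (∏ i, ((1 - x i : ℝ) : ℂ) ^ vExp s a i) * ∑' k : ℕ, phiTerm n a x₁ x k

/-- The function `ψ_a(x_1, x_2, …, x_d)`, the product over `j = 2, …, d` of
`(1 - x_j)^{v_j} (x_1 t_2 ⋯ t_j) / (e^{x_1 t_2 ⋯ t_j} - 1)`. -/
noncomputable def psi {e : ℕ} (s : Fin (e + 1) → ℂ) (a : Fin e → Fin 2)
    (x₁ : ℝ) (x : Fin e → ℝ) : ℂ :=
  ∏ i, (((1 - x i : ℝ) : ℂ) ^ vExp s a i *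
    (todd (x₁ * ∏ l ∈ Finset.Iic i, tVar a x l) : ℂ))

/-- The `k`-th partial derivative of `f` in the `i`-th coordinate. -/
noncomputable def partialPow {e : ℕ} (i : Fin e) (k : ℕ) (f : (Fin e → ℝ) → ℂ) :
    (Fin e → ℝ) → ℂ :=
  fun x => iteratedDeriv k (fun t : ℝ => f (Function.update x i t)) (x i)

/-- The mixed partial derivative `∂_2^{α_2} ⋯ ∂_d^{α_d} f`. -/
noncomputable def mixedPartial {e : ℕ} (α : Fin e → ℕ) (f : (Fin e → ℝ) → ℂ) :
    (Fin e → ℝ) → ℂ :=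
  (List.finRange e).foldr (fun i g => partialPow i (α i) g) f

/-- The point with coordinates `1/2` in `S` and the coordinates of `y` outside `S`. -/
noncomputable def glue {e : ℕ} (S : Finset (Fin e)) (y : {i : Fin e // i ∉ S} → ℝ) : Fin e → ℝ :=
  fun i => if h : i ∈ S then 1 / 2 else y ⟨i, h⟩

/-- The cube `[0, 1/2]^ι`. -/
def halfCube (ι : Type*) : Set (ι → ℝ) :=
  Set.pi Set.univ fun _ => Set.Icc (0 : ℝ) (1 / 2)

/-- The integrand of the inner integral for the set `S` of boundary coordinates (those where
`x_j = 1/2`): the product of `x_j^{u_j + n_j + 1}` over `j ∉ S` times `∂^α f` with `x_j = 1/2` for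
`j ∈ S`. -/
noncomputable def innerIntegrand {e : ℕ} (n : Fin (e + 1) → ℕ) (u : Fin e → ℂ)
    (f : (Fin e → ℝ) → ℂ) (S : Finset (Fin e)) (α : Fin e → ℕ)
    (y : {i : Fin e // i ∉ S} → ℝ) : ℂ :=
  (∏ i : {i : Fin e // i ∉ S}, (y i : ℂ) ^ (u i + (n i.1.succ : ℂ) + 1)) *
    mixedPartial α f (glue S y)

/-- The orders of differentiation for a given `S`: `0 ≤ α_j ≤ n_j` for `j ∈ S`, and
`α_j = n_j + 1` for `j ∉ S`. -/
def orders {e : ℕ} (n : Fin (e + 1) → ℕ) (S : Finset (Fin e)) : Finset (Fin e → ℕ) :=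
  Fintype.piFinset fun i =>
    if i ∈ S then Finset.range (n i.succ + 1) else {n i.succ + 1}

/-- The function `F_{f_a}(x_1)`, for a family of functions `f_a(x_1, …, x_d)`.

A number `m ∈ {1, …, d}` and a permutation `σ` of `{2, …, d}` with `σ(2) < ⋯ < σ(m)` and
`σ(m+1) < ⋯ < σ(d)` are the same thing as the subset `S = {σ(2), …, σ(m)}` of `{2, …, d}`. -/
noncomputable def bigF {e : ℕ} (n : Fin (e + 1) → ℕ) (s : Fin (e + 1) → ℂ)
    (f : (Fin e → Fin 2) → ℝ → (Fin e → ℝ) → ℂ) (x₁ : ℝ) : ℂ :=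
  ∑ a : Fin e → Fin 2, ∑ S : Finset (Fin e), ∑ α ∈ orders n S,
    (∏ i ∈ S, (-1 : ℂ) ^ α i * ((ascPochhammer ℂ (α i + 1)).eval (uExp s a i + 1))⁻¹ *
        (1 / 2 : ℂ) ^ (uExp s a i + (α i : ℂ) + 1)) *
    (∏ i ∈ Sᶜ, (-1 : ℂ) ^ (n i.succ + 1) *
        ((ascPochhammer ℂ (n i.succ + 1)).eval (uExp s a i + 1))⁻¹) *
    ∫ y in halfCube {i : Fin e // i ∉ S}, innerIntegrand n (uExp s a) (f a x₁) S α y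

/-- The integrand `x_1^{s_d(1) - d + n_1} F_{φ_a}(x_1)`, integrated over `[0, 1]`. -/
noncomputable def phiIntegrand {e : ℕ} (n : Fin (e + 1) → ℕ) (s : Fin (e + 1) → ℂ)
    (x₁ : ℝ) : ℂ :=
  (x₁ : ℂ) ^ (tailSum s 0 - ((e : ℂ) + 1) + (n 0 : ℂ)) * bigF n s (phi n s) x₁

/-- The integrand `x_1^{s_d(1) - d} / (e^{x_1} - 1) F_{ψ_a}(x_1)`, integrated over `[1, ∞)`. -/
noncomputable def psiIntegrand {e : ℕ} (n : Fin (e + 1) → ℕ) (s : Fin (e + 1) → ℂ)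
    (x₁ : ℝ) : ℂ :=
  (x₁ : ℂ) ^ (tailSum s 0 - ((e : ℂ) + 1)) / ((Real.exp x₁ - 1 : ℝ) : ℂ) * bigF n s (psi s) x₁

/-- Every series, derivative and integral in the explicit expression exists in the proper sense. -/
def ExpressionExists {e : ℕ} (n : Fin (e + 1) → ℕ) (s : Fin (e + 1) → ℂ) : Prop :=
  (∀ a : Fin e → Fin 2, ∀ x₁ ∈ Set.Icc (0 : ℝ) 1,
    (∀ x ∈ halfCube (Fin e),
      Summable (phiTerm n a x₁ x) ∧ ContDiffAt ℝ (⊤ : ℕ∞) (phi n s a x₁) x) ∧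
    ∀ S : Finset (Fin e), ∀ α ∈ orders n S,
      MeasureTheory.IntegrableOn (innerIntegrand n (uExp s a) (phi n s a x₁) S α)
        (halfCube {i : Fin e // i ∉ S})) ∧
  (∀ a : Fin e → Fin 2, ∀ x₁ ∈ Set.Ici (1 : ℝ),
    (∀ x ∈ halfCube (Fin e), ContDiffAt ℝ (⊤ : ℕ∞) (psi s a x₁) x) ∧
    ∀ S : Finset (Fin e), ∀ α ∈ orders n S,
      MeasureTheory.IntegrableOn (innerIntegrand n (uExp s a) (psi s a x₁) S α)
        (halfCube {i : Fin e // i ∉ S})) ∧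
  MeasureTheory.IntegrableOn (phiIntegrand n s) (Set.Ioc 0 1) ∧
  MeasureTheory.IntegrableOn (psiIntegrand n s) (Set.Ioi 1)

end EulerZagier

/-!
# Meromorphic continuation of the Euler–Zagier multiple zeta function

Write `w_j = x_1 x_2 ⋯ x_j`.  Expanding `1 / (m_1 + ⋯ + m_j)^{s_j}` as a Gamma integral and
substituting `y_j + ⋯ + y_d = w_j` in the variables `y_j` of these integrals gives, for `s` in the
domain of absolute convergence with all `Re s_j > 0` (`integral_zetaKernel`),

`Γ(s_1) ⋯ Γ(s_d) ζ_d(s) = ∫ x_1^{s_d(1) - d - 1} ∏_{j ≥ 2} x_j^{u_j} (1 - x_j)^{v_j}`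
`  ∏_{j ≥ 1} w_j / (e^{w_j} - 1)`

over `x_1 ∈ (0, ∞)` and `(x_2, …, x_d) ∈ (0, 1)^{d-1}`, with the exponents `u_j`, `v_j` for `a = 0`.

* For `x_1 ≤ 1` the product of the functions `w / (e^w - 1)` is expanded in powers of `x_1`
  (`toddProd_eq`).  The first `n_1 + 1` terms are integrals of monomials and give the beta
  functions; the remainder gives the functions `φ_a`.  For `x_1 > 1` nothing is subtracted, and one
  gets the functions `ψ_a`.
* The unit cube is cut into `2^{d-1}` cubes of side `1/2`, indexed by `a`, and each is reflected to
  `[0, 1/2]^{d-1}` (`integral_unitCube_eq_sum`).  There only the factors `x_j^{u_j}` are singular,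
  and `n_j + 1` integrations by parts in each variable `x_j` raise these exponents
  (`integral_halfCube_eq_sum`).  This is `F_{φ_a}` and `F_{ψ_a}`, and it proves the formula when
  `Re s_j > 1` for all `j` (`continuationFormula_eq_of_one_lt`).

The integrated formula makes sense on the whole region.  The functions `φ_a` and `ψ_a` extend
holomorphically to complex values of all variables, hence their partial derivatives are bounded
uniformly on `[0, 1/2]^{d-1}`; for `ψ_a` Cauchy's estimate on polydiscs of radius proportional to
`1 / x_1` shows that the derivatives grow at most polynomially in `x_1`, which `1 / (e^{x_1} - 1)`
absorbs.  Dominated convergence and Osgood's lemma (`analyticOnNhd_of_separately`) then show that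
the integrals are holomorphic in `s` (`exists_integral_bigF_eq`).  The remaining
factors, the Pochhammer symbols and the beta functions, have poles on the hyperplanes only
(`regularOff_continuationFormula`).

Finally, the formula and the series agree wherever both are defined: on a complex line in the
direction `(1, …, 1)` the hyperplanes meet a half-plane in a countable set, whose complement is
connected, and far to the right the two agree (`continuationFormula_eq`).
-/

namespace EulerZagier

open Metric Set Filter Topology MeasureTheory Function

/-! ### Osgood's lemma -/

lemma cons_mem_closedBall {m : ℕ} {c : Fin (m + 1) → ℂ} {r : ℝ} (hr : 0 ≤ r) {x : ℂ}
    {y : Fin m → ℂ} (hx : x ∈ closedBall (c 0) r) (hy : y ∈ closedBall (c ∘ Fin.succ) r) :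
    (Fin.cons x y : Fin (m + 1) → ℂ) ∈ closedBall c r := by
  rw [mem_closedBall, dist_pi_le_iff hr] at *
  intro i
  refine Fin.cases ?_ (fun j => ?_) i
  · simpa using hx
  · simpa using hy j

lemma torusMap_mem_closedBall {m : ℕ} (c : Fin m → ℂ) {r : ℝ} (hr : 0 ≤ r) (θ : Fin m → ℝ) :
    torusMap c (fun _ => r) θ ∈ closedBall c r := by
  rw [mem_closedBall, dist_pi_le_iff hr]
  intro i
  simp [torusMap, dist_eq_norm, abs_of_nonneg hr]

lemma continuous_torusMap {m : ℕ} (c : Fin m → ℂ) (R : Fin m → ℝ) :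
    Continuous (torusMap c R) := by
  unfold torusMap; fun_prop

lemma torusMap_sub_ne_zero {m : ℕ} {c w : Fin m → ℂ} {r : ℝ} (hw : w ∈ ball c r)
    (θ : Fin m → ℝ) (i : Fin m) : torusMap c (fun _ => r) θ i - w i ≠ 0 := by
  have hr : 0 < r := pos_of_mem_ball hw
  intro h
  have h1 : dist (w i) (c i) < r := (dist_pi_lt_iff hr).1 (mem_ball.1 hw) i
  rw [← sub_eq_zero.1 h] at h1
  simp [torusMap, dist_eq_norm, abs_of_pos hr] at h1

/-- The Cauchy integral formula on a polydisc, for a continuous function that is holomorphic in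
each variable separately. -/
theorem torusIntegral_cauchy {m : ℕ} {f : (Fin m → ℂ) → ℂ} {c w : Fin m → ℂ} {r : ℝ}
    (hf : ContinuousOn f (closedBall c r))
    (hd : ∀ z ∈ closedBall c r, ∀ i, DifferentiableAt ℂ (fun t => f (update z i t)) (z i))
    (hw : w ∈ ball c r) :
    torusIntegral (fun ζ => (∏ i, (ζ i - w i)⁻¹) * f ζ) c (fun _ => r) =
      (2 * Real.pi * Complex.I) ^ m * f w := by
  have hr : 0 < r := pos_of_mem_ball hw
  induction m with
  | zero => simp [Subsingleton.elim c w]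
  | succ m ih =>
    have hw0 : w 0 ∈ ball (c 0) r := (dist_pi_lt_iff hr).1 (mem_ball.1 hw) 0
    have hw' : w ∘ Fin.succ ∈ ball (c ∘ Fin.succ) r := by
      rw [mem_ball, dist_pi_lt_iff hr]
      exact fun i => (dist_pi_lt_iff hr).1 (mem_ball.1 hw) i.succ
    have hint : TorusIntegrable (fun ζ => (∏ i, (ζ i - w i)⁻¹) * f ζ) c (fun _ => r) := by
      refine ContinuousOn.integrableOn_compact isCompact_Icc (Continuous.continuousOn ?_)
      refine Continuous.mul (continuous_finsetProd _ fun i _ => Continuous.inv₀ ?_ ?_) ?_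
      · exact (continuous_pi_iff.1 (continuous_torusMap c _) i).sub continuous_const
      · exact fun θ => torusMap_sub_ne_zero hw θ i
      · exact hf.comp_continuous (continuous_torusMap c _) (torusMap_mem_closedBall c hr.le)
    rw [torusIntegral_succ hint]
    have hstep : ∀ x ∈ sphere (c 0) r,
        torusIntegral (fun y => (∏ i, ((Fin.cons x y : Fin (m + 1) → ℂ) i - w i)⁻¹) *
          f (Fin.cons x y)) (c ∘ Fin.succ) ((fun _ => r) ∘ Fin.succ) =
        (x - w 0)⁻¹ • ((2 * Real.pi * Complex.I) ^ m * f (Fin.cons x (w ∘ Fin.succ))) := by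
      intro x hx
      have hx' : x ∈ closedBall (c 0) r := sphere_subset_closedBall hx
      rw [← ih (f := fun y => f (Fin.cons x y)) (c := c ∘ Fin.succ) (w := w ∘ Fin.succ) ?_ ?_ hw']
      · rw [← torusIntegral_smul]
        congr 1
        ext y
        simp [Fin.prod_univ_succ]
        ring
      · refine hf.comp (Continuous.continuousOn ?_) fun y hy => cons_mem_closedBall hr.le hx' hy
        exact continuous_pi fun i => by
          refine Fin.cases ?_ (fun j => ?_) i
          · simpa using continuous_const
          · simpa using continuous_apply j
      · intro z hz i
        have := hd _ (cons_mem_closedBall hr.le hx' hz) i.succ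
        simpa [Fin.cons_update] using this
    rw [show (∮ x in C(c 0, r), torusIntegral (fun y => (∏ i, ((Fin.cons x y : Fin (m + 1) → ℂ) i
        - w i)⁻¹) * f (Fin.cons x y)) (c ∘ Fin.succ) ((fun _ => r) ∘ Fin.succ)) = ∮ x in C(c 0, r),
        (x - w 0)⁻¹ • ((2 * Real.pi * Complex.I) ^ m * f (Fin.cons x (w ∘ Fin.succ))) from
        circleIntegral.integral_congr hr.le hstep]
    have hdiff : DifferentiableOn ℂ
        (fun x => (2 * Real.pi * Complex.I) ^ m * f (Fin.cons x (w ∘ Fin.succ)))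
        (closedBall (c 0) r) := by
      intro x hx
      have := hd _ (cons_mem_closedBall hr.le hx (ball_subset_closedBall hw')) 0
      simp only [Fin.update_cons_zero, Fin.cons_zero] at this
      exact (this.const_mul _).differentiableWithinAt
    rw [hdiff.circleIntegral_sub_inv_smul hw0]
    have : (Fin.cons (w 0) (w ∘ Fin.succ) : Fin (m + 1) → ℂ) = w := Fin.cons_self_tail w
    rw [this, smul_eq_mul, pow_succ]
    ring

/-- **Osgood's lemma**: a continuous function of several complex variables that is holomorphic in
each variable separately is analytic. -/
theorem analyticOnNhd_of_separately {m : ℕ} {f : (Fin m → ℂ) → ℂ} {U : Set (Fin m → ℂ)}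
    (hU : IsOpen U) (hf : ContinuousOn f U)
    (hd : ∀ z ∈ U, ∀ i, DifferentiableAt ℂ (fun t => f (update z i t)) (z i)) :
    AnalyticOnNhd ℂ f U := by
  intro c hc
  obtain ⟨r, hr, hrU⟩ := nhds_basis_closedBall.mem_iff.1 (hU.mem_nhds hc)
  -- On the polydisc, `f w` is a continuous linear functional of the kernel
  -- `θ ↦ ∏ i, (ζ_i(θ) - w_i)⁻¹`, which is an analytic function of `w` with values in `C(K, ℂ)`.
  let K : Set (Fin m → ℝ) := Icc (0 : Fin m → ℝ) fun _ => 2 * Real.pi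
  have : CompactSpace K := isCompact_iff_compactSpace.1 isCompact_Icc
  have hval : Continuous fun θ : K => θ.1 := continuous_subtype_val
  have hτ : Continuous fun θ : K => torusMap c (fun _ => r) θ.1 :=
    (continuous_torusMap c _).comp hval
  let ζ : Fin m → C(K, ℂ) := fun i =>
    ⟨fun θ => torusMap c (fun _ => r) θ i,
      continuous_pi_iff.1 hτ i⟩
  let A : (Fin m → ℂ) → C(K, ℂ) := fun w => ∏ i, Ring.inverse (ζ i - algebraMap ℂ C(K, ℂ) (w i))
  have hunit : ∀ w ∈ ball c r, ∀ i, IsUnit (ζ i - algebraMap ℂ C(K, ℂ) (w i)) := by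
    intro w hw i
    rw [ContinuousMap.isUnit_iff_forall_ne_zero]
    exact fun θ => torusMap_sub_ne_zero hw θ i
  have hAan : AnalyticAt ℂ A c := by
    refine Finset.analyticAt_fun_prod _ fun i _ => ?_
    have h1 : AnalyticAt ℂ (fun w : Fin m → ℂ => ζ i - algebraMap ℂ C(K, ℂ) (w i)) c := by
      refine analyticAt_const.sub ?_
      exact ((Algebra.linearMap ℂ C(K, ℂ)).toContinuousLinearMap.comp
        (ContinuousLinearMap.proj (R := ℂ) (φ := fun _ : Fin m => ℂ) i)).analyticAt c
    obtain ⟨u, hu⟩ := hunit c (mem_ball_self hr) i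
    have h2 := analyticAt_inverse (𝕜 := ℂ) u
    rw [hu] at h2
    exact h2.comp (f := fun w : Fin m → ℂ => ζ i - algebraMap ℂ C(K, ℂ) (w i)) h1
  have hAval : ∀ w ∈ ball c r, ∀ θ : K,
      A w θ = ∏ i, (torusMap c (fun _ => r) θ i - w i)⁻¹ := by
    intro w hw θ
    simp only [A, ContinuousMap.coe_prod, Finset.prod_apply]
    refine Finset.prod_congr rfl fun i _ => ?_
    have h := congrArg (fun g : C(K, ℂ) => g θ) (Ring.mul_inverse_cancel _ (hunit w hw i))
    exact eq_inv_of_mul_eq_one_right h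
  let g : C(K, ℂ) :=
    ⟨fun θ => (∏ i, (r : ℂ) * Complex.exp (θ.1 i * Complex.I) * Complex.I) *
      f (torusMap c (fun _ => r) θ), by
      refine Continuous.mul ?_ ?_
      · refine continuous_finsetProd _ fun i _ => ?_
        have h : Continuous fun θ : K => θ.1 i := continuous_pi_iff.1 hval i
        exact (continuous_const.mul (Complex.continuous_exp.comp
          ((Complex.continuous_ofReal.comp h).mul continuous_const))).mul continuous_const
      · exact (hf.mono hrU).comp_continuous hτ
          fun θ => torusMap_mem_closedBall c hr.le θ⟩
  let μ : Measure K := Measure.comap Subtype.val volume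
  have : IsFiniteMeasure μ := by
    refine ⟨?_⟩
    rw [Measure.comap_apply _ Subtype.val_injective
      (fun s hs => (MeasurableEmbedding.subtype_coe measurableSet_Icc).measurableSet_image.2 hs) _
      MeasurableSet.univ]
    rw [image_univ, Subtype.range_coe]
    exact isCompact_Icc.measure_lt_top
  have hint : ∀ h : C(K, ℂ), Integrable (fun θ => h θ) μ := fun h => by
    refine Integrable.of_bound h.continuous.aestronglyMeasurable ‖h‖ ?_
    exact Eventually.of_forall fun θ => h.norm_coe_le_norm θ
  let L : C(K, ℂ) →L[ℂ] ℂ := LinearMap.mkContinuous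
    { toFun := fun h => ∫ θ, h θ ∂μ
      map_add' := fun h₁ h₂ => integral_add (hint h₁) (hint h₂)
      map_smul' := fun a h => integral_const_mul a _ } (μ.real univ) (fun h => by
        have := norm_integral_le_of_norm_le_const (μ := μ)
          (Eventually.of_forall fun θ => h.norm_coe_le_norm θ)
        rw [mul_comm]; exact this)
  have hLA : AnalyticAt ℂ (fun w => ((2 * Real.pi * Complex.I) ^ m)⁻¹ * L (A w * g)) c :=
    analyticAt_const.mul ((L.analyticAt _).comp (hAan.mul analyticAt_const))
  refine hLA.congr ?_
  filter_upwards [ball_mem_nhds c hr] with w hw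
  have hI := torusIntegral_cauchy (hf.mono hrU) (fun z hz => hd z (hrU hz)) hw
  rw [inv_mul_eq_iff_eq_mul₀ (pow_ne_zero _ Complex.two_pi_I_ne_zero), ← hI, torusIntegral,
    ← integral_subtype_comap measurableSet_Icc]
  refine integral_congr_ae (Eventually.of_forall fun θ => ?_)
  change A w θ * g θ = _
  rw [hAval w hw θ]
  simp only [g, ContinuousMap.coe_mk, smul_eq_mul]
  ring

/-! ### Holomorphic dependence on parameters -/

lemma update_mem_ball {m : ℕ} {z : Fin m → ℂ} {i : Fin m} {t : ℂ} {r : ℝ}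
    (ht : t ∈ ball (z i) r) : update z i t ∈ ball z r := by
  have hr : 0 < r := pos_of_mem_ball ht
  rw [mem_ball, dist_pi_lt_iff hr]
  intro j
  rcases eq_or_ne j i with rfl | hj
  · simpa using ht
  · simpa [hj] using hr

lemma differentiable_update {m : ℕ} (z : Fin m → ℂ) (i : Fin m) :
    Differentiable ℂ fun t : ℂ => update z i t := fun t =>
  (hasDerivAt_update z i t).differentiableAt

/-- A dominated parametric integral of functions that are holomorphic in the parameter is
analytic in the parameter. -/
theorem analyticOnNhd_integral {X : Type*} [MeasurableSpace X] {μ : Measure X} {m : ℕ}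
    {U : Set (Fin m → ℂ)} (hU : IsOpen U) {F : (Fin m → ℂ) → X → ℂ}
    (hmeas : ∀ s ∈ U, AEStronglyMeasurable (F s) μ)
    (hdiff : ∀ᵐ x ∂μ, DifferentiableOn ℂ (fun s => F s x) U)
    (hb : ∀ s₀ ∈ U, ∃ b : X → ℝ, Integrable b μ ∧ ∃ V ∈ 𝓝 s₀, ∀ᵐ x ∂μ, ∀ s ∈ V, ‖F s x‖ ≤ b x) :
    AnalyticOnNhd ℂ (fun s => ∫ x, F s x ∂μ) U := by
  refine analyticOnNhd_of_separately hU (fun z hz => ?_) fun z hz i => ?_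
  · obtain ⟨b, hbi, V, hV, hbV⟩ := hb z hz
    refine (continuousAt_of_dominated (bound := b) ?_ ?_ hbi ?_).continuousWithinAt
    · filter_upwards [hU.mem_nhds hz] with s hs using hmeas s hs
    · filter_upwards [hV] with s hs
      filter_upwards [hbV] with x hx using hx s hs
    · filter_upwards [hdiff] with x hx
      exact (hx.differentiableAt (hU.mem_nhds hz)).continuousAt
  · obtain ⟨b, hbi, V, hV, hbV⟩ := hb z hz
    obtain ⟨r, hr, hrUV⟩ := Metric.mem_nhds_iff.1 (inter_mem (hU.mem_nhds hz) hV)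
    have hr2 : 0 < r / 2 := by positivity
    have hmem : ∀ t ∈ ball (z i) r, update z i t ∈ U ∩ V := fun t ht => hrUV (update_mem_ball ht)
    have hzi : z i ∈ ball (z i) r := mem_ball_self hr
    have hself : update z i (z i) = z := update_eq_self i z
    have hdx : ∀ᵐ x ∂μ, DifferentiableOn ℂ (fun t => F (update z i t) x) (ball (z i) r) := by
      filter_upwards [hdiff] with x hx
      exact hx.comp (differentiable_update z i).differentiableOn fun t ht => (hmem t ht).1
    refine (hasDerivAt_integral_of_dominated_loc_of_deriv_le (s := ball (z i) (r / 2))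
      (F := fun t x => F (update z i t) x) (bound := fun x => b x / (r / 2))
      (F' := fun t x => deriv (fun t => F (update z i t) x) t)
      (ball_mem_nhds _ hr2) ?_ ?_ ?_ ?_ (hbi.div_const _) ?_).2.differentiableAt
    · filter_upwards [ball_mem_nhds _ hr] with t ht using hmeas _ (hmem t ht).1
    · refine hbi.mono' (hmeas _ (hmem _ hzi).1) ?_
      filter_upwards [hbV] with x hx using hx _ (hmem _ hzi).2
    · -- the derivative is a pointwise limit of difference quotients
      let δ : ℕ → ℝ := fun k => r / 2 / (k + 1)
      have hδ0 : ∀ k, 0 < δ k := fun k => by positivity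
      have hδ : Tendsto δ atTop (𝓝 0) := by
        have := (tendsto_one_div_add_atTop_nhds_zero_nat (𝕜 := ℝ)).const_mul (r / 2)
        simpa [δ, div_eq_mul_inv] using this
      have hδr : ∀ k, δ k < r := fun k => by
        have : δ k ≤ r / 2 := div_le_self hr2.le (by linarith [Nat.cast_nonneg (α := ℝ) k])
        linarith
      refine aestronglyMeasurable_of_tendsto_ae atTop
        (f := fun k x => (δ k : ℂ)⁻¹ • (F (update z i (z i + δ k)) x - F (update z i (z i)) x))
        (fun k => ?_) ?_
      · refine ((hmeas _ (hmem _ ?_).1).sub (hmeas _ (hmem _ hzi).1)).const_smul (δ k : ℂ)⁻¹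
        simp [dist_eq_norm, abs_of_pos (hδ0 k), hδr k]
      · filter_upwards [hdx] with x hx
        have h := (hx.differentiableAt (ball_mem_nhds _ hr)).hasDerivAt.tendsto_slope_zero
        refine h.comp (tendsto_nhdsWithin_iff.2 ⟨?_, Eventually.of_forall fun k => ?_⟩)
        · have := (Complex.continuous_ofReal.tendsto 0).comp hδ
          simpa [Function.comp_def] using this
        · simpa using (hδ0 k).ne'
    · filter_upwards [hdx, hbV] with x hx hbx t ht
      have hsub : closedBall t (r / 2) ⊆ ball (z i) r := fun y hy => by
        rw [mem_ball] at *
        linarith [dist_triangle y t (z i), mem_closedBall.1 hy]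
      refine Complex.norm_deriv_le_of_forall_mem_sphere_norm_le hr2 ?_ fun y hy => ?_
      · refine (hx.mono ?_).diffContOnCl
        rw [closure_ball _ hr2.ne']
        exact hsub
      · exact hbx _ (hmem y (hsub (sphere_subset_closedBall hy))).2
    · filter_upwards [hdx] with x hx t ht
      exact (hx.differentiableAt (isOpen_ball.mem_nhds
        (ball_subset_ball (by linarith) ht))).hasDerivAt

/-- The Weierstrass M-test for series of holomorphic functions of several variables. -/
theorem analyticOnNhd_tsum {ι : Type*} {m : ℕ} {U : Set (Fin m → ℂ)} (hU : IsOpen U)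
    {F : ι → (Fin m → ℂ) → ℂ} {u : ι → ℝ} (hu : Summable u)
    (hdiff : ∀ k, DifferentiableOn ℂ (F k) U) (hF : ∀ k, ∀ z ∈ U, ‖F k z‖ ≤ u k) :
    AnalyticOnNhd ℂ (fun z => ∑' k, F k z) U := by
  refine analyticOnNhd_of_separately hU
    (continuousOn_tsum (fun k => (hdiff k).continuousOn) hu hF) fun z hz i => ?_
  obtain ⟨r, hr, hrU⟩ := Metric.mem_nhds_iff.1 (hU.mem_nhds hz)
  have hmem : ∀ t ∈ ball (z i) r, update z i t ∈ U := fun t ht => hrU (update_mem_ball ht)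
  exact (Complex.differentiableOn_tsum_of_summable_norm hu
    (fun k => (hdiff k).comp (differentiable_update z i).differentiableOn hmem) isOpen_ball
    fun k t ht => hF k _ (hmem t ht)).differentiableAt (ball_mem_nhds _ hr)

/-! ### Meromorphic functions of several variables -/

section Meromorphic

variable {E : Type*} [NormedAddCommGroup E] [NormedSpace ℂ E] {f g : E → ℂ} {z : E}

/-- Meromorphy near a point, the local condition in `IsMeromorphicOn`. -/
def MeromorphicNear (f : E → ℂ) (z : E) : Prop :=
  ∃ g h : E → ℂ, AnalyticAt ℂ g z ∧ AnalyticAt ℂ h z ∧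
    (¬ ∀ᶠ w in 𝓝 z, h w = 0) ∧ ∀ᶠ w in 𝓝 z, h w ≠ 0 → f w = g w / h w

lemma _root_.AnalyticAt.not_eventually_mul_eq_zero (hf : AnalyticAt ℂ f z)
    (hg : AnalyticAt ℂ g z) (hf0 : ¬ ∀ᶠ w in 𝓝 z, f w = 0) (hg0 : ¬ ∀ᶠ w in 𝓝 z, g w = 0) :
    ¬ ∀ᶠ w in 𝓝 z, f w * g w = 0 := by
  intro h
  apply hg0
  obtain ⟨r, hr, hrh⟩ := Metric.eventually_nhds_iff_ball.1
    (h.and (hg.eventually_analyticAt.and hf.eventually_analyticAt))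
  obtain ⟨w, hw, hfw⟩ : ∃ w ∈ ball z r, f w ≠ 0 := by
    by_contra! hcon
    exact hf0 (Metric.eventually_nhds_iff_ball.2 ⟨r, hr, hcon⟩)
  have hgw : g =ᶠ[𝓝 w] 0 := by
    filter_upwards [isOpen_ball.mem_nhds hw,
      (hrh w hw).2.2.continuousAt.eventually_ne hfw] with y hy hfy
    exact (mul_eq_zero.1 (hrh y hy).1).resolve_left hfy
  have := AnalyticOnNhd.eqOn_zero_of_preconnected_of_eventuallyEq_zero
    (f := g) (U := ball z r) (fun y hy => (hrh y hy).2.1) isPreconnected_ball hw hgw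
  exact Metric.eventually_nhds_iff_ball.2 ⟨r, hr, fun y hy => this hy⟩

lemma _root_.AnalyticAt.meromorphicNear (hf : AnalyticAt ℂ f z) : MeromorphicNear f z :=
  ⟨f, fun _ => 1, hf, analyticAt_const, fun h => by simpa using h.self_of_nhds, by simp⟩

lemma MeromorphicNear.add (hf : MeromorphicNear f z) (hg : MeromorphicNear g z) :
    MeromorphicNear (fun w => f w + g w) z := by
  obtain ⟨a, b, ha, hb, hb0, hab⟩ := hf
  obtain ⟨c, d, hc, hd, hd0, hcd⟩ := hg
  refine ⟨fun w => a w * d w + b w * c w, fun w => b w * d w, (ha.mul hd).add (hb.mul hc),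
    hb.mul hd, hb.not_eventually_mul_eq_zero hd hb0 hd0, ?_⟩
  filter_upwards [hab, hcd] with w h1 h2 h
  have hb' := left_ne_zero_of_mul h
  have hd' := right_ne_zero_of_mul h
  rw [h1 hb', h2 hd', div_add_div _ _ hb' hd']

lemma MeromorphicNear.mul (hf : MeromorphicNear f z) (hg : MeromorphicNear g z) :
    MeromorphicNear (fun w => f w * g w) z := by
  obtain ⟨a, b, ha, hb, hb0, hab⟩ := hf
  obtain ⟨c, d, hc, hd, hd0, hcd⟩ := hg
  refine ⟨fun w => a w * c w, fun w => b w * d w, ha.mul hc,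
    hb.mul hd, hb.not_eventually_mul_eq_zero hd hb0 hd0, ?_⟩
  filter_upwards [hab, hcd] with w h1 h2 h
  rw [h1 (left_ne_zero_of_mul h), h2 (right_ne_zero_of_mul h), div_mul_div_comm]

lemma _root_.AnalyticAt.meromorphicNear_inv (hf : AnalyticAt ℂ f z) :
    MeromorphicNear (fun w => (f w)⁻¹) z := by
  by_cases h : ∀ᶠ w in 𝓝 z, f w = 0
  · refine ⟨fun _ => 0, fun _ => 1, analyticAt_const, analyticAt_const,
      fun h => by simpa using h.self_of_nhds, ?_⟩
    filter_upwards [h] with w hw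
    simp [hw]
  · exact ⟨fun _ => 1, f, analyticAt_const, hf, h, by simp⟩

lemma MeromorphicNear.sum {ι : Type*} {s : Finset ι} {F : ι → E → ℂ}
    (h : ∀ i ∈ s, MeromorphicNear (F i) z) : MeromorphicNear (fun w => ∑ i ∈ s, F i w) z := by
  classical
  induction s using Finset.induction_on with
  | empty => simpa using (analyticAt_const (𝕜 := ℂ) (v := (0 : ℂ)) (x := z)).meromorphicNear
  | insert i s hi ih =>
    simp only [Finset.sum_insert hi]
    exact (h i (by simp)).add (ih fun j hj => h j (by simp [hj]))

lemma MeromorphicNear.prod {ι : Type*} {s : Finset ι} {F : ι → E → ℂ}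
    (h : ∀ i ∈ s, MeromorphicNear (F i) z) : MeromorphicNear (fun w => ∏ i ∈ s, F i w) z := by
  classical
  induction s using Finset.induction_on with
  | empty => simpa using (analyticAt_const (𝕜 := ℂ) (v := (1 : ℂ)) (x := z)).meromorphicNear
  | insert i s hi ih =>
    simp only [Finset.prod_insert hi]
    exact (h i (by simp)).mul (ih fun j hj => h j (by simp [hj]))

/-- Changing a meromorphic function on the zero set of a nontrivial holomorphic function does not
affect its meromorphy. -/
lemma MeromorphicNear.congr_of_ne_zero (hf : MeromorphicNear f z) {H : E → ℂ}
    (hH : AnalyticAt ℂ H z) (hH0 : ¬ ∀ᶠ w in 𝓝 z, H w = 0)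
    (hfg : ∀ᶠ w in 𝓝 z, H w ≠ 0 → g w = f w) : MeromorphicNear g z := by
  obtain ⟨a, b, ha, hb, hb0, hab⟩ := hf
  refine ⟨fun w => a w * H w, fun w => b w * H w, ha.mul hH, hb.mul hH,
    hb.not_eventually_mul_eq_zero hH hb0 hH0, ?_⟩
  filter_upwards [hab, hfg] with w h1 h2 h
  rw [h2 (right_ne_zero_of_mul h), h1 (left_ne_zero_of_mul h),
    mul_div_mul_right _ _ (right_ne_zero_of_mul h)]

end Meromorphic

/-- The complement of a countable set in a half-plane is connected. -/
lemma isPreconnected_halfPlane_diff_countable (c : ℝ) {S : Set ℂ} (hS : S.Countable) :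
    IsPreconnected ({t : ℂ | c < t.re} \ S) := by
  let φ : ℂ → ℂ := fun w => ((c + Real.exp w.re : ℝ) : ℂ) + (w.im : ℂ) * Complex.I
  have hre : ∀ w, (φ w).re = c + Real.exp w.re := fun w => by
    simp [φ, -Complex.ofReal_exp]
  have him : ∀ w, (φ w).im = w.im := fun w => by simp [φ]
  have hinj : Injective φ := fun w w' h => by
    have h1 := congrArg Complex.re h
    have h2 := congrArg Complex.im h
    rw [hre, hre] at h1
    rw [him, him] at h2
    exact Complex.ext (Real.exp_injective (by linarith)) h2
  have hcont : Continuous φ := by fun_prop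
  have himg : φ '' (φ ⁻¹' S)ᶜ = {t : ℂ | c < t.re} \ S := by
    ext t
    constructor
    · rintro ⟨w, hw, rfl⟩
      refine ⟨?_, hw⟩
      change c < (φ w).re
      rw [hre]
      linarith [Real.exp_pos w.re]
    · rintro ⟨ht, htS⟩
      have : φ ⟨Real.log (t.re - c), t.im⟩ = t := Complex.ext
        (by rw [hre, Real.exp_log (by simpa using ht)]; ring) (him _)
      exact ⟨_, by simpa [this] using htS, this⟩
  rw [← himg]
  refine (Set.Countable.isConnected_compl_of_one_lt_rank ?_
    (hS.preimage hinj)).isPreconnected.image _ hcont.continuousOn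
  rw [Complex.rank_real_complex]
  exact Cardinal.one_lt_two

/-! ### Products of series -/

lemma summable_pi_prod_norm {ι : Type*} {m : ℕ} {f : Fin m → ι → ℂ}
    (hf : ∀ i, Summable fun k => ‖f i k‖) :
    Summable fun p : Fin m → ι => ‖∏ i, f i (p i)‖ := by
  induction m with
  | zero => exact (hasSum_fintype _).summable
  | succ m ih =>
    rw [← (Fin.consEquiv fun _ : Fin (m + 1) => ι).summable_iff]
    have := (hf 0).mul_norm (ih fun i => hf i.succ)
    simpa [Function.comp_def, Fin.consEquiv, Fin.prod_univ_succ] using this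

lemma hasSum_pi_prod {ι : Type*} {m : ℕ} {f : Fin m → ι → ℂ}
    (hf : ∀ i, Summable fun k => ‖f i k‖) :
    HasSum (fun p : Fin m → ι => ∏ i, f i (p i)) (∏ i, ∑' k, f i k) := by
  induction m with
  | zero => simp
  | succ m ih =>
    have h1 := (summable_pi_prod_norm hf).of_norm
    rw [← (Fin.consEquiv fun _ : Fin (m + 1) => ι).hasSum_iff, Fin.prod_univ_succ,
      ← (ih fun i => hf i.succ).tsum_eq, tsum_mul_tsum_of_summable_norm (hf 0)
        (summable_pi_prod_norm fun i => hf i.succ)]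
    have h2 := ((Fin.consEquiv fun _ : Fin (m + 1) => ι).summable_iff.2 h1).hasSum
    have h3 : ((fun p : Fin (m + 1) → ι => ∏ i, f i (p i)) ∘ Fin.consEquiv fun _ => ι) =
        fun z : ι × (Fin m → ι) => f 0 z.1 * ∏ i, f i.succ (z.2 i) := by
      ext z
      simp [Fin.consEquiv, Fin.prod_univ_succ]
    rw [h3] at h2 ⊢
    exact h2

lemma hasSum_sum_piAntidiag {m : ℕ} {g : (Fin m → ℕ) → ℂ} {a : ℂ} (hg : HasSum g a) :
    HasSum (fun K => ∑ p ∈ Finset.piAntidiag Finset.univ K, g p) a := by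
  have h := hg.tsum_fiberwise fun p => ∑ i, p i
  suffices hK : ∀ K, ∑ p ∈ Finset.piAntidiag Finset.univ K, g p =
      ∑' b : ((fun p : Fin m → ℕ => ∑ i, p i) ⁻¹' {K}), g b by
    simpa only [hK] using h
  intro K
  rw [← Finset.tsum_subtype]
  have : ((fun p : Fin m → ℕ => ∑ i, p i) ⁻¹' {K}) =
      ((Finset.piAntidiag Finset.univ K : Finset (Fin m → ℕ)) : Set (Fin m → ℕ)) := by
    ext p; simp
  rw [this]
  rfl

lemma summable_sum_piAntidiag {m : ℕ} {g : (Fin m → ℕ) → ℝ} (hg : Summable g) :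
    Summable (fun K => ∑ p ∈ Finset.piAntidiag Finset.univ K, g p) := by
  have h1 : Summable fun p => (g p : ℂ) := Complex.summable_ofReal.2 hg
  have h2 := (hasSum_sum_piAntidiag h1.hasSum).summable
  refine Complex.summable_ofReal.1 ?_
  simpa using h2

/-! ### The function `y / (e^y - 1)` -/

/-- The Taylor coefficient `B_n / n!` of `y / (e^y - 1)`. -/
noncomputable def toddCoeff (n : ℕ) : ℂ := (bernoulli n : ℂ) / (n.factorial : ℂ)

/-- The recursion of the Bernoulli numbers, that is `(y / (e^y - 1)) * ((e^y - 1) / y) = 1`. -/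
lemma sum_toddCoeff (n : ℕ) :
    ∑ k ∈ Finset.range (n + 1), toddCoeff k * (((n + 1 - k).factorial : ℂ))⁻¹ =
      if n = 0 then 1 else 0 := by
  have h := congrArg (fun q : ℚ => (q : ℂ)) (sum_bernoulli (n + 1))
  have hf : ((n + 1).factorial : ℂ) ≠ 0 := by exact_mod_cast (n + 1).factorial_ne_zero
  rw [← mul_right_inj' hf, Finset.mul_sum]
  simp only [Rat.cast_sum, Rat.cast_mul, Rat.cast_natCast] at h
  have h2 : ∀ k ∈ Finset.range (n + 1), ((n + 1).factorial : ℂ) *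
      (toddCoeff k * (((n + 1 - k).factorial : ℂ))⁻¹) =
      ((n + 1).choose k : ℂ) * (bernoulli k : ℂ) := by
    intro k hk
    have hk' : k ≤ n + 1 := by have := Finset.mem_range.1 hk; omega
    rw [← Nat.choose_mul_factorial_mul_factorial hk', toddCoeff]
    have h3 : (k.factorial : ℂ) ≠ 0 := by exact_mod_cast k.factorial_ne_zero
    have h4 : ((n + 1 - k).factorial : ℂ) ≠ 0 := by exact_mod_cast (n + 1 - k).factorial_ne_zero
    push_cast
    field_simp
  rw [Finset.sum_congr rfl h2, h]
  rcases eq_or_ne n 0 with rfl | hn <;> simp [*]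

lemma factorial_add_two_ge (m : ℕ) : 2 * 3 ^ m ≤ (m + 2).factorial := by
  induction m with
  | zero => simp
  | succ m ih =>
    rw [Nat.factorial_succ, pow_succ]
    nlinarith [Nat.zero_le (m * (m + 2).factorial)]

/-- Any exponential rate `< 1` would do; `5/6` comes out of the recursion since
`∑_{m ≥ 1} (6/5)^m / (m+1)! ≤ ∑_{m ≥ 1} (6/5)^m / (2 · 3^(m-1)) = 1`. -/
lemma norm_toddCoeff_le (n : ℕ) : ‖toddCoeff n‖ ≤ (5 / 6 : ℝ) ^ n := by
  induction n using Nat.strong_induction_on with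
  | _ n ih =>
    rcases Nat.eq_zero_or_pos n with rfl | hn
    · simp [toddCoeff]
    have h := sum_toddCoeff n
    rw [if_neg hn.ne', Finset.sum_range_succ] at h
    have h1 : toddCoeff n = -∑ k ∈ Finset.range n,
        toddCoeff k * (((n + 1 - k).factorial : ℂ))⁻¹ := by
      have : n + 1 - n = 1 := by omega
      rw [this] at h
      simp only [Nat.factorial_one, Nat.cast_one, inv_one, mul_one] at h
      linear_combination h
    rw [h1, norm_neg]
    calc ‖∑ k ∈ Finset.range n, toddCoeff k * (((n + 1 - k).factorial : ℂ))⁻¹‖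
        ≤ ∑ k ∈ Finset.range n, (5 / 6 : ℝ) ^ n * (3 / 5) * (2 / 5) ^ (n - 1 - k) := by
          refine norm_sum_le_of_le _ fun k hk => ?_
          have hk' := Finset.mem_range.1 hk
          obtain ⟨j, rfl⟩ : ∃ j, n = k + 1 + j := ⟨n - k - 1, by omega⟩
          rw [norm_mul, norm_inv, Complex.norm_natCast]
          have e1 : k + 1 + j + 1 - k = j + 2 := by omega
          have e2 : k + 1 + j - 1 - k = j := by omega
          rw [e1, e2]
          have h3 : (2 * 3 ^ j : ℝ) ≤ ((j + 2).factorial : ℝ) := by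
            exact_mod_cast factorial_add_two_ge j
          have h4 : (((j + 2).factorial : ℝ))⁻¹ ≤ (2 * 3 ^ j)⁻¹ := inv_anti₀ (by positivity) h3
          refine (mul_le_mul (ih k (by omega)) h4 (by positivity) (by positivity)).trans_eq ?_
          have e3 : (2 / 5 : ℝ) ^ j * (5 / 6) ^ j = (3 ^ j)⁻¹ := by
            rw [← mul_pow, ← inv_pow]; norm_num
          rw [mul_inv, ← e3, pow_add, pow_add]
          ring
      _ = (5 / 6 : ℝ) ^ n * (3 / 5 * ∑ k ∈ Finset.range n, (2 / 5 : ℝ) ^ k) := by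
          rw [← Finset.mul_sum, Finset.sum_range_reflect (fun k => (2 / 5 : ℝ) ^ k) n]
          ring
      _ ≤ (5 / 6 : ℝ) ^ n * 1 := by
          refine mul_le_mul_of_nonneg_left ?_ (by positivity)
          rw [geom_sum_eq (by norm_num)]
          have : (0 : ℝ) ≤ (2 / 5) ^ n := by positivity
          norm_num
          linarith
      _ = _ := mul_one _

/-- The holomorphic extension of `todd`. -/
noncomputable def toddC (y : ℂ) : ℂ := if y = 0 then 1 else y / (Complex.exp y - 1)

lemma toddC_ofReal (y : ℝ) : toddC (y : ℂ) = (todd y : ℂ) := by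
  unfold toddC todd
  split_ifs with h1 h2 h2
  · simp
  · exact absurd (Complex.ofReal_eq_zero.1 h1) h2
  · exact absurd (by simp [h2]) h1
  · push_cast; rfl

lemma toddC_eq_inv_dslope (y : ℂ) : toddC y = (dslope Complex.exp 0 y)⁻¹ := by
  unfold toddC
  split_ifs with h
  · simp [h, dslope_same]
  · rw [dslope_of_ne _ h, slope_def_field]
    simp

lemma differentiable_dslope_exp : Differentiable ℂ (dslope Complex.exp 0) := by
  rw [← differentiableOn_univ, Complex.differentiableOn_dslope univ_mem]
  exact Complex.differentiable_exp.differentiableOn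

/-- The domain of holomorphy of `y / (e^y - 1)`. -/
def toddDomain : Set ℂ := {y | dslope Complex.exp 0 y ≠ 0}

lemma isOpen_toddDomain : IsOpen toddDomain :=
  isOpen_ne_fun differentiable_dslope_exp.continuous continuous_const

lemma analyticAt_toddC {y : ℂ} (hy : y ∈ toddDomain) : AnalyticAt ℂ toddC y := by
  rw [show toddC = fun y => (dslope Complex.exp 0 y)⁻¹ from funext toddC_eq_inv_dslope]
  exact (differentiable_dslope_exp.analyticAt y).inv hy

lemma mem_toddDomain {y : ℂ} (hy : |y.im| < 2 * Real.pi) : y ∈ toddDomain := by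
  rcases eq_or_ne y 0 with rfl | h
  · simp [toddDomain, dslope_same]
  · intro h0
    rw [dslope_of_ne _ h, slope_def_field] at h0
    have h1 : Complex.exp y = 1 := by
      rcases div_eq_zero_iff.1 h0 with h2 | h2
      · simpa [sub_eq_zero] using h2
      · exact absurd (by simpa using h2) h
    obtain ⟨k, hk⟩ := Complex.exp_eq_one_iff.1 h1
    have him : y.im = k * (2 * Real.pi) := by rw [hk]; simp
    rw [him, abs_mul, abs_of_pos Real.two_pi_pos] at hy
    have hk1 : |(k : ℝ)| < 1 := by
      by_contra! hcon
      nlinarith [Real.two_pi_pos]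
    have : k = 0 := by
      rw [← Int.cast_abs] at hk1
      exact Int.abs_lt_one_iff.1 (by exact_mod_cast hk1)
    exact h (by rw [hk, this]; simp)

lemma summable_norm_toddCoeff {y : ℂ} (hy : ‖y‖ < 6 / 5) :
    Summable fun n => ‖toddCoeff n * y ^ n‖ := by
  refine Summable.of_nonneg_of_le (fun _ => norm_nonneg _) (fun n => ?_)
    (summable_geometric_of_lt_one (r := 5 / 6 * ‖y‖) (by positivity) (by linarith))
  rw [norm_mul, norm_pow, mul_pow]
  exact mul_le_mul_of_nonneg_right (norm_toddCoeff_le n) (by positivity)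

lemma tsum_toddCoeff {y : ℂ} (hy : ‖y‖ < 6 / 5) : ∑' n, toddCoeff n * y ^ n = toddC y := by
  rcases eq_or_ne y 0 with rfl | h
  · rw [tsum_eq_single 0 fun n hn => by simp [hn]]
    simp [toddC, toddCoeff]
  have hexp := NormedSpace.expSeries_div_hasSum_exp y
  rw [← Complex.exp_eq_exp_ℂ] at hexp
  have hexp1 : HasSum (fun m : ℕ => y ^ (m + 1) / ((m + 1).factorial : ℂ)) (Complex.exp y - 1) := by
    have := (hasSum_nat_add_iff' (f := fun m : ℕ => y ^ m / (m.factorial : ℂ)) 1).2 hexp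
    simpa using this
  have hexp2 : HasSum (fun m : ℕ => y ^ m * (((m + 1).factorial : ℂ))⁻¹)
      ((Complex.exp y - 1) / y) := by
    have hm : ∀ m : ℕ, y ^ (m + 1) / ((m + 1).factorial : ℂ) / y =
        y ^ m * (((m + 1).factorial : ℂ))⁻¹ := fun m => by
      rw [pow_succ]
      field_simp
    simpa only [hm] using hexp1.div_const y
  have hnorm2 : Summable fun m : ℕ => ‖y ^ m * (((m + 1).factorial : ℂ))⁻¹‖ := hexp2.summable.norm
  have hprod := tsum_mul_tsum_eq_tsum_sum_antidiagonal_of_summable_norm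
    (summable_norm_toddCoeff hy) hnorm2
  have hone : ∑' n, ∑ kl ∈ Finset.HasAntidiagonal.antidiagonal n, toddCoeff kl.1 * y ^ kl.1 *
      (y ^ kl.2 * (((kl.2 + 1).factorial : ℂ))⁻¹) = 1 := by
    have hterm : ∀ n, ∑ kl ∈ Finset.HasAntidiagonal.antidiagonal n, toddCoeff kl.1 * y ^ kl.1 *
        (y ^ kl.2 * (((kl.2 + 1).factorial : ℂ))⁻¹) = y ^ n * if n = 0 then 1 else 0 := by
      intro n
      rw [← sum_toddCoeff n, Finset.mul_sum, Finset.Nat.sum_antidiagonal_eq_sum_range_succ_mk]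
      refine Finset.sum_congr rfl fun k hk => ?_
      have hk' := Finset.mem_range.1 hk
      have e1 : n - k + 1 = n + 1 - k := by omega
      have e2 : y ^ n = y ^ k * y ^ (n - k) := by rw [← pow_add]; congr 1; omega
      rw [e1, e2]
      ring
    simp_rw [hterm]
    rw [tsum_eq_single 0 fun n hn => by simp [hn]]
    simp
  rw [hone, hexp2.tsum_eq] at hprod
  rw [toddC, if_neg h, eq_comm, ← inv_div, inv_eq_iff_eq_inv]
  exact (eq_inv_of_mul_eq_one_right hprod)

/-! ### Partial products and tail sums -/

lemma prod_Iic_eq_prod_ite {M : Type*} [CommMonoid M] {m : ℕ} (q : Fin m → M) (i : Fin m) :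
    ∏ l ∈ Finset.Iic i, q l = ∏ l, if l ≤ i then q l else 1 := by
  rw [← Finset.prod_filter]
  congr 1
  ext l
  simp

lemma sum_Iic_eq_sum_ite {M : Type*} [AddCommMonoid M] {m : ℕ} (q : Fin m → M) (i : Fin m) :
    ∑ l ∈ Finset.Iic i, q l = ∑ l, if l ≤ i then q l else 0 := by
  rw [← Finset.sum_filter]
  congr 1
  ext l
  simp

lemma tailSum_eq_sum_ite {M : Type*} [AddCommMonoid M] {e : ℕ} (q : Fin (e + 1) → M)
    (i : Fin (e + 1)) : tailSum q i = ∑ l, if i ≤ l then q l else 0 := by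
  rw [tailSum, ← Finset.sum_filter]
  congr 1
  ext l
  simp

lemma prod_Iic_succ {M : Type*} [CommMonoid M] {m : ℕ} (q : Fin (m + 1) → M) (i : Fin m) :
    ∏ l ∈ Finset.Iic i.succ, q l = q 0 * ∏ l ∈ Finset.Iic i, q l.succ := by
  rw [prod_Iic_eq_prod_ite, prod_Iic_eq_prod_ite, Fin.prod_univ_succ]
  simp

lemma sum_Iic_succ {M : Type*} [AddCommMonoid M] {m : ℕ} (q : Fin (m + 1) → M) (i : Fin m) :
    ∑ l ∈ Finset.Iic i.succ, q l = q 0 + ∑ l ∈ Finset.Iic i, q l.succ := by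
  rw [sum_Iic_eq_sum_ite, sum_Iic_eq_sum_ite, Fin.sum_univ_succ]
  simp

lemma prod_Iic_zero {M : Type*} [CommMonoid M] {m : ℕ} (q : Fin (m + 1) → M) :
    ∏ l ∈ Finset.Iic 0, q l = q 0 := by
  rw [prod_Iic_eq_prod_ite, Fin.prod_univ_succ]
  simp

lemma sum_Iic_zero {M : Type*} [AddCommMonoid M] {m : ℕ} (q : Fin (m + 1) → M) :
    ∑ l ∈ Finset.Iic 0, q l = q 0 := by
  rw [sum_Iic_eq_sum_ite, Fin.sum_univ_succ]
  simp

lemma tailSum_zero {M : Type*} [AddCommMonoid M] {e : ℕ} (q : Fin (e + 1) → M) :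
    tailSum q 0 = ∑ l, q l := by
  rw [tailSum_eq_sum_ite]
  simp

lemma tailSum_succ {M : Type*} [AddCommMonoid M] {e : ℕ} (q : Fin (e + 2) → M)
    (i : Fin (e + 1)) : tailSum q i.succ = tailSum (fun l => q l.succ) i := by
  rw [tailSum_eq_sum_ite, tailSum_eq_sum_ite, Fin.sum_univ_succ]
  simp

lemma prod_prod_Iic_pow {M : Type*} [CommMonoid M] {e : ℕ} (q : Fin (e + 1) → M)
    (p : Fin (e + 1) → ℕ) :
    ∏ i, (∏ l ∈ Finset.Iic i, q l) ^ p i = ∏ l, q l ^ tailSum p l := by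
  simp_rw [prod_Iic_eq_prod_ite, tailSum_eq_sum_ite, ← Finset.prod_pow,
    ← Finset.prod_pow_eq_pow_sum]
  rw [Finset.prod_comm]
  refine Finset.prod_congr rfl fun l _ => Finset.prod_congr rfl fun i _ => ?_
  split_ifs <;> simp

/-! ### The Taylor expansion of the product of `y / (e^y - 1)` in the first variable -/

/-- The coefficient of `x₁^K` in the Taylor expansion of the product of the functions
`y / (e^y - 1)` at `y = x₁ t₂ ⋯ t_j`, `j = 1, …, d`. -/
noncomputable def toddPoly {e : ℕ} (K : ℕ) (t : Fin e → ℂ) : ℂ :=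
  ∑ p ∈ Finset.piAntidiag (Finset.univ : Finset (Fin (e + 1))) K,
    bernoulliCoeff p * ∏ i : Fin e, t i ^ tailSum p i.succ

/-- The remainder of the Taylor expansion, divided by `x₁^N`. -/
noncomputable def toddRem {e : ℕ} (N : ℕ) (c : ℂ) (t : Fin e → ℂ) : ℂ :=
  ∑' k : ℕ, c ^ k * toddPoly (k + N) t

/-- The full product of the functions `y / (e^y - 1)`, `y = x₁ t₂ ⋯ t_j`, `j = 1, …, d`. -/
noncomputable def toddProd {e : ℕ} (c : ℂ) (t : Fin e → ℂ) : ℂ :=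
  toddC c * ∏ i : Fin e, toddC (c * ∏ l ∈ Finset.Iic i, t l)

lemma phiTerm_eq {e : ℕ} (n : Fin (e + 1) → ℕ) (a : Fin e → Fin 2) (x₁ : ℝ) (x : Fin e → ℝ)
    (k : ℕ) : phiTerm n a x₁ x k =
      (x₁ : ℂ) ^ k * toddPoly (k + (n 0 + 1)) fun i => (tVar a x i : ℂ) := by
  rw [phiTerm, toddPoly, Finset.mul_sum]
  refine Finset.sum_congr rfl fun p _ => ?_
  ring

lemma bernoulliCoeff_eq {e : ℕ} (p : Fin (e + 1) → ℕ) :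
    bernoulliCoeff p = ∏ i, toddCoeff (p i) := by
  simp [bernoulliCoeff, toddCoeff, Finset.prod_div_distrib]

lemma exists_toddRadius (e : ℕ) : ∃ r : ℝ, 1 < r ∧ r ^ (e + 1) < 6 / 5 := by
  have h : ContinuousAt (fun r : ℝ => r ^ (e + 1)) 1 := by fun_prop
  have h1 : ∀ᶠ r in 𝓝 (1 : ℝ), r ^ (e + 1) < 6 / 5 :=
    h.eventually_lt continuousAt_const (by norm_num)
  obtain ⟨r, hr, hr'⟩ := ((h1.filter_mono nhdsWithin_le_nhds).and
    (self_mem_nhdsWithin (s := Ioi (1 : ℝ)))).exists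
  exact ⟨r, hr', hr⟩

/-- A radius `r > 1` such that the Taylor expansion converges on the polydisc of radius `r`: if all
variables are bounded by `r` then `|x₁ t₂ ⋯ t_j| ≤ r^d < 6/5`, where the Taylor series of
`y / (e^y - 1)` is controlled by `norm_toddCoeff_le`. -/
noncomputable def toddRadius (e : ℕ) : ℝ := (exists_toddRadius e).choose

lemma one_lt_toddRadius (e : ℕ) : 1 < toddRadius e := (exists_toddRadius e).choose_spec.1

lemma toddRadius_pow_lt (e : ℕ) : toddRadius e ^ (e + 1) < 6 / 5 :=
  (exists_toddRadius e).choose_spec.2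

/-- A summable majorant of the terms of the Taylor expansion on the polydisc of radius
`toddRadius e`. -/
noncomputable def toddMajorant (e K : ℕ) : ℝ :=
  ∑ p ∈ Finset.piAntidiag (Finset.univ : Finset (Fin (e + 1))) K,
    ∏ i, (5 / 6 * toddRadius e ^ (e + 1)) ^ p i

lemma summable_toddMajorant (e : ℕ) : Summable (toddMajorant e) := by
  refine summable_sum_piAntidiag ?_
  have h0 : (0 : ℝ) < toddRadius e := by linarith [one_lt_toddRadius e]
  have h1 : 5 / 6 * toddRadius e ^ (e + 1) < 1 := by linarith [toddRadius_pow_lt e]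
  have h := summable_pi_prod_norm (m := e + 1)
    (f := fun _ k => ((5 / 6 * toddRadius e ^ (e + 1) : ℝ) : ℂ) ^ k) (fun _ => by
      refine (summable_geometric_of_lt_one (by positivity) h1).congr fun k => ?_
      rw [norm_pow, Complex.norm_real, Real.norm_of_nonneg (by positivity)])
  refine h.congr fun p => ?_
  rw [norm_prod]
  refine Finset.prod_congr rfl fun i _ => ?_
  rw [norm_pow, Complex.norm_real, Real.norm_of_nonneg (by positivity)]

lemma tailSum_le_sum {e : ℕ} (p : Fin (e + 1) → ℕ) (i : Fin (e + 1)) :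
    tailSum p i ≤ ∑ l, p l :=
  Finset.sum_le_sum_of_subset (Finset.subset_univ _)

/-- All exponents in `toddPoly K` are at most `K`, so that the `d` variables contribute at most
`r^{d K}`. -/
lemma norm_toddPoly_mul_le {e : ℕ} (K : ℕ) {t : Fin e → ℂ} (ht : ∀ i, ‖t i‖ ≤ toddRadius e) :
    ‖toddPoly K t‖ * toddRadius e ^ K ≤ toddMajorant e K := by
  have h1 := one_lt_toddRadius e
  set r := toddRadius e with hr
  have h0 : 0 < r := by linarith
  rw [toddPoly, toddMajorant, ← hr]
  refine (mul_le_mul_of_nonneg_right (norm_sum_le _ _) (by positivity)).trans ?_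
  rw [Finset.sum_mul]
  refine Finset.sum_le_sum fun p hp => ?_
  have hK : ∑ i, p i = K := by simpa using hp
  rw [norm_mul, bernoulliCoeff_eq, norm_prod, norm_prod]
  have hA : ∏ i, ‖toddCoeff (p i)‖ ≤ ∏ i, (5 / 6 : ℝ) ^ p i :=
    Finset.prod_le_prod (fun _ _ => norm_nonneg _) fun i _ => norm_toddCoeff_le (p i)
  have hB : ∏ i : Fin e, ‖t i ^ tailSum p i.succ‖ ≤ (r ^ K) ^ e := by
    calc ∏ i : Fin e, ‖t i ^ tailSum p i.succ‖ ≤ ∏ _i : Fin e, r ^ K := by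
          refine Finset.prod_le_prod (fun _ _ => norm_nonneg _) fun i _ => ?_
          rw [norm_pow]
          exact (pow_le_pow_left₀ (norm_nonneg _) (ht i) _).trans
            (pow_le_pow_right₀ h1.le (hK ▸ tailSum_le_sum p i.succ))
      _ = _ := by simp
  calc _ ≤ (∏ i, (5 / 6 : ℝ) ^ p i) * (r ^ K) ^ e * r ^ K := by
        refine mul_le_mul_of_nonneg_right (mul_le_mul hA hB ?_ ?_) (by positivity)
        · exact Finset.prod_nonneg fun _ _ => norm_nonneg _
        · positivity
    _ = _ := by
        have h2 : (r ^ K) ^ e * r ^ K = ∏ i, (r ^ (e + 1)) ^ p i := by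
          rw [Finset.prod_pow_eq_pow_sum, hK, ← pow_mul, ← pow_mul, ← pow_add]
          congr 1
          ring
        rw [mul_assoc, h2, ← Finset.prod_mul_distrib]
        simp_rw [mul_pow]

lemma norm_pow_mul_toddPoly_le {e : ℕ} (k N : ℕ) {c : ℂ} (hc : ‖c‖ ≤ toddRadius e)
    {t : Fin e → ℂ} (ht : ∀ i, ‖t i‖ ≤ toddRadius e) :
    ‖c ^ k * toddPoly (k + N) t‖ ≤ toddMajorant e (k + N) := by
  have h1 := one_lt_toddRadius e
  refine le_trans ?_ (norm_toddPoly_mul_le (k + N) ht)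
  rw [norm_mul, norm_pow, mul_comm]
  refine mul_le_mul_of_nonneg_left ?_ (norm_nonneg _)
  exact (pow_le_pow_left₀ (norm_nonneg _) hc k).trans (pow_le_pow_right₀ h1.le (by omega))

lemma summable_toddRem {e : ℕ} (N : ℕ) {c : ℂ} (hc : ‖c‖ ≤ toddRadius e)
    {t : Fin e → ℂ} (ht : ∀ i, ‖t i‖ ≤ toddRadius e) :
    Summable fun k => c ^ k * toddPoly (k + N) t :=
  Summable.of_norm_bounded ((summable_nat_add_iff N).2 (summable_toddMajorant e))
    fun k => norm_pow_mul_toddPoly_le k N hc ht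

/-- The remainder is jointly analytic on a polydisc of radius `> 1`. -/
lemma analyticOnNhd_toddRem (e N : ℕ) :
    AnalyticOnNhd ℂ (fun q : Fin (e + 1) → ℂ => toddRem N (q 0) fun i : Fin e => q i.succ)
      (ball 0 (toddRadius e)) := by
  have h0 : 0 < toddRadius e := by linarith [one_lt_toddRadius e]
  refine analyticOnNhd_tsum isOpen_ball ((summable_nat_add_iff N).2 (summable_toddMajorant e))
    (fun k => Differentiable.differentiableOn ?_) fun k q hq => ?_
  · unfold toddPoly
    fun_prop
  · have hq' : ∀ i, ‖q i‖ ≤ toddRadius e := fun i =>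
      (norm_le_pi_norm q i).trans (mem_ball_zero_iff.1 hq).le
    exact norm_pow_mul_toddPoly_le k N (hq' 0) fun i => hq' i.succ

/-- Since `p_j` occurs as the exponent of `w_j = x₁ t₂ ⋯ t_j`, the exponent of `t_j` is
`p_j + ⋯ + p_d`. -/
lemma hasSum_toddProd {e : ℕ} {c : ℂ} (hc : ‖c‖ ≤ toddRadius e)
    {t : Fin e → ℂ} (ht : ∀ i, ‖t i‖ ≤ toddRadius e) :
    HasSum (fun K => c ^ K * toddPoly K t) (toddProd c t) := by
  have h1 := one_lt_toddRadius e
  have h0 : 0 ≤ toddRadius e := by linarith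
  let q : Fin (e + 1) → ℂ := Fin.cons c t
  have hq : ∀ i, ‖q i‖ ≤ toddRadius e := fun i => by
    refine Fin.cases ?_ (fun j => ?_) i
    · simpa [q] using hc
    · simpa [q] using ht j
  have hw : ∀ i, ‖∏ l ∈ Finset.Iic i, q l‖ < 6 / 5 := fun i => by
    refine lt_of_le_of_lt ?_ (toddRadius_pow_lt e)
    rw [norm_prod]
    refine (Finset.prod_le_prod (fun _ _ => norm_nonneg _) fun l _ => hq l).trans ?_
    rw [Finset.prod_const, Fin.card_Iic]
    exact pow_le_pow_right₀ h1.le (by omega)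
  have h := hasSum_sum_piAntidiag (hasSum_pi_prod
    (f := fun (i : Fin (e + 1)) k => toddCoeff k * (∏ l ∈ Finset.Iic i, q l) ^ k)
    fun i => summable_norm_toddCoeff (hw i))
  have hlim : ∏ i, ∑' k, toddCoeff k * (∏ l ∈ Finset.Iic i, q l) ^ k = toddProd c t := by
    simp_rw [tsum_toddCoeff (hw _)]
    rw [Fin.prod_univ_succ, prod_Iic_zero, toddProd]
    simp [prod_Iic_succ, q]
  rw [hlim] at h
  have hterm : ∀ K, ∑ p ∈ Finset.piAntidiag Finset.univ K,
      ∏ i, toddCoeff (p i) * (∏ l ∈ Finset.Iic i, q l) ^ p i = c ^ K * toddPoly K t := fun K => by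
    rw [toddPoly, Finset.mul_sum]
    refine Finset.sum_congr rfl fun p hp => ?_
    have hK : ∑ i, p i = K := by simpa using hp
    rw [Finset.prod_mul_distrib, prod_prod_Iic_pow, ← bernoulliCoeff_eq, Fin.prod_univ_succ,
      tailSum_zero, hK]
    simp only [q, Fin.cons_zero, Fin.cons_succ]
    ring
  simpa only [hterm] using h

lemma toddProd_eq {e : ℕ} (N : ℕ) {c : ℂ} (hc : ‖c‖ ≤ toddRadius e)
    {t : Fin e → ℂ} (ht : ∀ i, ‖t i‖ ≤ toddRadius e) :
    toddProd c t = ∑ k ∈ Finset.range N, c ^ k * toddPoly k t + c ^ N * toddRem N c t := by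
  have h := hasSum_toddProd hc ht
  rw [← h.tsum_eq, ← h.summable.sum_add_tsum_nat_add N, toddRem, ← tsum_mul_left]
  congr 1
  refine tsum_congr fun k => ?_
  rw [pow_add]
  ring

/-! ### Absolute convergence of the Euler–Zagier series -/

/-- The absolute value of the general term, with all partial sums shifted by `N`. -/
noncomputable def zetaBound {m : ℕ} (σ : Fin m → ℝ) (N : ℕ) (k : Fin m → ℕ) : ℝ :=
  ∏ i, ((N + ∑ l ∈ Finset.Iic i, (k l + 1) : ℕ) : ℝ) ^ (-σ i)

lemma zetaBound_nonneg {m : ℕ} (σ : Fin m → ℝ) (N : ℕ) (k : Fin m → ℕ) :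
    0 ≤ zetaBound σ N k :=
  Finset.prod_nonneg fun _ _ => Real.rpow_nonneg (Nat.cast_nonneg _) _

lemma zetaBound_cons {m : ℕ} (σ : Fin (m + 1) → ℝ) (N k₀ : ℕ) (k : Fin m → ℕ) :
    zetaBound σ N (Fin.cons k₀ k) =
      ((N + k₀ + 1 : ℕ) : ℝ) ^ (-σ 0) * zetaBound (fun i => σ i.succ) (N + k₀ + 1) k := by
  rw [zetaBound, Fin.prod_univ_succ, sum_Iic_zero, zetaBound]
  simp [sum_Iic_succ, add_assoc]

/-- Summation over the first variable of the Euler–Zagier series. -/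
lemma exists_zetaBound_step {m : ℕ} {σ : Fin (m + 1) → ℝ} {C' β β' : ℝ} (hC' : 0 ≤ C')
    (hβ : 0 ≤ β) (hβ' : 0 ≤ β') (h : 1 + β < σ 0 + β')
    (hin : ∀ N : ℕ, Summable (zetaBound (fun i => σ i.succ) N) ∧
      ∑' k, zetaBound (fun i => σ i.succ) N k ≤ C' * ((N : ℝ) + 1) ^ (-β')) :
    ∃ C, 0 ≤ C ∧ ∀ N : ℕ, Summable (zetaBound σ N) ∧
      ∑' k, zetaBound σ N k ≤ C * ((N : ℝ) + 1) ^ (-β) := by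
  set ε := σ 0 + β' - β - 1 with hε
  have hε0 : 0 < ε := by linarith
  have hsum : Summable fun k : ℕ => ((k : ℝ) + 1) ^ (-(1 + ε)) := by
    have := (summable_nat_add_iff 1).2
      (Real.summable_nat_rpow (p := -(1 + ε)) |>.2 (by linarith))
    simpa using this
  refine ⟨C' * ∑' k : ℕ, ((k : ℝ) + 1) ^ (-(1 + ε)),
    mul_nonneg hC' (tsum_nonneg fun k => by positivity), fun N => ?_⟩
  have hle : ∀ k : ℕ, ((N + k + 1 : ℕ) : ℝ) ^ (-σ 0) *
      ∑' p, zetaBound (fun i => σ i.succ) (N + k + 1) p ≤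
      C' * ((N : ℝ) + 1) ^ (-β) * ((k : ℝ) + 1) ^ (-(1 + ε)) := by
    intro k
    have hx : (0 : ℝ) < ((N + k + 1 : ℕ) : ℝ) := by positivity
    have hxN : (N : ℝ) + 1 ≤ ((N + k + 1 : ℕ) : ℝ) := by
      push_cast
      linarith [Nat.cast_nonneg (α := ℝ) k]
    have hxk : (k : ℝ) + 1 ≤ ((N + k + 1 : ℕ) : ℝ) := by
      push_cast
      linarith [Nat.cast_nonneg (α := ℝ) N]
    calc _ ≤ ((N + k + 1 : ℕ) : ℝ) ^ (-σ 0) * (C' * ((N + k + 1 : ℕ) : ℝ) ^ (-β')) := by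
          refine mul_le_mul_of_nonneg_left ((hin _).2.trans ?_) (by positivity)
          refine mul_le_mul_of_nonneg_left ?_ hC'
          exact Real.rpow_le_rpow_of_nonpos hx (by linarith) (by linarith)
      _ = C' * (((N + k + 1 : ℕ) : ℝ) ^ (-β) * ((N + k + 1 : ℕ) : ℝ) ^ (-(1 + ε))) := by
          rw [← Real.rpow_add hx, mul_left_comm, ← Real.rpow_add hx]
          congr 2
          rw [hε]; ring
      _ ≤ C' * (((N : ℝ) + 1) ^ (-β) * ((k : ℝ) + 1) ^ (-(1 + ε))) := by
          refine mul_le_mul_of_nonneg_left (mul_le_mul ?_ ?_ (by positivity) (by positivity)) hC'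
          · exact Real.rpow_le_rpow_of_nonpos (by positivity) hxN (by linarith)
          · exact Real.rpow_le_rpow_of_nonpos (by positivity) hxk (by linarith)
      _ = _ := by ring
  let E := Fin.consEquiv fun _ : Fin (m + 1) => ℕ
  have hE : zetaBound σ N ∘ E = fun z : ℕ × (Fin m → ℕ) =>
      ((N + z.1 + 1 : ℕ) : ℝ) ^ (-σ 0) * zetaBound (fun i => σ i.succ) (N + z.1 + 1) z.2 := by
    ext z
    exact zetaBound_cons σ N z.1 z.2
  have hinner : ∀ k : ℕ, Summable fun p => ((N + k + 1 : ℕ) : ℝ) ^ (-σ 0) *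
      zetaBound (fun i => σ i.succ) (N + k + 1) p := fun k => (hin _).1.mul_left _
  have houter : Summable fun k : ℕ => ((N + k + 1 : ℕ) : ℝ) ^ (-σ 0) *
      ∑' p, zetaBound (fun i => σ i.succ) (N + k + 1) p :=
    Summable.of_nonneg_of_le (fun k => mul_nonneg (by positivity)
      (tsum_nonneg fun p => zetaBound_nonneg _ _ _)) hle (hsum.mul_left _)
  have hS : Summable (zetaBound σ N ∘ E) := by
    rw [hE, summable_prod_of_nonneg fun z => mul_nonneg (by positivity) (zetaBound_nonneg _ _ _)]
    refine ⟨hinner, ?_⟩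
    simpa only [tsum_mul_left] using houter
  refine ⟨E.summable_iff.1 hS, ?_⟩
  rw [← E.tsum_eq]
  change ∑' z, (zetaBound σ N ∘ E) z ≤ _
  rw [hS.tsum_prod, hE]
  simp only [tsum_mul_left]
  refine (houter.tsum_le_tsum hle (hsum.mul_left _)).trans_eq ?_
  rw [tsum_mul_left]
  ring

/-- The sum over `m_1, …, m_d` with shift `N` decays like any power `N^{-β}` with
`β < s_d(1) - d`; for the induction on the depth the exponent for `m_2, …, m_d` has to be chosen
large enough to make the sum over `m_1` converge. -/
lemma exists_zetaBound_le {e : ℕ} {σ : Fin (e + 1) → ℝ}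
    (hσ : ∀ i : Fin (e + 1), (e : ℝ) + 1 - i < tailSum σ i) {β : ℝ} (hβ : 0 ≤ β)
    (hβσ : β < tailSum σ 0 - (e + 1)) :
    ∃ C, 0 ≤ C ∧ ∀ N : ℕ, Summable (zetaBound σ N) ∧
      ∑' k, zetaBound σ N k ≤ C * ((N : ℝ) + 1) ^ (-β) := by
  induction e generalizing β with
  | zero =>
    refine exists_zetaBound_step (C' := 1) (β' := 0) zero_le_one hβ le_rfl ?_ fun N => ?_
    · have : tailSum σ 0 = σ 0 := by rw [tailSum_zero]; simp
      rw [this] at hβσ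
      norm_num at hβσ
      linarith
    · refine ⟨(hasSum_fintype _).summable, ?_⟩
      simp [zetaBound]
  | succ e ih =>
    have h0 : tailSum σ 0 = σ 0 + tailSum (fun i => σ i.succ) 0 := by
      rw [tailSum_zero, tailSum_zero, Fin.sum_univ_succ]
    have h1 := hσ (Fin.succ 0)
    rw [tailSum_succ] at h1
    rw [h0] at hβσ
    push_cast at h1 hβσ
    simp only [Fin.val_succ, Fin.val_zero] at h1
    push_cast at h1
    obtain ⟨β', hb1, hb2⟩ := exists_between
      (show max 0 (1 + β - σ 0) < tailSum (fun i => σ i.succ) 0 - (e + 1) from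
        max_lt (by linarith) (by linarith))
    have hb0 : 0 ≤ β' := (le_max_left _ _).trans hb1.le
    obtain ⟨C', hC', hin⟩ := ih (σ := fun i => σ i.succ) (fun i => by
      have := hσ i.succ
      rw [tailSum_succ] at this
      push_cast at this
      simp only [Fin.val_succ] at this
      push_cast at this
      linarith) hb0 hb2
    exact exists_zetaBound_step hC' hβ hb0 (by linarith [le_max_right 0 (1 + β - σ 0)]) hin

lemma summable_zetaBound {e : ℕ} {σ : Fin (e + 1) → ℝ}
    (hσ : ∀ i : Fin (e + 1), (e : ℝ) + 1 - i < tailSum σ i) : Summable (zetaBound σ 0) := by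
  have h0 := hσ 0
  simp only [Fin.val_zero, Nat.cast_zero, sub_zero] at h0
  obtain ⟨C, -, hC⟩ := exists_zetaBound_le hσ le_rfl (by linarith)
  exact (hC 0).1

lemma sum_Iic_pos {e : ℕ} (m : Fin (e + 1) → ℕ) (i : Fin (e + 1)) :
    0 < ∑ l ∈ Finset.Iic i, (m l + 1) :=
  Finset.sum_pos (fun _ _ => Nat.succ_pos _) ⟨i, by simp⟩

lemma norm_zetaTerm {e : ℕ} (s : Fin (e + 1) → ℂ) (m : Fin (e + 1) → ℕ) :
    ‖zetaTerm s m‖ = zetaBound (fun i => (s i).re) 0 m := by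
  rw [zetaTerm, zetaBound, norm_prod]
  refine Finset.prod_congr rfl fun i _ => ?_
  rw [norm_div, norm_one, zero_add, Complex.norm_natCast_cpow_of_pos (sum_Iic_pos m i),
    Real.rpow_neg (Nat.cast_nonneg _), one_div]

lemma zetaBound_anti {e : ℕ} {σ τ : Fin (e + 1) → ℝ} (h : ∀ i, σ i ≤ τ i)
    (m : Fin (e + 1) → ℕ) : zetaBound τ 0 m ≤ zetaBound σ 0 m := by
  refine Finset.prod_le_prod (fun _ _ => Real.rpow_nonneg (Nat.cast_nonneg _) _) fun i _ => ?_
  refine Real.rpow_le_rpow_of_exponent_le ?_ (neg_le_neg (h i))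
  rw [zero_add]
  exact_mod_cast sum_Iic_pos m i

lemma re_tailSum {e : ℕ} (s : Fin (e + 1) → ℂ) (i : Fin (e + 1)) :
    (tailSum s i).re = tailSum (fun l => (s l).re) i := by
  simp [tailSum]

lemma mem_convergenceRegion {e : ℕ} {s : Fin (e + 1) → ℂ} :
    s ∈ convergenceRegion e ↔ ∀ i : Fin (e + 1), (e : ℝ) + 1 - i < (tailSum s i).re := by
  refine forall_congr' fun i => ?_
  rw [show ((e : ℝ) + 1) - ((i : ℝ) + 1) + 1 = e + 1 - i by ring]

lemma summable_norm_zetaTerm {e : ℕ} {s : Fin (e + 1) → ℂ} (hs : s ∈ convergenceRegion e) :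
    Summable fun m => ‖zetaTerm s m‖ := by
  simp_rw [norm_zetaTerm]
  refine summable_zetaBound fun i => ?_
  rw [← re_tailSum]
  exact mem_convergenceRegion.1 hs i

@[fun_prop]
lemma differentiable_tailSum {e : ℕ} (i : Fin (e + 1)) :
    Differentiable ℂ fun s : Fin (e + 1) → ℂ => tailSum s i := by
  unfold tailSum
  fun_prop

@[fun_prop]
lemma continuous_tailSum {e : ℕ} (i : Fin (e + 1)) :
    Continuous fun s : Fin (e + 1) → ℂ => tailSum s i := by
  unfold tailSum
  fun_prop

lemma isOpen_convergenceRegion (e : ℕ) : IsOpen (convergenceRegion e) := by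
  simp only [convergenceRegion, ofPred_forall]
  exact isOpen_iInter_of_finite fun i =>
    isOpen_lt continuous_const (Complex.continuous_re.comp (continuous_tailSum i))

/-- The Euler–Zagier series defines an analytic function on its domain of absolute convergence. -/
theorem analyticOnNhd_tsum_zetaTerm (e : ℕ) :
    AnalyticOnNhd ℂ (fun s => ∑' m, zetaTerm s m) (convergenceRegion e) := by
  intro s₀ hs₀
  have hcont : Continuous fun ε : ℝ => fun i : Fin (e + 1) =>
      tailSum (fun l => (s₀ l).re - ε) i := by
    unfold tailSum
    fun_prop
  have hev : ∀ᶠ ε in 𝓝 (0 : ℝ), ∀ i : Fin (e + 1),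
      (e : ℝ) + 1 - i < tailSum (fun l => (s₀ l).re - ε) i := by
    rw [eventually_all]
    intro i
    refine continuousAt_const.eventually_lt
      ((continuous_apply i).comp hcont).continuousAt ?_
    have := mem_convergenceRegion.1 hs₀ i
    rw [re_tailSum] at this
    simpa using this
  obtain ⟨ε, hε, hε0⟩ := ((hev.filter_mono nhdsWithin_le_nhds).and
    (self_mem_nhdsWithin (s := Ioi (0 : ℝ)))).exists
  have hV : IsOpen {s : Fin (e + 1) → ℂ | ∀ i, (s₀ i).re - ε < (s i).re} := by
    simp only [ofPred_forall]
    exact isOpen_iInter_of_finite fun i =>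
      isOpen_lt continuous_const (Complex.continuous_re.comp (continuous_apply i))
  refine analyticOnNhd_tsum hV (summable_zetaBound hε) (fun m => ?_) (fun m s hs => ?_) s₀ ?_
  · refine Differentiable.differentiableOn ?_
    have hfac : ∀ i : Fin (e + 1), Differentiable ℂ fun s : Fin (e + 1) → ℂ =>
        1 / ((∑ l ∈ Finset.Iic i, (m l + 1) : ℕ) : ℂ) ^ s i := ?_
    · unfold zetaTerm
      fun_prop
    intro i
    have hne : ((∑ l ∈ Finset.Iic i, (m l + 1) : ℕ) : ℂ) ≠ 0 := by
      exact_mod_cast (sum_Iic_pos m i).ne'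
    have happ : Differentiable ℂ fun s : Fin (e + 1) → ℂ => s i := by fun_prop
    have hpow : Differentiable ℂ fun s : Fin (e + 1) → ℂ =>
        ((∑ l ∈ Finset.Iic i, (m l + 1) : ℕ) : ℂ) ^ s i := fun s =>
      (happ s).const_cpow (Or.inl hne)
    simp_rw [one_div]
    refine hpow.fun_inv fun s => ?_
    simp [Complex.cpow_eq_zero_iff, -Nat.cast_sum, hne]
  · rw [norm_zetaTerm]
    exact zetaBound_anti (fun i => (hs i).le) m
  · intro i
    have : (0 : ℝ) < ε := hε0
    linarith

/-! ### The change of variables `(x, y) ↦ (x (1 - y), x y)` -/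

/-- Lebesgue measure on `(0, ∞)`. -/
noncomputable abbrev halfLine : Measure ℝ := volume.restrict (Ioi 0)

/-- Lebesgue measure on `(0, 1)`. -/
noncomputable abbrev unitSegment : Measure ℝ := volume.restrict (Ioo 0 1)

/-- Lebesgue measure on the open unit cube `(0, 1)^e`. -/
noncomputable abbrev unitCube (e : ℕ) : Measure (Fin e → ℝ) :=
  Measure.pi fun _ : Fin e => unitSegment

/-- The map `(x, y) ↦ (x (1 - y), x y)` from `(0, ∞) × (0, 1)` onto `(0, ∞)²`. -/
def splitMap (z : ℝ × ℝ) : ℝ × ℝ := (z.1 * (1 - z.2), z.1 * z.2)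

lemma hasFDerivAt_splitMap (z : ℝ × ℝ) :
    HasFDerivAt splitMap (Matrix.toLin (.finTwoProd ℝ) (.finTwoProd ℝ)
      !![1 - z.2, -z.1; z.2, z.1]).toContinuousLinearMap z := by
  rw [Matrix.toLin_finTwoProd_toContinuousLinearMap]
  have h := HasFDerivAt.prodMk (𝕜 := ℝ)
    ((hasFDerivAt_fst (𝕜 := ℝ) (p := z)).mul
      ((hasFDerivAt_const (1 : ℝ) z).sub (hasFDerivAt_snd (𝕜 := ℝ) (p := z))))
    ((hasFDerivAt_fst (𝕜 := ℝ) (p := z)).mul (hasFDerivAt_snd (𝕜 := ℝ) (p := z)))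
  refine h.congr_fderiv ?_
  ext <;> simp

/-- The Jacobian of `splitMap` is `x`. -/
lemma map_splitMap :
    Measure.map splitMap ((halfLine.prod unitSegment).withDensity fun z => ENNReal.ofReal z.1) =
      halfLine.prod halfLine := by
  have hs : MeasurableSet (Ioi (0 : ℝ) ×ˢ Ioo (0 : ℝ) 1) := measurableSet_Ioi.prod measurableSet_Ioo
  have hinj : InjOn splitMap (Ioi (0 : ℝ) ×ˢ Ioo (0 : ℝ) 1) := by
    rintro ⟨x, y⟩ ⟨hx, -⟩ ⟨x', y'⟩ ⟨hx', -⟩ h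
    simp only [splitMap, Prod.mk.injEq] at h
    obtain ⟨h1, h2⟩ := h
    have hxx : x = x' := by linarith
    subst hxx
    have hx0 : x ≠ 0 := ne_of_gt hx
    exact Prod.ext rfl (mul_left_cancel₀ hx0 h2)
  have himg : splitMap '' (Ioi (0 : ℝ) ×ˢ Ioo (0 : ℝ) 1) = Ioi 0 ×ˢ Ioi 0 := by
    ext ⟨u, v⟩
    constructor
    · rintro ⟨⟨x, y⟩, ⟨hx, hy⟩, h⟩
      simp only [splitMap, Prod.mk.injEq] at h
      simp only [mem_Ioi, mem_Ioo] at hx hy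
      refine ⟨?_, ?_⟩
      · simp only [mem_Ioi]
        rw [← h.1]
        exact mul_pos hx (by linarith)
      · simp only [mem_Ioi]
        rw [← h.2]
        exact mul_pos hx hy.1
    · rintro ⟨hu, hv⟩
      simp only [mem_Ioi] at hu hv
      have hne : u + v ≠ 0 := by positivity
      refine ⟨(u + v, v / (u + v)), ⟨?_, ?_, ?_⟩, ?_⟩
      · exact add_pos hu hv
      · simp only; positivity
      · simp only
        rw [div_lt_one (by positivity)]
        linarith
      · simp only [splitMap, Prod.mk.injEq]
        constructor
        · field_simp
          ring
        · field_simp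
  have h := map_withDensity_abs_det_fderiv_eq_addHaar (volume : Measure (ℝ × ℝ))
    hs.nullMeasurableSet (fun z _ => (hasFDerivAt_splitMap z).hasFDerivWithinAt) hinj
  rw [himg, Measure.volume_eq_prod, ← Measure.prod_restrict, ← Measure.prod_restrict] at h
  rw [← h]
  congr 1
  refine withDensity_congr_ae ?_
  rw [Measure.prod_restrict]
  filter_upwards [ae_restrict_mem hs] with z hz
  have hz1 : 0 < z.1 := hz.1
  congr 1
  have hdet : (LinearMap.toContinuousLinearMap (Matrix.toLin (.finTwoProd ℝ) (.finTwoProd ℝ)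
      !![1 - z.2, -z.1; z.2, z.1])).det = z.1 := by
    rw [ContinuousLinearMap.det]
    simp only [LinearMap.coe_toContinuousLinearMap, LinearMap.det_toLin, Matrix.det_fin_two_of]
    ring
  rw [hdet, abs_of_pos hz1]

/-- Integration in the coordinates `(x (1 - y), x y)`, with parameters. -/
lemma integral_splitMap {Y : Type*} [MeasurableSpace Y] {ν : Measure Y} [SFinite ν]
    {g : ℝ → ℂ} {h : ℝ × Y → ℂ} (hg : Integrable g halfLine) (hh : Integrable h (halfLine.prod ν)) :
    Integrable (fun z : (ℝ × ℝ) × Y => (z.1.1 : ℂ) * (g (z.1.1 * (1 - z.1.2)) *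
      h (z.1.1 * z.1.2, z.2))) ((halfLine.prod unitSegment).prod ν) ∧
    ∫ z : (ℝ × ℝ) × Y, (z.1.1 : ℂ) * (g (z.1.1 * (1 - z.1.2)) * h (z.1.1 * z.1.2, z.2))
      ∂((halfLine.prod unitSegment).prod ν) =
      (∫ y, g y ∂halfLine) * ∫ z, h z ∂(halfLine.prod ν) := by
  let μ : Measure (ℝ × ℝ) := (halfLine.prod unitSegment).withDensity fun z => ENNReal.ofReal z.1
  have hmeas : Measurable splitMap := by unfold splitMap; fun_prop
  have hmp : MeasurePreserving splitMap μ (halfLine.prod halfLine) := ⟨hmeas, map_splitMap⟩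
  have hmp2 : MeasurePreserving (fun z : (ℝ × ℝ) × Y => ((splitMap z.1).1, ((splitMap z.1).2, z.2)))
      (μ.prod ν) (halfLine.prod (halfLine.prod ν)) :=
    (measurePreserving_prodAssoc halfLine halfLine ν).comp
      (hmp.prod (MeasurePreserving.id ν))
  have hint : Integrable (fun w : ℝ × (ℝ × Y) => g w.1 * h w.2) (halfLine.prod (halfLine.prod ν)) :=
    hg.mul_prod hh
  have hint2 := (hmp2.integrable_comp hint.1).2 hint
  have hdens : μ.prod ν = ((halfLine.prod unitSegment).prod ν).withDensity
      fun z => ENNReal.ofReal z.1.1 :=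
    prod_withDensity_left (by fun_prop)
  have hae : ∀ᵐ z ∂((halfLine.prod unitSegment).prod ν), 0 < z.1.1 := by
    have h1 : ∀ᵐ x ∂halfLine, (0 : ℝ) < x := ae_restrict_mem measurableSet_Ioi
    exact Measure.quasiMeasurePreserving_fst.ae (Measure.quasiMeasurePreserving_fst.ae h1)
  have hfin : ∀ᵐ z ∂((halfLine.prod unitSegment).prod ν), ENNReal.ofReal z.1.1 < ⊤ :=
    Eventually.of_forall fun _ => ENNReal.ofReal_lt_top
  have heq : (fun z : (ℝ × ℝ) × Y => (ENNReal.ofReal z.1.1).toReal •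
      (g (splitMap z.1).1 * h ((splitMap z.1).2, z.2))) =ᵐ[(halfLine.prod unitSegment).prod ν]
      fun z => (z.1.1 : ℂ) * (g (z.1.1 * (1 - z.1.2)) * h (z.1.1 * z.1.2, z.2)) := by
    filter_upwards [hae] with z hz
    rw [ENNReal.toReal_ofReal hz.le, Complex.real_smul]
    rfl
  constructor
  · rw [hdens, integrable_withDensity_iff_integrable_smul' (by fun_prop) hfin] at hint2
    exact hint2.congr heq
  · rw [← integral_congr_ae heq, ← integral_withDensity_eq_integral_toReal_smul (by fun_prop) hfin,
      ← hdens, ← integral_prod_mul]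
    have := integral_map (μ := μ.prod ν) hmp2.measurable.aemeasurable
      (f := fun w : ℝ × (ℝ × Y) => g w.1 * h w.2) (by rw [hmp2.map_eq]; exact hint.1)
    rw [hmp2.map_eq] at this
    exact this.symm

/-- A sum of integrable functions whose `L¹` norms are summable is integrable. -/
lemma integrable_of_hasSum_ae {X ι : Type*} [Countable ι] [MeasurableSpace X] {μ : Measure X}
    {F : ι → X → ℂ} {G : X → ℂ} (hG : AEStronglyMeasurable G μ) (hF : ∀ i, Integrable (F i) μ)
    (hsum : Summable fun i => ∫ x, ‖F i x‖ ∂μ) (h : ∀ᵐ x ∂μ, HasSum (fun i => F i x) (G x)) :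
    Integrable G μ := by
  refine ⟨hG, ?_⟩
  have h1 : ∫⁻ x, ∑' i, ‖F i x‖ₑ ∂μ < ⊤ := by
    rw [lintegral_tsum fun i => (hF i).1.enorm]
    have h2 : ∀ i, ∫⁻ x, ‖F i x‖ₑ ∂μ = ENNReal.ofReal (∫ x, ‖F i x‖ ∂μ) := fun i =>
      (ofReal_integral_norm_eq_lintegral_enorm (hF i)).symm
    simp_rw [h2]
    rw [← ENNReal.ofReal_tsum_of_nonneg (fun i => integral_nonneg fun _ => norm_nonneg _) hsum]
    exact ENNReal.ofReal_lt_top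
  refine lt_of_le_of_lt (lintegral_mono_ae ?_) h1
  filter_upwards [h] with x hx
  rw [← hx.tsum_eq]
  exact enorm_tsum_le_tsum_enorm

/-! ### The Mellin-type integral of a single term of the series -/

/-- The products `w_j = x₁ x₂ ⋯ x_j`. -/
def wVar {e : ℕ} (x₁ : ℝ) (x : Fin e → ℝ) (i : Fin (e + 1)) : ℝ :=
  ∏ l ∈ Finset.Iic i, (Fin.cons x₁ x : Fin (e + 1) → ℝ) l

lemma wVar_zero {e : ℕ} (x₁ : ℝ) (x : Fin e → ℝ) : wVar x₁ x 0 = x₁ := by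
  rw [wVar, prod_Iic_zero, Fin.cons_zero]

lemma wVar_succ {e : ℕ} (x₁ : ℝ) (x : Fin e → ℝ) (i : Fin e) :
    wVar x₁ x i.succ = x₁ * ∏ l ∈ Finset.Iic i, x l := by
  simp [wVar, prod_Iic_succ]

lemma wVar_succ_eq {e : ℕ} (x₁ : ℝ) (x : Fin (e + 1) → ℝ) (i : Fin (e + 1)) :
    wVar x₁ x i.succ = wVar (x₁ * x 0) (fun l => x l.succ) i := by
  rw [wVar_succ]
  refine Fin.cases ?_ (fun j => ?_) i
  · rw [wVar_zero, prod_Iic_zero]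
  · rw [wVar_succ, prod_Iic_succ, mul_assoc]

/-- The powers in the integrand, after the change of variables. -/
noncomputable def powKernel {e : ℕ} (s : Fin (e + 1) → ℂ) (z : ℝ × (Fin e → ℝ)) : ℂ :=
  (z.1 : ℂ) ^ (tailSum s 0 - 1) * ∏ i : Fin e, ((z.2 i : ℂ) ^ (tailSum s i.succ - 1) *
    ((1 - z.2 i : ℝ) : ℂ) ^ (s i.castSucc - 1))

/-- The integrand whose integral is a single term of the series. -/
noncomputable def expKernel {e : ℕ} (s : Fin (e + 1) → ℂ) (c : Fin (e + 1) → ℝ)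
    (z : ℝ × (Fin e → ℝ)) : ℂ :=
  powKernel s z * Complex.exp (-(∑ i, c i * wVar z.1 z.2 i : ℝ))

lemma integral_gammaKernel {a : ℂ} {r : ℝ} (ha : 0 < a.re) (hr : 0 < r) :
    Integrable (fun t : ℝ => (t : ℂ) ^ (a - 1) * Complex.exp (-(r * t : ℝ))) halfLine ∧
    ∫ t : ℝ, (t : ℂ) ^ (a - 1) * Complex.exp (-(r * t : ℝ)) ∂halfLine =
      Complex.Gamma a * (r : ℂ) ^ (-a) := by
  have h := Complex.integral_cpow_mul_exp_neg_mul_Ioi ha hr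
  have hr0 : (r : ℂ) ≠ 0 := by exact_mod_cast hr.ne'
  have hpow : (1 / (r : ℂ)) ^ a = (r : ℂ) ^ (-a) := by
    rw [one_div, Complex.inv_cpow, Complex.cpow_neg]
    rw [Complex.arg_ofReal_of_nonneg hr.le]
    exact Real.pi_pos.ne
  rw [hpow] at h
  push_cast
  refine ⟨?_, by rw [h, mul_comm]⟩
  by_contra hcon
  rw [integral_undef hcon] at h
  refine mul_ne_zero ?_ (Complex.Gamma_ne_zero_of_re_pos ha) h.symm
  rw [Complex.cpow_ne_zero_iff]
  exact Or.inl hr0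

/-- The coordinates `(x₁, x) ↦ ((x₁, x₂), (x₃, …, x_d))`. -/
def splitFirst {e : ℕ} (z : ℝ × (Fin (e + 1) → ℝ)) : (ℝ × ℝ) × (Fin e → ℝ) :=
  ((z.1, z.2 0), fun l => z.2 l.succ)

lemma measurePreserving_uncons {e : ℕ} (ν : Fin (e + 1) → Measure ℝ) [∀ i, SigmaFinite (ν i)] :
    MeasurePreserving (fun x : Fin (e + 1) → ℝ => (x 0, fun l : Fin e => x l.succ))
      (Measure.pi ν) ((ν 0).prod (Measure.pi fun i => ν i.succ)) := by
  have h := measurePreserving_piFinSuccAbove ν 0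
  simpa [Fin.succAbove_zero] using! h

lemma measurePreserving_splitFirst (e : ℕ) :
    MeasurePreserving (splitFirst (e := e)) (halfLine.prod (unitCube (e + 1)))
      ((halfLine.prod unitSegment).prod (unitCube e)) :=
  (measurePreserving_prodAssoc halfLine unitSegment (unitCube e)).symm.comp
    ((MeasurePreserving.id halfLine).prod
      (measurePreserving_uncons fun _ : Fin (e + 1) => unitSegment))

lemma ae_unitCube (e : ℕ) : ∀ᵐ x ∂unitCube e, ∀ i, x i ∈ Ioo (0 : ℝ) 1 := by
  rw [ae_all_iff]
  exact fun i => (Measure.quasiMeasurePreserving_eval (fun _ : Fin e => unitSegment) i).ae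
    (ae_restrict_mem measurableSet_Ioo)

lemma ae_halfLine_prod (e : ℕ) : ∀ᵐ z ∂halfLine.prod (unitCube e),
    0 < z.1 ∧ ∀ i, z.2 i ∈ Ioo (0 : ℝ) 1 := by
  have h1 : ∀ᵐ x ∂halfLine, (0 : ℝ) < x := ae_restrict_mem measurableSet_Ioi
  exact (Measure.quasiMeasurePreserving_fst.ae h1).and
    (Measure.quasiMeasurePreserving_snd.ae (ae_unitCube e))

lemma powKernel_succ {e : ℕ} (s : Fin (e + 2) → ℂ) {x₁ : ℝ} (hx₁ : 0 < x₁) {x : Fin (e + 1) → ℝ}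
    (hx : ∀ i, x i ∈ Ioo (0 : ℝ) 1) :
    powKernel s (x₁, x) = x₁ * ((x₁ * (1 - x 0) : ℝ) : ℂ) ^ (s 0 - 1) *
      powKernel (fun l => s l.succ) (x₁ * x 0, fun l => x l.succ) := by
  have h0 := hx 0
  have hx1 : (x₁ : ℂ) ≠ 0 := by exact_mod_cast hx₁.ne'
  simp only [powKernel]
  rw [Fin.prod_univ_succ, Complex.ofReal_mul, Complex.ofReal_mul,
    Complex.mul_cpow_ofReal_nonneg hx₁.le (by linarith [h0.2]),
    Complex.mul_cpow_ofReal_nonneg hx₁.le h0.1.le, Fin.castSucc_zero, tailSum_succ]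
  have ht : tailSum s 0 = s 0 + tailSum (fun l => s l.succ) 0 := by
    rw [tailSum_zero, tailSum_zero, Fin.sum_univ_succ]
  have hp : (x₁ : ℂ) ^ (tailSum s 0 - 1) = x₁ * (x₁ : ℂ) ^ (s 0 - 1) *
      (x₁ : ℂ) ^ (tailSum (fun l => s l.succ) 0 - 1) := by
    rw [show tailSum s 0 - 1 = 1 + (s 0 - 1) + (tailSum (fun l => s l.succ) 0 - 1) by rw [ht]; ring,
      Complex.cpow_add _ _ hx1, Complex.cpow_add _ _ hx1, Complex.cpow_one]
  rw [hp]
  simp only [tailSum_succ, Fin.castSucc_succ]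
  ring

/-- The substitution `y = x₁ (1 - x₂)`, `x₁' = x₁ x₂` separates the first variable from a kernel of
depth one less: `w_2, …, w_d` are the products `w_1', …, w_{d-1}'` for `x₁', x₃, …, x_d`. -/
lemma expKernel_succ {e : ℕ} (s : Fin (e + 2) → ℂ) (c : Fin (e + 2) → ℝ) {x₁ : ℝ} (hx₁ : 0 < x₁)
    {x : Fin (e + 1) → ℝ} (hx : ∀ i, x i ∈ Ioo (0 : ℝ) 1) :
    expKernel s c (x₁, x) = x₁ * ((((x₁ * (1 - x 0) : ℝ) : ℂ) ^ (s 0 - 1) *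
      Complex.exp (-(c 0 * (x₁ * (1 - x 0)) : ℝ))) *
      expKernel (fun l => s l.succ) (Fin.cons (c 0 + c 1) fun l => c l.succ.succ)
        (x₁ * x 0, fun l => x l.succ)) := by
  have hexp : ∑ i, c i * wVar x₁ x i = c 0 * (x₁ * (1 - x 0)) +
      ∑ i, (Fin.cons (c 0 + c 1) (fun l => c l.succ.succ) : Fin (e + 1) → ℝ) i *
        wVar (x₁ * x 0) (fun l => x l.succ) i := by
    rw [Fin.sum_univ_succ]
    simp only [wVar_succ_eq]
    rw [Fin.sum_univ_succ, Fin.sum_univ_succ, wVar_zero, wVar_zero]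
    simp only [Fin.cons_zero, Fin.cons_succ, Fin.succ_zero_eq_one]
    ring
  rw [expKernel, expKernel, powKernel_succ s hx₁ hx]
  dsimp only
  rw [hexp, Complex.ofReal_add, neg_add, Complex.exp_add]
  ring

/-- The integral of `expKernel` is a product of Gamma integrals, one for each variable
`y_j = w_j - w_{j+1}`. -/
lemma integral_expKernel {e : ℕ} {s : Fin (e + 1) → ℂ} (hs : ∀ i, 0 < (s i).re)
    {c : Fin (e + 1) → ℝ} (hc0 : 0 < c 0) (hc : ∀ i, 0 ≤ c i) :
    Integrable (expKernel s c) (halfLine.prod (unitCube e)) ∧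
    ∫ z, expKernel s c z ∂(halfLine.prod (unitCube e)) =
      ∏ i, (Complex.Gamma (s i) * ((∑ l ∈ Finset.Iic i, c l : ℝ) : ℂ) ^ (-s i)) := by
  induction e with
  | zero =>
    have hK : expKernel s c = fun z : ℝ × (Fin 0 → ℝ) =>
        ((z.1 : ℂ) ^ (s 0 - 1) * Complex.exp (-(c 0 * z.1 : ℝ))) * 1 := by
      ext z
      simp [expKernel, powKernel, tailSum_zero, wVar_zero]
    obtain ⟨h1, h2⟩ := integral_gammaKernel (hs 0) hc0
    rw [hK]
    refine ⟨h1.mul_prod (integrable_const 1), ?_⟩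
    refine (integral_prod_mul (μ := halfLine) (ν := unitCube 0)
      (fun t : ℝ => (t : ℂ) ^ (s 0 - 1) * Complex.exp (-(c 0 * t : ℝ))) fun _ => (1 : ℂ)).trans ?_
    rw [h2]
    have hone : (unitCube 0).real univ = 1 := by
      rw [Measure.real, Measure.pi_univ]
      simp
    simp [sum_Iic_zero, hone]
  | succ e ih =>
    obtain ⟨h1, h2⟩ := integral_gammaKernel (hs 0) hc0
    obtain ⟨h3, h4⟩ := ih (s := fun l => s l.succ) (fun i => hs i.succ)
      (c := Fin.cons (c 0 + c 1) fun l => c l.succ.succ)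
      (by simpa using add_pos_of_pos_of_nonneg hc0 (hc 1))
      (fun i => by
        refine Fin.cases ?_ (fun j => ?_) i
        · simpa using add_nonneg (hc 0) (hc 1)
        · simpa using hc j.succ.succ)
    obtain ⟨h5, h6⟩ := integral_splitMap h1 h3
    have hmp := measurePreserving_splitFirst e
    have hae : expKernel s c =ᵐ[halfLine.prod (unitCube (e + 1))]
        (fun z : (ℝ × ℝ) × (Fin e → ℝ) => (z.1.1 : ℂ) *
          ((((z.1.1 * (1 - z.1.2) : ℝ) : ℂ) ^ (s 0 - 1) *
            Complex.exp (-(c 0 * (z.1.1 * (1 - z.1.2)) : ℝ))) *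
          expKernel (fun l => s l.succ) (Fin.cons (c 0 + c 1) fun l => c l.succ.succ)
            (z.1.1 * z.1.2, z.2))) ∘ splitFirst := by
      filter_upwards [ae_halfLine_prod (e + 1)] with z hz
      exact expKernel_succ s c hz.1 hz.2
    refine ⟨((hmp.integrable_comp h5.1).2 h5).congr hae.symm, ?_⟩
    rw [integral_congr_ae hae]
    have hmap := integral_map (μ := halfLine.prod (unitCube (e + 1))) hmp.measurable.aemeasurable
      (f := _) (by rw [hmp.map_eq]; exact h5.1)
    rw [hmp.map_eq] at hmap
    refine hmap.symm.trans ?_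
    rw [h6, h2, h4]
    conv_rhs => rw [Fin.prod_univ_succ, sum_Iic_zero]
    congr 1
    refine Finset.prod_congr rfl fun i _ => ?_
    congr 3
    refine Fin.cases ?_ (fun j => ?_) i
    · rw [sum_Iic_zero, sum_Iic_succ, sum_Iic_zero]
      simp
    · rw [sum_Iic_succ, sum_Iic_succ, sum_Iic_succ]
      simp [add_assoc]

/-! ### The integral representation of the series -/

/-- The powers in the integral representation, with the exponents `u_j` and `v_j`. -/
noncomputable def zetaPow {e : ℕ} (s : Fin (e + 1) → ℂ) (x : Fin e → ℝ) : ℂ :=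
  ∏ i : Fin e, ((x i : ℂ) ^ uExp s 0 i * ((1 - x i : ℝ) : ℂ) ^ vExp s 0 i)

/-- The integrand of the integral representation of the Euler–Zagier series. -/
noncomputable def zetaKernel {e : ℕ} (s : Fin (e + 1) → ℂ) (z : ℝ × (Fin e → ℝ)) : ℂ :=
  (z.1 : ℂ) ^ (tailSum s 0 - ((e : ℂ) + 1) - 1) * (zetaPow s z.2 *
    toddProd (z.1 : ℂ) fun i => (z.2 i : ℂ))

lemma measurable_toddC : Measurable toddC := by
  unfold toddC
  refine Measurable.ite (measurableSet_singleton 0) measurable_const ?_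
  exact measurable_id.div (Complex.measurable_exp.sub_const 1)

lemma measurable_zetaKernel {e : ℕ} (s : Fin (e + 1) → ℂ) : Measurable (zetaKernel s) := by
  have h := measurable_toddC
  unfold zetaKernel zetaPow toddProd
  fun_prop

lemma prod_wVar {e : ℕ} (x₁ : ℝ) (x : Fin e → ℝ) :
    ∏ i, wVar x₁ x i = x₁ ^ (e + 1) * ∏ i : Fin e, x i ^ (e - (i : ℕ)) := by
  have h := prod_prod_Iic_pow (Fin.cons x₁ x : Fin (e + 1) → ℝ) (fun _ => 1)
  simp only [pow_one] at h
  rw [show ∏ i, wVar x₁ x i = _ from h, Fin.prod_univ_succ]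
  simp only [Fin.cons_zero, Fin.cons_succ, tailSum, Finset.sum_const, Fin.card_Ici]
  simp

lemma cpow_sub_natCast {x : ℂ} (hx : x ≠ 0) (a : ℂ) (k : ℕ) : x ^ (a - k) = x ^ a / x ^ k := by
  rw [Complex.cpow_sub _ _ hx, Complex.cpow_natCast]

/-- The factor `∏ w_j` of `toddProd` shifts the exponents of `powKernel` to those of
`zetaKernel`. -/
lemma zetaKernel_eq {e : ℕ} (s : Fin (e + 1) → ℂ) {x₁ : ℝ} (hx₁ : 0 < x₁)
    {x : Fin e → ℝ} (hx : ∀ i, x i ∈ Ioo (0 : ℝ) 1) :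
    zetaKernel s (x₁, x) = powKernel s (x₁, x) *
      ∏ i, (Complex.exp (wVar x₁ x i : ℝ) - 1)⁻¹ := by
  have hx1 : (x₁ : ℂ) ≠ 0 := by exact_mod_cast hx₁.ne'
  have hxi : ∀ i, (x i : ℂ) ≠ 0 := fun i => by exact_mod_cast (hx i).1.ne'
  have hw : ∀ i, 0 < wVar x₁ x i := fun i => by
    refine Finset.prod_pos fun l _ => ?_
    refine Fin.cases ?_ (fun j => ?_) l
    · simpa using hx₁
    · simpa using (hx j).1
  have htodd : toddProd (x₁ : ℂ) (fun i => (x i : ℂ)) =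
      (∏ i, (wVar x₁ x i : ℂ)) * ∏ i, (Complex.exp (wVar x₁ x i : ℝ) - 1)⁻¹ := by
    rw [← Finset.prod_mul_distrib, Fin.prod_univ_succ, toddProd]
    have hC : ∀ i, toddC (wVar x₁ x i : ℂ) =
        (wVar x₁ x i : ℂ) * (Complex.exp (wVar x₁ x i : ℝ) - 1)⁻¹ := fun i => by
      rw [toddC, if_neg (by exact_mod_cast (hw i).ne'), div_eq_mul_inv]
    rw [← hC 0, wVar_zero]
    congr 1
    refine Finset.prod_congr rfl fun i _ => ?_
    rw [← hC, wVar_succ]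
    push_cast
    rfl
  have hprod := congrArg (fun y : ℝ => (y : ℂ)) (prod_wVar x₁ x)
  push_cast at hprod
  rw [zetaKernel, htodd, hprod, powKernel, zetaPow]
  dsimp only
  have hp1 : (x₁ : ℂ) ^ (tailSum s 0 - ((e : ℂ) + 1) - 1) * (x₁ : ℂ) ^ (e + 1) =
      (x₁ : ℂ) ^ (tailSum s 0 - 1) := by
    have := cpow_sub_natCast hx1 (tailSum s 0 - 1) (e + 1)
    rw [show tailSum s 0 - ((e : ℂ) + 1) - 1 = tailSum s 0 - 1 - ((e + 1 : ℕ) : ℂ) by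
      push_cast; ring, this]
    exact div_mul_cancel₀ _ (pow_ne_zero _ hx1)
  have hp2 : ∀ i : Fin e, (x i : ℂ) ^ uExp s 0 i * ((1 - x i : ℝ) : ℂ) ^ vExp s 0 i *
      (x i : ℂ) ^ (e - (i : ℕ)) = (x i : ℂ) ^ (tailSum s i.succ - 1) *
      ((1 - x i : ℝ) : ℂ) ^ (s i.castSucc - 1) := by
    intro i
    have := cpow_sub_natCast (hxi i) (tailSum s i.succ - 1) (e - i)
    have hu : uExp s 0 i = tailSum s i.succ - 1 - ((e - (i : ℕ) : ℕ) : ℂ) := by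
      rw [Nat.cast_sub i.2.le, uExp, Pi.zero_apply, if_pos rfl]
      ring
    rw [hu, this, vExp, Pi.zero_apply, if_pos rfl]
    have hne := pow_ne_zero (e - (i : ℕ)) (hxi i)
    field_simp
  rw [← hp1, ← Finset.prod_congr rfl fun i _ => hp2 i]
  simp only [Finset.prod_mul_distrib]
  ring

/-- For `Re s_j > 0` in the domain of absolute convergence, `Γ(s₁) ⋯ Γ(s_d) ζ_d(s)` is an
absolutely convergent integral over `(0, ∞) × (0, 1)^(d-1)`. -/
theorem integral_zetaKernel {e : ℕ} {s : Fin (e + 1) → ℂ} (hs : ∀ i, 0 < (s i).re)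
    (hD : s ∈ convergenceRegion e) :
    Integrable (zetaKernel s) (halfLine.prod (unitCube e)) ∧
    ∫ z, zetaKernel s z ∂(halfLine.prod (unitCube e)) =
      (∏ i, Complex.Gamma (s i)) * ∑' m, zetaTerm s m := by
  let F : (Fin (e + 1) → ℕ) → ℝ × (Fin e → ℝ) → ℂ := fun m => expKernel s fun i => (m i : ℝ) + 1
  have hcast : ∀ (m : Fin (e + 1) → ℕ) i, ((∑ l ∈ Finset.Iic i, ((m l : ℝ) + 1) : ℝ) : ℂ) =
      ((∑ l ∈ Finset.Iic i, (m l + 1) : ℕ) : ℂ) := fun m i => by push_cast; rfl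
  have hterm : ∀ (s : Fin (e + 1) → ℂ) m, ∏ i, (Complex.Gamma (s i) *
      ((∑ l ∈ Finset.Iic i, ((m l : ℝ) + 1) : ℝ) : ℂ) ^ (-s i)) =
      (∏ i, Complex.Gamma (s i)) * zetaTerm s m := by
    intro s m
    rw [Finset.prod_mul_distrib, zetaTerm]
    congr 1
    refine Finset.prod_congr rfl fun i _ => ?_
    rw [hcast, Complex.cpow_neg, one_div]
  have hF : ∀ m, Integrable (F m) (halfLine.prod (unitCube e)) ∧
      ∫ z, F m z ∂(halfLine.prod (unitCube e)) = (∏ i, Complex.Gamma (s i)) * zetaTerm s m :=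
    fun m => by
      rw [← hterm]
      exact integral_expKernel hs (by positivity) fun i => by positivity
  -- the integral of the absolute value is the same integral at the real parts of `s`
  have hnorm : ∀ m, ∫ z, ‖F m z‖ ∂(halfLine.prod (unitCube e)) =
      ‖(∏ i, Complex.Gamma ((s i).re : ℂ))‖ * ‖zetaTerm s m‖ := by
    intro m
    let σ : Fin (e + 1) → ℂ := fun i => ((s i).re : ℂ)
    have hσ : ∀ i, 0 < (σ i).re := fun i => by simpa [σ] using hs i
    have htσ : ∀ i, tailSum σ i = ((tailSum s i).re : ℂ) := fun i => by simp [tailSum, σ]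
    have h := (integral_expKernel hσ (c := fun i => (m i : ℝ) + 1) (by positivity)
      fun i => by positivity).2
    rw [hterm] at h
    have hz : ‖zetaTerm s m‖ = ‖zetaTerm σ m‖ := by
      rw [norm_zetaTerm, norm_zetaTerm]
      simp [σ]
    rw [hz, ← norm_mul, ← h]
    have hae : (fun z => expKernel σ (fun i => (m i : ℝ) + 1) z) =ᵐ[halfLine.prod (unitCube e)]
        fun z => ((‖F m z‖ : ℝ) : ℂ) := by
      filter_upwards [ae_halfLine_prod e] with z hz
      have hp : ∀ {x : ℝ} (hx : 0 < x) (a : ℂ), (x : ℂ) ^ ((a.re : ℂ) - 1) =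
          ((‖(x : ℂ) ^ (a - 1)‖ : ℝ) : ℂ) := fun {x} hx a => by
        rw [Complex.norm_cpow_eq_rpow_re_of_pos hx, Complex.ofReal_cpow hx.le]
        simp
      simp only [F, expKernel, powKernel, norm_mul, norm_prod, Complex.ofReal_mul,
        Complex.ofReal_prod, htσ]
      rw [hp hz.1]
      congr 1
      · congr 1
        refine Finset.prod_congr rfl fun i _ => ?_
        rw [hp (hz.2 i).1, ← hp (x := 1 - z.2 i) (by linarith [(hz.2 i).2])]
      · rw [← Complex.ofReal_neg, ← Complex.ofReal_exp, Complex.norm_real,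
          Real.norm_of_nonneg (Real.exp_pos _).le]
    rw [integral_congr_ae hae, integral_complex_ofReal, Complex.norm_real,
      Real.norm_of_nonneg (integral_nonneg fun _ => norm_nonneg _)]
  have hsum : Summable fun m => ∫ z, ‖F m z‖ ∂(halfLine.prod (unitCube e)) := by
    simp_rw [hnorm]
    exact (summable_norm_zetaTerm hD).mul_left _
  have hpt : ∀ᵐ z ∂halfLine.prod (unitCube e), HasSum (fun m => F m z) (zetaKernel s z) := by
    filter_upwards [ae_halfLine_prod e] with z hz
    have hw : ∀ i, 0 < wVar z.1 z.2 i := fun i => by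
      refine Finset.prod_pos fun l _ => ?_
      refine Fin.cases ?_ (fun j => ?_) l
      · simpa using hz.1
      · simpa using (hz.2 j).1
    have hlt : ∀ i, Real.exp (-wVar z.1 z.2 i) < 1 := fun i => by
      rw [Real.exp_lt_one_iff]; linarith [hw i]
    have hnorm1 : ∀ i, ‖Complex.exp (-(wVar z.1 z.2 i : ℝ))‖ < 1 := fun i => by
      rw [← Complex.ofReal_neg, ← Complex.ofReal_exp, Complex.norm_real,
        Real.norm_of_nonneg (Real.exp_pos _).le]
      exact hlt i
    have hgeo : ∀ i, Summable fun k : ℕ => ‖Complex.exp (-(wVar z.1 z.2 i : ℝ)) ^ (k + 1)‖ :=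
      fun i => by
        simp_rw [norm_pow, pow_succ]
        exact (summable_geometric_of_lt_one (norm_nonneg _) (hnorm1 i)).mul_right _
    have h := (hasSum_pi_prod hgeo).mul_left (powKernel s z)
    have hval : ∀ i, ∑' k : ℕ, Complex.exp (-(wVar z.1 z.2 i : ℝ)) ^ (k + 1) =
        (Complex.exp (wVar z.1 z.2 i : ℝ) - 1)⁻¹ := fun i => by
      simp_rw [pow_succ]
      rw [tsum_mul_right, tsum_geometric_of_norm_lt_one (hnorm1 i), Complex.exp_neg]
      have h1 : Complex.exp (wVar z.1 z.2 i : ℝ) ≠ 0 := Complex.exp_ne_zero _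
      have h2 : Complex.exp (wVar z.1 z.2 i : ℝ) - 1 ≠ 0 := by
        intro h0
        have h3 := hnorm1 i
        rw [Complex.exp_neg, sub_eq_zero.1 h0] at h3
        simp at h3
      rw [← mul_inv]
      congr 1
      field_simp
    simp_rw [hval] at h
    rw [← zetaKernel_eq s hz.1 hz.2] at h
    have hfun : (fun m : Fin (e + 1) → ℕ => powKernel s z *
        ∏ i, Complex.exp (-(wVar z.1 z.2 i : ℝ)) ^ (m i + 1)) = fun m => F m z := by
      ext m
      simp only [F, expKernel]
      rw [Complex.ofReal_sum, ← Finset.sum_neg_distrib, Complex.exp_sum]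
      congr 1
      refine Finset.prod_congr rfl fun i _ => ?_
      rw [← Complex.exp_nat_mul]
      push_cast
      congr 1
      ring
    rwa [hfun] at h
  refine ⟨integrable_of_hasSum_ae (measurable_zetaKernel s).aestronglyMeasurable
    (fun m => (hF m).1) hsum hpt, ?_⟩
  have h := hasSum_integral_of_summable_integral_norm (fun m => (hF m).1) hsum
  rw [← tsum_mul_left, ← tsum_congr fun m => (hF m).2, h.tsum_eq]
  refine integral_congr_ae ?_
  filter_upwards [hpt] with z hz using hz.tsum_eq.symm

/-! ### Integration by parts in one variable -/

/-- Lebesgue measure on `[0, 1/2]`. -/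
noncomputable abbrev halfSegment : Measure ℝ := volume.restrict (Icc 0 (1 / 2))

/-- The measure attached to the `k`-th term of the `(n+1)`-fold integration by parts: for `k ≤ n` it
is the evaluation at the boundary point `1/2`, for `k = n + 1` it is Lebesgue measure. -/
noncomputable def partsMeasure (n k : ℕ) : Measure ℝ :=
  if k ≤ n then Measure.dirac (1 / 2) else halfSegment

/-- The coefficient of the `k`-th term of the `(n+1)`-fold integration by parts. -/
noncomputable def partsCoeff (u : ℂ) (n k : ℕ) : ℂ :=
  if k ≤ n then (-1) ^ k * ((ascPochhammer ℂ (k + 1)).eval (u + 1))⁻¹ * (1 / 2) ^ (u + k + 1)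
  else (-1) ^ (n + 1) * ((ascPochhammer ℂ (n + 1)).eval (u + 1))⁻¹

/-- The weight function of the `k`-th term of the `(n+1)`-fold integration by parts. -/
noncomputable def partsWeight (u : ℂ) (n k : ℕ) (x : ℝ) : ℂ :=
  if k ≤ n then 1 else (x : ℂ) ^ (u + n + 1)

instance (n k : ℕ) : IsFiniteMeasure (partsMeasure n k) := by
  unfold partsMeasure
  split_ifs <;> infer_instance

lemma ae_partsMeasure (n k : ℕ) : ∀ᵐ x ∂partsMeasure n k, x ∈ Icc (0 : ℝ) (1 / 2) := by
  unfold partsMeasure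
  split_ifs
  · exact (ae_dirac_iff (measurableSet_Icc (a := (0 : ℝ)) (b := 1 / 2))).2 (by norm_num)
  · exact ae_restrict_mem measurableSet_Icc

lemma integral_halfSegment (f : ℝ → ℂ) : ∫ x, f x ∂halfSegment = ∫ x in (0 : ℝ)..(1 / 2), f x := by
  rw [intervalIntegral.integral_of_le (by norm_num), integral_Icc_eq_integral_Ioc]

lemma integrable_cpow_halfSegment {u : ℂ} (hu : -1 < u.re) :
    Integrable (fun x : ℝ => (x : ℂ) ^ u) halfSegment := by
  have h := intervalIntegral.intervalIntegrable_cpow' (a := 0) (b := 1 / 2) hu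
  rw [intervalIntegrable_iff_integrableOn_Icc_of_le (by norm_num)] at h
  exact h

lemma integrable_partsWeight {u : ℂ} {n : ℕ} (hu : -1 < (u + n + 1).re) (k : ℕ) :
    Integrable (partsWeight u n k) (partsMeasure n k) := by
  unfold partsWeight partsMeasure
  split_ifs
  · exact integrable_const 1
  · exact integrable_cpow_halfSegment hu

/-- A single integration by parts. -/
lemma integral_cpow_mul_eq {u : ℂ} (hu : -1 < u.re) {g g' : ℝ → ℂ}
    (hg : ∀ x ∈ Icc (0 : ℝ) (1 / 2), HasDerivAt g (g' x) x)
    (hg' : ContinuousOn g' (Icc (0 : ℝ) (1 / 2))) :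
    ∫ x : ℝ, (x : ℂ) ^ u * g x ∂halfSegment =
      (u + 1)⁻¹ * (1 / 2) ^ (u + 1) * g (1 / 2) -
        (u + 1)⁻¹ * ∫ x : ℝ, (x : ℂ) ^ (u + 1) * g' x ∂halfSegment := by
  have hu1 : 0 < (u + 1).re := by rw [Complex.add_re, Complex.one_re]; linarith
  have hu0 : u + 1 ≠ 0 := fun h => by rw [h] at hu1; simp at hu1
  have h12 : uIcc (0 : ℝ) (1 / 2) = Icc 0 (1 / 2) := uIcc_of_le (by norm_num)
  have hcont : Continuous fun x : ℝ => (x : ℂ) ^ (u + 1) := Complex.continuous_ofReal_cpow_const hu1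
  have h := intervalIntegral.integral_mul_deriv_eq_deriv_mul_of_hasDerivAt (a := (0 : ℝ))
    (b := 1 / 2) (u := g) (u' := g') (v := fun x : ℝ => (x : ℂ) ^ (u + 1) * (u + 1)⁻¹)
    (v' := fun x : ℝ => (x : ℂ) ^ u) ?_ ?_ ?_ ?_ ?_ ?_
  · rw [integral_halfSegment, integral_halfSegment]
    have e1 : ∫ x in (0 : ℝ)..(1 / 2), (x : ℂ) ^ u * g x =
        ∫ x in (0 : ℝ)..(1 / 2), g x * (x : ℂ) ^ u := by simp_rw [mul_comm]
    have e2 : ∫ x in (0 : ℝ)..(1 / 2), g' x * ((x : ℂ) ^ (u + 1) * (u + 1)⁻¹) =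
        (u + 1)⁻¹ * ∫ x in (0 : ℝ)..(1 / 2), (x : ℂ) ^ (u + 1) * g' x := by
      rw [← intervalIntegral.integral_const_mul]
      refine intervalIntegral.integral_congr fun x _ => ?_
      ring
    rw [e1, h, e2]
    have e3 : ((0 : ℝ) : ℂ) ^ (u + 1) = 0 := by rw [Complex.ofReal_zero, Complex.zero_cpow hu0]
    rw [e3]
    push_cast
    ring
  · rw [h12]; exact fun x hx => (hg x hx).continuousAt.continuousWithinAt
  · exact (hcont.mul continuous_const).continuousOn
  · intro x hx
    rw [min_eq_left (by norm_num), max_eq_right (by norm_num)] at hx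
    exact hg x (Ioo_subset_Icc_self hx)
  · intro x hx
    rw [min_eq_left (by norm_num), max_eq_right (by norm_num)] at hx
    have := (hasDerivAt_ofReal_cpow_const hx.1.ne' hu0).mul_const (u + 1)⁻¹
    rw [add_sub_cancel_right, mul_right_comm, mul_inv_cancel₀ hu0, one_mul] at this
    exact this
  · exact (hg'.mono (by rw [h12])).intervalIntegrable
  · exact intervalIntegral.intervalIntegrable_cpow' hu

lemma contDiffAt_iteratedDeriv {g : ℝ → ℂ} {x : ℝ} (hg : ContDiffAt ℝ (⊤ : ℕ∞) g x) (k : ℕ) :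
    ContDiffAt ℝ (⊤ : ℕ∞) (iteratedDeriv k g) x := by
  induction k with
  | zero => simpa using hg
  | succ k ih =>
    rw [iteratedDeriv_succ]
    exact (ih.fderiv_right (m := (⊤ : ℕ∞)) (by norm_cast)).clm_apply contDiffAt_const

/-- `(n+1)`-fold integration by parts on `[0, 1/2]` against a power of `x`. -/
lemma integral_cpow_mul_eq_sum {u : ℂ} (hu : -1 < u.re) {g : ℝ → ℂ}
    (hg : ∀ x ∈ Icc (0 : ℝ) (1 / 2), ContDiffAt ℝ (⊤ : ℕ∞) g x) (n : ℕ) :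
    ∫ x : ℝ, (x : ℂ) ^ u * g x ∂halfSegment = ∑ k ∈ Finset.range (n + 2), partsCoeff u n k *
      ∫ x, partsWeight u n k x * iteratedDeriv k g x ∂partsMeasure n k := by
  have hder : ∀ k : ℕ, ∀ x ∈ Icc (0 : ℝ) (1 / 2),
      HasDerivAt (iteratedDeriv k g) (iteratedDeriv (k + 1) g x) x := fun k x hx => by
    rw [iteratedDeriv_succ]
    refine DifferentiableAt.hasDerivAt ?_
    exact (contDiffAt_iteratedDeriv (hg x hx) k).differentiableAt (by simp)
  have hcont : ∀ k : ℕ, ContinuousOn (iteratedDeriv k g) (Icc (0 : ℝ) (1 / 2)) :=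
    fun k x hx => (hder k x hx).continuousAt.continuousWithinAt
  have hA : ∀ n : ℕ, ∫ x : ℝ, (x : ℂ) ^ u * g x ∂halfSegment =
      ∑ k ∈ Finset.range n, (-1) ^ k * ((ascPochhammer ℂ (k + 1)).eval (u + 1))⁻¹ *
        (1 / 2) ^ (u + k + 1) * iteratedDeriv k g (1 / 2) +
      (-1) ^ n * ((ascPochhammer ℂ n).eval (u + 1))⁻¹ *
        ∫ x : ℝ, (x : ℂ) ^ (u + n) * iteratedDeriv n g x ∂halfSegment := by
    intro n
    induction n with
    | zero => simp
    | succ n ih =>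
      have hun : -1 < (u + n).re := by
        rw [Complex.add_re, Complex.natCast_re]
        linarith [Nat.cast_nonneg (α := ℝ) n]
      rw [ih, Finset.sum_range_succ, integral_cpow_mul_eq hun (hder n) (hcont (n + 1)),
        ascPochhammer_succ_eval, mul_inv, add_right_comm u 1 (n : ℂ), pow_succ]
      push_cast
      rw [← add_assoc]
      ring
  rw [hA (n + 1)]
  conv_rhs => rw [Finset.sum_range_succ]
  congr 1
  · refine Finset.sum_congr rfl fun k hk => ?_
    have hk' : k ≤ n := Nat.lt_succ_iff.1 (Finset.mem_range.1 hk)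
    simp only [partsCoeff, partsWeight, partsMeasure, if_pos hk', integral_dirac, one_mul]
  · have hn : ¬ n + 1 ≤ n := by omega
    simp only [partsCoeff, partsWeight, partsMeasure, if_neg hn]
    push_cast
    rw [← add_assoc]

/-! ### Partial derivatives -/

lemma partialPow_succ {e : ℕ} (i : Fin e) (k : ℕ) (f : (Fin e → ℝ) → ℂ) :
    partialPow i (k + 1) f = partialPow i 1 (partialPow i k f) := by
  ext x
  simp [partialPow, iteratedDeriv_succ]

lemma partialPow_zero {e : ℕ} (i : Fin e) (f : (Fin e → ℝ) → ℂ) : partialPow i 0 f = f := by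
  ext x
  simp [partialPow]

lemma partialPow_one_eq {e : ℕ} {i : Fin e} {f : (Fin e → ℝ) → ℂ} {x : Fin e → ℝ}
    (hf : DifferentiableAt ℝ f x) : partialPow i 1 f x = fderiv ℝ f x (Pi.single i 1) := by
  rw [partialPow, iteratedDeriv_one]
  have h := hasDerivAt_update x i (x i)
  have hf' : HasFDerivAt f (fderiv ℝ f x) (update x i (x i)) := by
    rw [update_eq_self]; exact hf.hasFDerivAt
  exact (hf'.comp_hasDerivAt (x i) h).deriv

lemma contDiffAt_partialPow {e : ℕ} (i : Fin e) (k : ℕ) {f : (Fin e → ℝ) → ℂ} {x : Fin e → ℝ}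
    (hf : ContDiffAt ℝ (⊤ : ℕ∞) f x) : ContDiffAt ℝ (⊤ : ℕ∞) (partialPow i k f) x := by
  induction k with
  | zero => rwa [partialPow_zero]
  | succ k ih =>
    rw [partialPow_succ]
    have h1 : ContDiffAt ℝ (⊤ : ℕ∞) (fun y => fderiv ℝ (partialPow i k f) y (Pi.single i 1)) x :=
      (ih.fderiv_right (m := (⊤ : ℕ∞)) (by norm_cast)).clm_apply contDiffAt_const
    refine h1.congr_of_eventuallyEq ?_
    have h2 := (ih.of_le (m := 1) (by norm_cast)).eventually (by norm_num)
    filter_upwards [h2] with y hy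
    exact partialPow_one_eq (hy.differentiableAt one_ne_zero)

lemma contDiffAt_foldr_partialPow {e : ℕ} {ι : Type*} (l : List ι) (j : ι → Fin e) (α : ι → ℕ)
    {f : (Fin e → ℝ) → ℂ} {x : Fin e → ℝ} (hf : ContDiffAt ℝ (⊤ : ℕ∞) f x) :
    ContDiffAt ℝ (⊤ : ℕ∞) (l.foldr (fun i g => partialPow (j i) (α i) g) f) x := by
  induction l with
  | nil => simpa using hf
  | cons i l ih => exact contDiffAt_partialPow (j i) (α i) ih

lemma foldr_partialPow_cons {e : ℕ} (l : List (Fin e)) (α : Fin e → ℕ)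
    (f : (Fin (e + 1) → ℝ) → ℂ) (t : ℝ) (y : Fin e → ℝ) :
    l.foldr (fun i g => partialPow i.succ (α i) g) f (Fin.cons t y) =
      l.foldr (fun i g => partialPow i (α i) g) (fun y => f (Fin.cons t y)) y := by
  induction l generalizing y with
  | nil => simp
  | cons i l ih =>
    simp only [List.foldr_cons, partialPow, Fin.cons_succ]
    congr 1
    ext τ
    rw [← ih, Fin.cons_update]

lemma mixedPartial_cons {e : ℕ} (k : ℕ) (α : Fin e → ℕ) (f : (Fin (e + 1) → ℝ) → ℂ) (t : ℝ)
    (y : Fin e → ℝ) : mixedPartial (Fin.cons k α) f (Fin.cons t y) =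
      iteratedDeriv k (fun τ => mixedPartial α (fun y => f (Fin.cons τ y)) y) t := by
  rw [mixedPartial, List.finRange_succ, List.foldr_cons, List.foldr_map, partialPow]
  simp only [Fin.cons_zero, Fin.cons_succ, Fin.update_cons_zero]
  congr 1
  ext τ
  rw [foldr_partialPow_cons]
  rfl

lemma contDiffAt_mixedPartial {e : ℕ} (α : Fin e → ℕ) {f : (Fin e → ℝ) → ℂ} {x : Fin e → ℝ}
    (hf : ContDiffAt ℝ (⊤ : ℕ∞) f x) : ContDiffAt ℝ (⊤ : ℕ∞) (mixedPartial α f) x :=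
  contDiffAt_foldr_partialPow _ (fun i => i) α hf

lemma contDiffAt_mixedPartial_tail {e : ℕ} (α : Fin e → ℕ) {f : (Fin (e + 1) → ℝ) → ℂ}
    {x : Fin (e + 1) → ℝ} (hf : ContDiffAt ℝ (⊤ : ℕ∞) f x) :
    ContDiffAt ℝ (⊤ : ℕ∞) (fun x : Fin (e + 1) → ℝ =>
      mixedPartial α (fun y => f (Fin.cons (x 0) y)) (fun l => x l.succ)) x := by
  have h := contDiffAt_foldr_partialPow (List.finRange e) Fin.succ α hf
  refine h.congr_of_eventuallyEq (Eventually.of_forall fun y => ?_)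
  have := foldr_partialPow_cons (List.finRange e) α f (y 0) (fun l => y l.succ)
  rw [show (Fin.cons (y 0) (fun l => y l.succ) : Fin (e + 1) → ℝ) = y from
    Fin.cons_self_tail y] at this
  exact this.symm

/-! ### Integration by parts on the cube `[0, 1/2]^(d-1)` -/

lemma measurePreserving_cons {e : ℕ} (ν : Fin (e + 1) → Measure ℝ) [∀ i, SigmaFinite (ν i)] :
    MeasurePreserving (fun z : ℝ × (Fin e → ℝ) => (Fin.cons z.1 z.2 : Fin (e + 1) → ℝ))
      ((ν 0).prod (Measure.pi fun i => ν i.succ)) (Measure.pi ν) := by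
  have h := (measurePreserving_piFinSuccAbove ν 0).symm
  have h2 : (fun z : ℝ × (Fin e → ℝ) => (Fin.cons z.1 z.2 : Fin (e + 1) → ℝ)) =
      ⇑(MeasurableEquiv.piFinSuccAbove (fun _ : Fin (e + 1) => ℝ) 0).symm := by
    ext z i
    simp [MeasurableEquiv.piFinSuccAbove, Fin.insertNthEquiv]
  rw [h2]
  simpa [Fin.succAbove_zero] using! h

/-- Fubini's theorem for the first variable. -/
lemma integral_pi_succ {e : ℕ} {ν : Fin (e + 1) → Measure ℝ} [∀ i, IsFiniteMeasure (ν i)]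
    {H : (Fin (e + 1) → ℝ) → ℂ} (hH : Integrable H (Measure.pi ν)) :
    ∫ x, H x ∂Measure.pi ν =
      ∫ t, ∫ y, H (Fin.cons t y) ∂(Measure.pi fun i => ν i.succ) ∂ν 0 ∧
    ∫ x, H x ∂Measure.pi ν =
      ∫ y, ∫ t, H (Fin.cons t y) ∂ν 0 ∂(Measure.pi fun i => ν i.succ) ∧
    Integrable (fun y => ∫ t, H (Fin.cons t y) ∂ν 0) (Measure.pi fun i => ν i.succ) ∧
    Integrable (fun t => ∫ y, H (Fin.cons t y) ∂(Measure.pi fun i => ν i.succ)) (ν 0) := by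
  have hmp := measurePreserving_cons ν
  have hI := (hmp.integrable_comp hH.1).2 hH
  have hmap := integral_map (μ := (ν 0).prod (Measure.pi fun i => ν i.succ))
    hmp.measurable.aemeasurable
    (f := H) (by rw [hmp.map_eq]; exact hH.1)
  rw [hmp.map_eq] at hmap
  refine ⟨?_, ?_, hI.integral_prod_right, hI.integral_prod_left⟩
  · rw [hmap]; exact integral_prod _ hI
  · rw [hmap]; exact integral_prod_symm _ hI

lemma ae_pi_mem_halfCube {e : ℕ} {ν : Fin e → Measure ℝ} [∀ i, IsFiniteMeasure (ν i)]
    (hν : ∀ i, ∀ᵐ x ∂ν i, x ∈ Icc (0 : ℝ) (1 / 2)) :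
    ∀ᵐ x ∂Measure.pi ν, x ∈ halfCube (Fin e) := by
  have h : ∀ᵐ x ∂Measure.pi ν, ∀ i, x i ∈ Icc (0 : ℝ) (1 / 2) := by
    rw [ae_all_iff]
    exact fun i => (Measure.quasiMeasurePreserving_eval ν i).ae (hν i)
  filter_upwards [h] with x hx i _ using hx i

lemma isCompact_halfCube (ι : Type*) : IsCompact (halfCube ι) :=
  isCompact_univ_pi fun _ => isCompact_Icc

lemma measurableSet_halfCube (ι : Type*) [Countable ι] : MeasurableSet (halfCube ι) :=
  MeasurableSet.univ_pi fun _ => measurableSet_Icc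

lemma integrable_prod_mul_of_continuousOn {e : ℕ} {ν : Fin e → Measure ℝ}
    [∀ i, IsFiniteMeasure (ν i)] (hν : ∀ i, ∀ᵐ x ∂ν i, x ∈ Icc (0 : ℝ) (1 / 2))
    {w : Fin e → ℝ → ℂ} (hw : ∀ i, Integrable (w i) (ν i)) {h : (Fin e → ℝ) → ℂ}
    (hh : ContinuousOn h (halfCube (Fin e))) :
    Integrable (fun x => (∏ i, w i (x i)) * h x) (Measure.pi ν) := by
  have hae := ae_pi_mem_halfCube hν
  have hrestr : (Measure.pi ν).restrict (halfCube (Fin e)) = Measure.pi ν :=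
    Measure.restrict_eq_self_of_ae_mem hae
  have hmeas : AEStronglyMeasurable h (Measure.pi ν) := by
    rw [← hrestr]
    exact hh.aestronglyMeasurable (measurableSet_halfCube _)
  obtain ⟨C, hC⟩ := (isCompact_halfCube (Fin e)).exists_bound_of_continuousOn hh
  refine (Integrable.fintype_prod hw).mul_bdd (c := C) hmeas ?_
  filter_upwards [hae] with x hx using hC x hx

lemma cons_mem_halfCube {e : ℕ} {t : ℝ} {y : Fin e → ℝ} (ht : t ∈ Icc (0 : ℝ) (1 / 2))
    (hy : y ∈ halfCube (Fin e)) : (Fin.cons t y : Fin (e + 1) → ℝ) ∈ halfCube (Fin (e + 1)) := by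
  intro i _
  refine Fin.cases ?_ (fun j => ?_) i
  · simpa using ht
  · simpa using hy j (mem_univ _)

lemma sum_piFinset_succ {M : Type*} [AddCommMonoid M] {e : ℕ} (T : Fin (e + 1) → Finset ℕ)
    (F : (Fin (e + 1) → ℕ) → M) :
    ∑ β ∈ Fintype.piFinset T, F β =
      ∑ β ∈ Fintype.piFinset (fun i : Fin e => T i.succ), ∑ k ∈ T 0, F (Fin.cons k β) := by
  rw [Finset.sum_comm, ← Finset.sum_product']
  refine Finset.sum_nbij' (fun β => (β 0, fun i => β i.succ)) (fun p => Fin.cons p.1 p.2)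
    ?_ ?_ ?_ ?_ ?_
  · intro β hβ
    rw [Fintype.mem_piFinset] at hβ
    simp [hβ]
  · intro p hp
    rw [Finset.mem_product, Fintype.mem_piFinset] at hp
    rw [Fintype.mem_piFinset]
    intro i
    refine Fin.cases ?_ (fun j => ?_) i
    · simpa using hp.1
    · simpa using hp.2 j
  · intro β _
    exact Fin.cons_self_tail β
  · intro p _
    simp
  · intro β _
    congr 1
    exact (Fin.cons_self_tail β).symm

/-- Iterated integration by parts on the cube `[0, 1/2]^e`. -/
theorem integral_halfCube_eq_sum {e : ℕ} {f : (Fin e → ℝ) → ℂ}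
    (hf : ∀ x ∈ halfCube (Fin e), ContDiffAt ℝ (⊤ : ℕ∞) f x) {u : Fin e → ℂ}
    (hu : ∀ i, -1 < (u i).re) (n : Fin e → ℕ) :
    ∫ x, (∏ i, (x i : ℂ) ^ u i) * f x ∂(Measure.pi fun _ : Fin e => halfSegment) =
      ∑ β ∈ Fintype.piFinset (fun i => Finset.range (n i + 2)),
        (∏ i, partsCoeff (u i) (n i) (β i)) *
          ∫ x, (∏ i, partsWeight (u i) (n i) (β i) (x i)) * mixedPartial β f x
            ∂(Measure.pi fun i => partsMeasure (n i) (β i)) := by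
  have hun : ∀ {e : ℕ} {u : Fin e → ℂ} (hu : ∀ i, -1 < (u i).re) (n : Fin e → ℕ),
      ∀ i, -1 < (u i + n i + 1).re := fun hu n i => by
    rw [Complex.add_re, Complex.add_re, Complex.natCast_re, Complex.one_re]
    linarith [hu i, Nat.cast_nonneg (α := ℝ) (n i)]
  have hhalf : ∀ᵐ x ∂halfSegment, x ∈ Icc (0 : ℝ) (1 / 2) := ae_restrict_mem measurableSet_Icc
  induction e with
  | zero =>
    have hν : ∀ β : Fin 0 → ℕ, (Measure.pi fun i => partsMeasure (n i) (β i)) =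
        Measure.pi fun _ : Fin 0 => halfSegment := fun β => by
      congr 1
      exact funext fun i => i.elim0
    simp only [hν]
    simp [mixedPartial]
  | succ e ih =>
    -- peel off the first variable, apply the induction hypothesis to the others
    have hslice : ∀ t ∈ Icc (0 : ℝ) (1 / 2), ∀ y ∈ halfCube (Fin e),
        ContDiffAt ℝ (⊤ : ℕ∞) (fun y : Fin e → ℝ => f (Fin.cons t y)) y := fun t ht y hy => by
      refine (hf _ (cons_mem_halfCube ht hy)).comp y (ContDiff.contDiffAt ?_)
      refine contDiff_pi.2 fun i => ?_
      refine Fin.cases ?_ (fun j => ?_) i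
      · simpa using contDiff_const
      · simpa using contDiff_apply ℝ ℝ j
    have hfc : ContinuousOn f (halfCube (Fin (e + 1))) :=
      fun x hx => (hf x hx).continuousAt.continuousWithinAt
    have h1 := (integral_pi_succ (ν := fun _ => halfSegment)
      (integrable_prod_mul_of_continuousOn (fun _ => hhalf)
        (w := fun i t => (t : ℂ) ^ u i) (fun i => integrable_cpow_halfSegment (hu i)) hfc)).1
    rw [h1]
    let G : (Fin e → ℕ) → ℝ → (Fin e → ℝ) → ℂ := fun β t y =>
      mixedPartial β (fun y => f (Fin.cons t y)) y
    have hGs : ∀ β, ∀ x ∈ halfCube (Fin (e + 1)), ContDiffAt ℝ (⊤ : ℕ∞)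
        (fun x : Fin (e + 1) → ℝ => G β (x 0) (fun l => x l.succ)) x :=
      fun β x hx => contDiffAt_mixedPartial_tail β (hf x hx)
    have hinner : ∀ᵐ t ∂halfSegment,
        ∫ y, (∏ i, ((Fin.cons t y : Fin (e + 1) → ℝ) i : ℂ) ^ u i) * f (Fin.cons t y)
          ∂(Measure.pi fun _ : Fin e => halfSegment) =
        ∑ β ∈ Fintype.piFinset (fun i : Fin e => Finset.range (n i.succ + 2)),
          (∏ i : Fin e, partsCoeff (u i.succ) (n i.succ) (β i)) *
          ∫ y, (t : ℂ) ^ u 0 * ((∏ i : Fin e, partsWeight (u i.succ) (n i.succ) (β i) (y i)) *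
            G β t y) ∂(Measure.pi fun i : Fin e => partsMeasure (n i.succ) (β i)) := by
      filter_upwards [hhalf] with t ht
      have h2 := ih (hslice t ht) (u := fun i => u i.succ) (fun i => hu i.succ) fun i => n i.succ
      simp only [Fin.prod_univ_succ, Fin.cons_zero, Fin.cons_succ, mul_assoc]
      rw [integral_const_mul, h2, Finset.mul_sum]
      refine Finset.sum_congr rfl fun β _ => ?_
      rw [integral_const_mul]
      ring
    rw [integral_congr_ae hinner, sum_piFinset_succ]
    -- exchange the order of integration, and integrate by parts in the first variable
    let w : (Fin e → ℕ) → Fin (e + 1) → ℝ → ℂ := fun β =>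
      Fin.cons (fun t : ℝ => (t : ℂ) ^ u 0) fun i => partsWeight (u i.succ) (n i.succ) (β i)
    let ν : (Fin e → ℕ) → Fin (e + 1) → Measure ℝ := fun β =>
      Fin.cons halfSegment fun i => partsMeasure (n i.succ) (β i)
    have hνfin : ∀ β i, IsFiniteMeasure (ν β i) := fun β i => by
      refine Fin.cases ?_ (fun j => ?_) i
      · simp only [ν, Fin.cons_zero]; infer_instance
      · simp only [ν, Fin.cons_succ]; infer_instance
    have hI : ∀ β, Integrable (fun x : Fin (e + 1) → ℝ =>
        (∏ i, w β i (x i)) * G β (x 0) (fun l => x l.succ)) (Measure.pi (ν β)) := fun β => by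
      refine integrable_prod_mul_of_continuousOn (fun i => ?_) (fun i => ?_)
        fun x hx => (hGs β x hx).continuousAt.continuousWithinAt
      · refine Fin.cases ?_ (fun j => ?_) i
        · exact hhalf
        · exact ae_partsMeasure _ _
      · refine Fin.cases ?_ (fun j => ?_) i
        · exact integrable_cpow_halfSegment (hu 0)
        · exact integrable_partsWeight (hun hu n j.succ) _
    have hwG : ∀ β t y, (∏ i, w β i ((Fin.cons t y : Fin (e + 1) → ℝ) i)) *
        G β ((Fin.cons t y : Fin (e + 1) → ℝ) 0)
          (fun l => (Fin.cons t y : Fin (e + 1) → ℝ) l.succ) =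
        (t : ℂ) ^ u 0 * ((∏ i : Fin e, partsWeight (u i.succ) (n i.succ) (β i) (y i)) *
          G β t y) := fun β t y => by
      simp [w, Fin.prod_univ_succ, mul_assoc]
    have hfub := fun β => integral_pi_succ (hI β)
    simp only [hwG] at hfub
    simp only [ν, Fin.cons_zero, Fin.cons_succ] at hfub
    rw [integral_finsetSum _ fun β _ => ((hfub β).2.2.2.const_mul _)]
    refine Finset.sum_congr rfl fun β _ => ?_
    rw [integral_const_mul, ← (hfub β).1, (hfub β).2.1]
    have hstep : ∀ᵐ y ∂(Measure.pi fun i : Fin e => partsMeasure (n i.succ) (β i)),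
        ∫ t : ℝ, (t : ℂ) ^ u 0 * ((∏ i : Fin e, partsWeight (u i.succ) (n i.succ) (β i) (y i)) *
          G β t y) ∂halfSegment =
        ∑ k ∈ Finset.range (n 0 + 2), partsCoeff (u 0) (n 0) k *
          ∫ t : ℝ, (∏ i, partsWeight (u i) (n i) ((Fin.cons k β : Fin (e + 1) → ℕ) i)
            ((Fin.cons t y : Fin (e + 1) → ℝ) i)) * mixedPartial (Fin.cons k β) f (Fin.cons t y)
            ∂partsMeasure (n 0) k := by
      filter_upwards [ae_pi_mem_halfCube fun i : Fin e => ae_partsMeasure (n i.succ) (β i)]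
        with y hy
      have hg : ∀ t ∈ Icc (0 : ℝ) (1 / 2), ContDiffAt ℝ (⊤ : ℕ∞) (fun t => G β t y) t := by
        intro t ht
        have hc : ContDiffAt ℝ (⊤ : ℕ∞) (fun t : ℝ => (Fin.cons t y : Fin (e + 1) → ℝ)) t := by
          refine ContDiff.contDiffAt (contDiff_pi.2 fun i => ?_)
          refine Fin.cases ?_ (fun j => ?_) i
          · simp only [Fin.cons_zero]
            exact contDiff_id
          · simpa using contDiff_const
        have := (hGs β _ (cons_mem_halfCube ht hy)).comp t hc
        simpa [Function.comp_def] using this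
      have h3 := integral_cpow_mul_eq_sum (hu 0) hg (n 0)
      have h4 : ∀ t : ℝ, (t : ℂ) ^ u 0 * ((∏ i : Fin e, partsWeight (u i.succ) (n i.succ) (β i)
          (y i)) * G β t y) = (∏ i : Fin e, partsWeight (u i.succ) (n i.succ) (β i) (y i)) *
          ((t : ℂ) ^ u 0 * G β t y) := fun t => by ring
      simp_rw [h4]
      rw [integral_const_mul, h3, Finset.mul_sum]
      refine Finset.sum_congr rfl fun k _ => ?_
      rw [mul_left_comm, ← integral_const_mul]
      congr 1
      refine integral_congr_ae (Eventually.of_forall fun t => ?_)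
      simp only [mixedPartial_cons, Fin.prod_univ_succ, Fin.cons_zero, Fin.cons_succ, G]
      ring
    rw [integral_congr_ae hstep]
    have hI2 : ∀ k, Integrable (fun x : Fin (e + 1) → ℝ =>
        (∏ i, partsWeight (u i) (n i) ((Fin.cons k β : Fin (e + 1) → ℕ) i) (x i)) *
          mixedPartial (Fin.cons k β) f x)
        (Measure.pi fun i => partsMeasure (n i) ((Fin.cons k β : Fin (e + 1) → ℕ) i)) := fun k =>
      integrable_prod_mul_of_continuousOn (fun i => ae_partsMeasure _ _)
        (fun i => integrable_partsWeight (hun hu n i) _)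
        fun x hx => (contDiffAt_mixedPartial _ (hf x hx)).continuousAt.continuousWithinAt
    have hfub2 := fun k => integral_pi_succ (hI2 k)
    have hpi : ∀ k, (Measure.pi fun i : Fin e => partsMeasure (n i.succ)
        ((Fin.cons k β : Fin (e + 1) → ℕ) i.succ)) =
        Measure.pi fun i : Fin e => partsMeasure (n i.succ) (β i) := fun k => by simp
    rw [integral_finsetSum _ fun k _ => ((hfub2 k).2.2.1.const_mul _), Finset.mul_sum]
    refine Finset.sum_congr rfl fun k _ => ?_
    rw [integral_const_mul, (hfub2 k).2.1]
    simp only [Fin.prod_univ_succ, Fin.cons_zero, Fin.cons_succ]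
    ring

/-! ### The function `F` in terms of iterated integration by parts -/

/-- The integral in a term of the iterated integration by parts, where `β i ≤ n i` stands for the
evaluation of the `β i`-th derivative at `1/2` in the `i`-th variable. -/
noncomputable def partsIntegral {e : ℕ} (n : Fin e → ℕ) (u : Fin e → ℂ) (β : Fin e → ℕ)
    (g : (Fin e → ℝ) → ℂ) : ℂ :=
  ∫ x, (∏ i, partsWeight (u i) (n i) (β i) (x i)) * g x
    ∂(Measure.pi fun i => partsMeasure (n i) (β i))

lemma measurable_glue {e : ℕ} (S : Finset (Fin e)) : Measurable (glue S) := by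
  refine measurable_pi_iff.2 fun i => ?_
  unfold glue
  split_ifs with h
  · exact measurable_const
  · exact measurable_pi_apply _

lemma mem_orders {e : ℕ} {n : Fin (e + 1) → ℕ} {S : Finset (Fin e)} {α : Fin e → ℕ} :
    α ∈ orders n S ↔ ∀ i, (i ∈ S → α i ≤ n i.succ) ∧ (i ∉ S → α i = n i.succ + 1) := by
  rw [orders, Fintype.mem_piFinset]
  refine forall_congr' fun i => ?_
  by_cases h : i ∈ S <;> simp [h]

lemma le_iff_of_mem_orders {e : ℕ} {n : Fin (e + 1) → ℕ} {S : Finset (Fin e)} {α : Fin e → ℕ}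
    (h : α ∈ orders n S) (i : Fin e) : α i ≤ n i.succ ↔ i ∈ S := by
  have hi := mem_orders.1 h i
  by_cases hS : i ∈ S
  · simp [hS, hi.1 hS]
  · simp [hS, hi.2 hS]

/-- The map `glue S` transports Lebesgue measure on the cube to a product of Lebesgue and Dirac
measures. -/
lemma measurePreserving_glue {e : ℕ} {n : Fin (e + 1) → ℕ} {S : Finset (Fin e)} {α : Fin e → ℕ}
    (h : α ∈ orders n S) :
    MeasurePreserving (glue S) (volume.restrict (halfCube {i : Fin e // i ∉ S}))
      (Measure.pi fun i => partsMeasure (n i.succ) (α i)) := by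
  refine ⟨measurable_glue S, ?_⟩
  symm
  refine Measure.pi_eq fun s hs => ?_
  rw [Measure.map_apply (measurable_glue S) (MeasurableSet.univ_pi hs), halfCube, volume_pi,
    Measure.restrict_pi_pi]
  have hprod : ∏ i, partsMeasure (n i.succ) (α i) (s i) =
      (∏ i : {i : Fin e // i ∈ S}, Measure.dirac (1 / 2 : ℝ) (s i)) *
        ∏ i : {i : Fin e // i ∉ S}, halfSegment (s i) := by
    rw [← Fintype.prod_subtype_mul_prod_subtype (fun i => i ∈ S)]
    congr 1
    · refine Finset.prod_congr (by ext; simp) fun i _ => ?_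
      rw [partsMeasure, if_pos ((le_iff_of_mem_orders h i.1).2 i.2)]
    · refine Finset.prod_congr rfl fun i _ => ?_
      rw [partsMeasure, if_neg fun h' => i.2 ((le_iff_of_mem_orders h i.1).1 h')]
  rw [hprod]
  by_cases hS : ∀ i ∈ S, (1 / 2 : ℝ) ∈ s i
  · have hpre : glue S ⁻¹' univ.pi s = univ.pi fun i : {i : Fin e // i ∉ S} => s i := by
      ext y
      simp only [mem_preimage, mem_univ_pi, glue]
      constructor
      · intro hy i
        have := hy i.1
        rwa [dif_neg i.2] at this
      · intro hy i
        split_ifs with hi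
        · exact hS i hi
        · exact hy ⟨i, hi⟩
    rw [hpre, Measure.pi_pi, Finset.prod_eq_one (s := (Finset.univ : Finset {i : Fin e // i ∈ S}))
      fun i _ => by rw [Measure.dirac_apply' _ (hs i), indicator_of_mem (hS i.1 i.2)]; rfl, one_mul]
  · push Not at hS
    obtain ⟨i, hi, hsi⟩ := hS
    have hpre : glue S ⁻¹' univ.pi s = ∅ := by
      ext y
      simp only [mem_preimage, mem_univ_pi, mem_empty_iff_false, iff_false]
      intro hy
      have := hy i
      rw [glue, dif_pos hi] at this
      exact hsi this
    rw [hpre, measure_empty, Finset.prod_eq_zero (Finset.mem_univ (⟨i, hi⟩ : {i // i ∈ S})),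
      zero_mul]
    rw [Measure.dirac_apply' _ (hs i)]
    simpa using hsi

lemma innerIntegrand_eq {e : ℕ} {n : Fin (e + 1) → ℕ} {S : Finset (Fin e)} {α : Fin e → ℕ}
    (h : α ∈ orders n S) (u : Fin e → ℂ) (f : (Fin e → ℝ) → ℂ) :
    innerIntegrand n u f S α = (fun x => (∏ i, partsWeight (u i) (n i.succ) (α i) (x i)) *
      mixedPartial α f x) ∘ glue S := by
  ext y
  simp only [innerIntegrand, Function.comp_apply]
  congr 1
  rw [← Fintype.prod_subtype_mul_prod_subtype (fun i => i ∈ S)]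
  refine Eq.symm ((congrArg (· * _) (Finset.prod_eq_one fun i _ => ?_)).trans
    ((one_mul _).trans ?_))
  · rw [partsWeight, if_pos ((le_iff_of_mem_orders h i.1).2 i.2)]
  · refine Finset.prod_congr rfl fun i _ => ?_
    rw [partsWeight, if_neg fun h' => i.2 ((le_iff_of_mem_orders h i.1).1 h'), glue, dif_neg i.2]

lemma integrable_partsIntegrand {e : ℕ} {n : Fin e → ℕ} {u : Fin e → ℂ}
    (hu : ∀ i, -1 < (u i + n i + 1).re) (β : Fin e → ℕ) {g : (Fin e → ℝ) → ℂ}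
    (hg : ContinuousOn g (halfCube (Fin e))) :
    Integrable (fun x => (∏ i, partsWeight (u i) (n i) (β i) (x i)) * g x)
      (Measure.pi fun i => partsMeasure (n i) (β i)) :=
  integrable_prod_mul_of_continuousOn (fun _ => ae_partsMeasure _ _)
    (fun i => integrable_partsWeight (hu i) _) hg

lemma integral_innerIntegrand {e : ℕ} {n : Fin (e + 1) → ℕ} {S : Finset (Fin e)} {α : Fin e → ℕ}
    (h : α ∈ orders n S) {u : Fin e → ℂ} (hu : ∀ i, -1 < (u i + n i.succ + 1).re)
    {f : (Fin e → ℝ) → ℂ} (hf : ContinuousOn (mixedPartial α f) (halfCube (Fin e))) :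
    IntegrableOn (innerIntegrand n u f S α) (halfCube {i : Fin e // i ∉ S}) ∧
    ∫ y in halfCube {i : Fin e // i ∉ S}, innerIntegrand n u f S α y =
      partsIntegral (fun i => n i.succ) u α (mixedPartial α f) := by
  have hI := integrable_partsIntegrand (n := fun i => n i.succ) hu α hf
  have hmp := measurePreserving_glue h
  rw [innerIntegrand_eq h]
  refine ⟨(hmp.integrable_comp hI.1).2 hI, ?_⟩
  have hmap := integral_map (μ := volume.restrict (halfCube {i : Fin e // i ∉ S}))
    hmp.measurable.aemeasurable (f := fun x => (∏ i, partsWeight (u i) (n i.succ) (α i) (x i)) *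
      mixedPartial α f x) (by rw [hmp.map_eq]; exact hI.1)
  rw [hmp.map_eq] at hmap
  exact hmap.symm

/-- The pairs of a set `S` and orders of differentiation for `S` correspond to the multi-indices
`β` with `β_j ≤ n_j + 1`, where `S` is the set of `j` with `β_j ≤ n_j`. -/
lemma sum_orders {M : Type*} [AddCommMonoid M] {e : ℕ} (n : Fin (e + 1) → ℕ)
    (T : (Fin e → ℕ) → M) :
    ∑ S : Finset (Fin e), ∑ α ∈ orders n S, T α =
      ∑ β ∈ Fintype.piFinset (fun i : Fin e => Finset.range (n i.succ + 2)), T β := by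
  rw [← Finset.sum_fiberwise _ fun β : Fin e → ℕ => Finset.univ.filter fun i => β i ≤ n i.succ]
  refine Finset.sum_congr rfl fun S _ => Finset.sum_congr ?_ fun _ _ => rfl
  ext β
  rw [mem_orders, Finset.mem_filter, Fintype.mem_piFinset, Finset.ext_iff]
  simp only [Finset.mem_range, Finset.mem_filter, Finset.mem_univ, true_and]
  constructor
  · intro h
    refine ⟨fun i => ?_, fun i => ?_⟩
    · by_cases hi : i ∈ S
      · have := (h i).1 hi; omega
      · have := (h i).2 hi; omega
    · by_cases hi : i ∈ S
      · simp [hi, (h i).1 hi]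
      · simp [hi, (h i).2 hi]
  · rintro ⟨h1, h2⟩ i
    refine ⟨fun hi => (h2 i).2 hi, fun hi => ?_⟩
    have h3 : ¬ β i ≤ n i.succ := fun h => hi ((h2 i).1 h)
    have := h1 i
    omega

lemma prod_partsCoeff_eq {e : ℕ} {n : Fin (e + 1) → ℕ} {S : Finset (Fin e)} {α : Fin e → ℕ}
    (h : α ∈ orders n S) (u : Fin e → ℂ) :
    (∏ i ∈ S, (-1 : ℂ) ^ α i * ((ascPochhammer ℂ (α i + 1)).eval (u i + 1))⁻¹ *
        (1 / 2 : ℂ) ^ (u i + (α i : ℂ) + 1)) *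
      (∏ i ∈ Sᶜ, (-1 : ℂ) ^ (n i.succ + 1) *
        ((ascPochhammer ℂ (n i.succ + 1)).eval (u i + 1))⁻¹) =
      ∏ i, partsCoeff (u i) (n i.succ) (α i) := by
  rw [← Finset.prod_mul_prod_compl S]
  congr 1
  · refine Finset.prod_congr rfl fun i hi => ?_
    rw [partsCoeff, if_pos ((le_iff_of_mem_orders h i).2 hi)]
  · refine Finset.prod_congr rfl fun i hi => ?_
    rw [partsCoeff, if_neg fun h' => (Finset.mem_compl.1 hi) ((le_iff_of_mem_orders h i).1 h')]

/-- The multi-indices of the iterated integration by parts. -/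
def partsIndex {e : ℕ} (n : Fin (e + 1) → ℕ) : Finset (Fin e → ℕ) :=
  Fintype.piFinset fun i : Fin e => Finset.range (n i.succ + 2)

lemma bigF_eq {e : ℕ} {n : Fin (e + 1) → ℕ} {s : Fin (e + 1) → ℂ}
    {f : (Fin e → Fin 2) → ℝ → (Fin e → ℝ) → ℂ} {x₁ : ℝ}
    (hu : ∀ a i, -1 < (uExp s a i + n i.succ + 1).re)
    (hf : ∀ a α, ContinuousOn (mixedPartial α (f a x₁)) (halfCube (Fin e))) :
    bigF n s f x₁ = ∑ a : Fin e → Fin 2, ∑ β ∈ partsIndex n,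
      (∏ i, partsCoeff (uExp s a i) (n i.succ) (β i)) *
        partsIntegral (fun i => n i.succ) (uExp s a) β (mixedPartial β (f a x₁)) := by
  rw [bigF]
  refine Finset.sum_congr rfl fun a _ => ?_
  rw [partsIndex, ← sum_orders]
  refine Finset.sum_congr rfl fun S _ => Finset.sum_congr rfl fun α hα => ?_
  rw [prod_partsCoeff_eq hα, (integral_innerIntegrand hα (hu a) (hf a α)).2]

/-- In the region `Re u_j > -1`, the function `F` is a sum of integrals over cubes. -/
lemma bigF_eq_sum_integral {e : ℕ} {n : Fin (e + 1) → ℕ} {s : Fin (e + 1) → ℂ}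
    {f : (Fin e → Fin 2) → ℝ → (Fin e → ℝ) → ℂ} {x₁ : ℝ}
    (hu : ∀ a i, -1 < (uExp s a i).re)
    (hf : ∀ a, ∀ x ∈ halfCube (Fin e), ContDiffAt ℝ (⊤ : ℕ∞) (f a x₁) x) :
    bigF n s f x₁ = ∑ a : Fin e → Fin 2,
      ∫ x, (∏ i, (x i : ℂ) ^ uExp s a i) * f a x₁ x ∂(Measure.pi fun _ : Fin e => halfSegment) := by
  rw [bigF_eq (fun a i => ?_)
    fun a α x hx => (contDiffAt_mixedPartial α (hf a x hx)).continuousAt.continuousWithinAt]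
  · refine Finset.sum_congr rfl fun a _ => ?_
    rw [integral_halfCube_eq_sum (hf a) (hu a) fun i => n i.succ]
    rfl
  · rw [Complex.add_re, Complex.add_re, Complex.natCast_re, Complex.one_re]
    linarith [hu a i, Nat.cast_nonneg (α := ℝ) (n i.succ)]

/-! ### Decomposition of the unit cube into `2^(d-1)` cubes of side `1/2` -/

lemma unitSegment_eq :
    unitSegment = halfSegment + Measure.map (fun x : ℝ => 1 - x) halfSegment := by
  have h1 : Measure.map (fun x : ℝ => 1 - x) halfSegment = volume.restrict (Icc (1 / 2) 1) := by
    have h := ((volume : Measure ℝ).measurePreserving_sub_left 1).restrict_preimage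
      (s := Icc (1 / 2) 1) measurableSet_Icc
    have hpre : (fun x : ℝ => 1 - x) ⁻¹' Icc (1 / 2) 1 = Icc 0 (1 / 2) := by
      ext x
      simp only [mem_preimage, mem_Icc]
      constructor <;> rintro ⟨h1, h2⟩ <;> constructor <;> linarith
    rw [hpre] at h
    exact h.map_eq
  have h2 : Ioc (0 : ℝ) 1 = Ioc 0 (1 / 2) ∪ Ioc (1 / 2) 1 :=
    (Ioc_union_Ioc_eq_Ioc (by norm_num) (by norm_num)).symm
  rw [h1, unitSegment, Measure.restrict_congr_set Ioo_ae_eq_Ioc, h2,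
    Measure.restrict_union (Ioc_disjoint_Ioc_of_le le_rfl) measurableSet_Ioc,
    Measure.restrict_congr_set Ioc_ae_eq_Icc, Measure.restrict_congr_set Ioc_ae_eq_Icc]

/-- One coordinate of `tVar`. -/
noncomputable def tCoord (j : Fin 2) (x : ℝ) : ℝ := if j = 0 then x else 1 - x

lemma measurable_tCoord (j : Fin 2) : Measurable (tCoord j) := by
  unfold tCoord
  split_ifs <;> fun_prop

lemma measurable_tVar {e : ℕ} (a : Fin e → Fin 2) : Measurable fun x => tVar a x :=
  measurable_pi_iff.2 fun i => (measurable_tCoord (a i)).comp (measurable_pi_apply i)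

lemma unitCube_eq_sum (e : ℕ) : unitCube e = ∑ a : Fin e → Fin 2,
    Measure.map (fun x => tVar a x) (Measure.pi fun _ : Fin e => halfSegment) := by
  refine Measure.pi_eq fun s hs => ?_
  have h1 : ∀ a : Fin e → Fin 2, Measure.map (fun x => tVar a x)
      (Measure.pi fun _ : Fin e => halfSegment) =
      Measure.pi fun i => Measure.map (tCoord (a i)) halfSegment := fun a =>
    Measure.pi_map_pi fun i => (measurable_tCoord (a i)).aemeasurable
  have h2 : ∀ i, unitSegment (s i) = ∑ j : Fin 2, Measure.map (tCoord j) halfSegment (s i) :=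
    fun i => by
      rw [unitSegment_eq, Measure.add_apply, Fin.sum_univ_two]
      have e0 : tCoord 0 = id := by ext x; simp [tCoord]
      have e1 : tCoord 1 = fun x => 1 - x := by ext x; simp [tCoord]
      rw [e0, e1, Measure.map_id]
  simp_rw [h1, h2]
  rw [Measure.finsetSum_apply, Finset.prod_univ_sum]
  simp only [Measure.pi_pi, Fintype.piFinset_univ]

lemma integral_unitCube_eq_sum {e : ℕ} {g : (Fin e → ℝ) → ℂ} (hg : Integrable g (unitCube e)) :
    ∫ x, g x ∂unitCube e = ∑ a : Fin e → Fin 2,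
      ∫ x, g (tVar a x) ∂(Measure.pi fun _ : Fin e => halfSegment) := by
  rw [unitCube_eq_sum] at hg ⊢
  have h := integrable_finsetSum_measure.1 hg
  rw [integral_finsetSum_measure h]
  exact Finset.sum_congr rfl fun a ha =>
    integral_map (measurable_tVar a).aemeasurable (h a ha).1

/-! ### Holomorphic extensions of functions on the cube -/

/-- The space of the variables `s ∈ ℂ^d`, `x₁ ∈ ℂ` and `(x₂, …, x_d) ∈ ℂ^(d-1)`. -/
abbrev ParamSpace (e : ℕ) : Type := (Fin (e + 1) → ℂ) × ℂ × (Fin e → ℂ)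

/-- The point of `ParamSpace` with the real coordinates `x₁` and `x`. -/
def realPoint {e : ℕ} (s : Fin (e + 1) → ℂ) (x₁ : ℝ) (x : Fin e → ℝ) : ParamSpace e :=
  (s, (x₁ : ℂ), fun i => (x i : ℂ))

/-- The unit vector in the direction of the `i`-th space variable. -/
def spaceDir {e : ℕ} (i : Fin e) : ParamSpace e := (0, 0, Pi.single i 1)

/-- The complex partial derivative in the `i`-th space variable. -/
noncomputable def dirDeriv {e : ℕ} (i : Fin e) (F : ParamSpace e → ℂ) : ParamSpace e → ℂ :=
  fun p => fderiv ℂ F p (spaceDir i)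

/-- The mixed complex partial derivative in the space variables. -/
noncomputable def mixedDeriv {e : ℕ} (α : Fin e → ℕ) (F : ParamSpace e → ℂ) : ParamSpace e → ℂ :=
  (List.finRange e).foldr (fun i g => (dirDeriv i)^[α i] g) F

variable {e : ℕ} {F : ParamSpace e → ℂ} {W : Set (ParamSpace e)}

lemma analyticOnNhd_dirDeriv (hF : AnalyticOnNhd ℂ F W) (i : Fin e) :
    AnalyticOnNhd ℂ (dirDeriv i F) W := fun p hp =>
  ((ContinuousLinearMap.apply ℂ ℂ (spaceDir i : ParamSpace e)).analyticAt _).comp (hF.fderiv p hp)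

lemma analyticOnNhd_iterate_dirDeriv (hF : AnalyticOnNhd ℂ F W) (i : Fin e) (k : ℕ) :
    AnalyticOnNhd ℂ ((dirDeriv i)^[k] F) W := by
  induction k with
  | zero => simpa using hF
  | succ k ih =>
    rw [iterate_succ_apply']
    exact analyticOnNhd_dirDeriv ih i

lemma analyticOnNhd_foldr_dirDeriv (hF : AnalyticOnNhd ℂ F W) (l : List (Fin e)) (α : Fin e → ℕ) :
    AnalyticOnNhd ℂ (l.foldr (fun i g => (dirDeriv i)^[α i] g) F) W := by
  induction l with
  | nil => simpa using hF
  | cons i l ih => exact analyticOnNhd_iterate_dirDeriv ih i (α i)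

lemma analyticOnNhd_mixedDeriv (hF : AnalyticOnNhd ℂ F W) (α : Fin e → ℕ) :
    AnalyticOnNhd ℂ (mixedDeriv α F) W :=
  analyticOnNhd_foldr_dirDeriv hF _ α

lemma continuous_realPoint :
    Continuous fun q : (Fin (e + 1) → ℂ) × ℝ × (Fin e → ℝ) => realPoint q.1 q.2.1 q.2.2 := by
  unfold realPoint
  fun_prop

lemma contDiff_realPoint (s : Fin (e + 1) → ℂ) (x₁ : ℝ) :
    ContDiff ℝ (⊤ : ℕ∞) fun x : Fin e → ℝ => realPoint s x₁ x := by
  refine contDiff_const.prodMk (contDiff_const.prodMk (contDiff_pi.2 fun i => ?_))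
  exact Complex.ofRealCLM.contDiff.comp (contDiff_apply ℝ ℝ i)

lemma eventually_realPoint_mem (hW : IsOpen W) {s : Fin (e + 1) → ℂ} {x₁ : ℝ} {x : Fin e → ℝ}
    (hx : realPoint s x₁ x ∈ W) : ∀ᶠ y in 𝓝 x, realPoint s x₁ y ∈ W :=
  (contDiff_realPoint s x₁).continuous.continuousAt.eventually_mem (hW.mem_nhds hx)

/-- The real function `f` is the restriction of `F` to the real points of `W` with given `s` and
`x₁`. -/
def RestrictsTo (F : ParamSpace e → ℂ) (W : Set (ParamSpace e)) (s : Fin (e + 1) → ℂ) (x₁ : ℝ)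
    (f : (Fin e → ℝ) → ℂ) : Prop :=
  ∀ x, realPoint s x₁ x ∈ W → f x = F (realPoint s x₁ x)

lemma contDiffAt_of_restrictsTo (hW : IsOpen W) (hF : AnalyticOnNhd ℂ F W)
    {s : Fin (e + 1) → ℂ} {x₁ : ℝ} {f : (Fin e → ℝ) → ℂ} (hf : RestrictsTo F W s x₁ f)
    {x : Fin e → ℝ} (hx : realPoint s x₁ x ∈ W) : ContDiffAt ℝ (⊤ : ℕ∞) f x := by
  have h1 : ContDiffAt ℝ (⊤ : ℕ∞) F (realPoint s x₁ x) := (hF _ hx).contDiffAt.restrict_scalars ℝ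
  have h2 : ContDiffAt ℝ (⊤ : ℕ∞) (fun y => F (realPoint s x₁ y)) x :=
    h1.comp x (contDiff_realPoint s x₁).contDiffAt
  refine h2.congr_of_eventuallyEq ?_
  filter_upwards [eventually_realPoint_mem hW hx] with y hy using hf y hy

lemma restrictsTo_partialPow_one (hW : IsOpen W) (hF : AnalyticOnNhd ℂ F W)
    {s : Fin (e + 1) → ℂ} {x₁ : ℝ} {f : (Fin e → ℝ) → ℂ} (hf : RestrictsTo F W s x₁ f)
    (i : Fin e) : RestrictsTo (dirDeriv i F) W s x₁ (partialPow i 1 f) := by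
  intro x hx
  rw [partialPow, iteratedDeriv_one]
  have hupd : HasDerivAt (fun t : ℝ => realPoint s x₁ (update x i t)) (spaceDir i) (x i) := by
    refine (hasDerivAt_const (x i) s).prodMk ((hasDerivAt_const (x i) (x₁ : ℂ)).prodMk ?_)
    rw [hasDerivAt_pi]
    intro j
    rcases eq_or_ne j i with rfl | hj
    · simpa using! (hasDerivAt_id (x j)).ofReal_comp
    · simpa [hj] using hasDerivAt_const (x i) (x j : ℂ)
  have hself : realPoint s x₁ (update x i (x i)) = realPoint s x₁ x := by rw [update_eq_self]
  have hF' : HasFDerivAt F ((fderiv ℂ F (realPoint s x₁ x)).restrictScalars ℝ)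
      (realPoint s x₁ (update x i (x i))) := by
    rw [hself]
    exact (hF _ hx).differentiableAt.hasFDerivAt.restrictScalars ℝ
  have hcomp := hF'.comp_hasDerivAt (x i) hupd
  refine (hcomp.congr_of_eventuallyEq ?_).deriv
  have hev : ∀ᶠ t in 𝓝 (x i), realPoint s x₁ (update x i t) ∈ W :=
    hupd.continuousAt.eventually_mem (hW.mem_nhds (by rw [hself]; exact hx))
  filter_upwards [hev] with t ht using hf _ ht

lemma restrictsTo_partialPow (hW : IsOpen W) (hF : AnalyticOnNhd ℂ F W)
    {s : Fin (e + 1) → ℂ} {x₁ : ℝ} {f : (Fin e → ℝ) → ℂ} (hf : RestrictsTo F W s x₁ f)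
    (i : Fin e) (k : ℕ) : RestrictsTo ((dirDeriv i)^[k] F) W s x₁ (partialPow i k f) := by
  induction k with
  | zero => simpa [partialPow_zero] using hf
  | succ k ih =>
    rw [iterate_succ_apply', partialPow_succ]
    exact restrictsTo_partialPow_one hW (analyticOnNhd_iterate_dirDeriv hF i k) ih i

/-- The real mixed partial derivatives of a function with a holomorphic extension are the
restrictions of the complex ones. -/
lemma restrictsTo_mixedPartial (hW : IsOpen W) (hF : AnalyticOnNhd ℂ F W)
    {s : Fin (e + 1) → ℂ} {x₁ : ℝ} {f : (Fin e → ℝ) → ℂ} (hf : RestrictsTo F W s x₁ f)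
    (α : Fin e → ℕ) : RestrictsTo (mixedDeriv α F) W s x₁ (mixedPartial α f) := by
  unfold mixedDeriv mixedPartial
  induction List.finRange e with
  | nil => simpa using hf
  | cons i l ih =>
    exact restrictsTo_partialPow hW (analyticOnNhd_foldr_dirDeriv hF l α) ih i (α i)

/-! ### Cauchy estimates -/

lemma iteratedDeriv_line (hW : IsOpen W) (hF : AnalyticOnNhd ℂ F W) (i : Fin e) (k : ℕ)
    {p : ParamSpace e} {t : ℂ} (ht : p + t • spaceDir i ∈ W) :
    iteratedDeriv k (fun t : ℂ => F (p + t • spaceDir i)) t =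
      (dirDeriv i)^[k] F (p + t • spaceDir i) := by
  induction k generalizing t with
  | zero => simp
  | succ k ih =>
    have hline : ∀ t : ℂ, HasDerivAt (fun t : ℂ => p + t • spaceDir i) (spaceDir i) t := fun t => by
      simpa using ((hasDerivAt_id t).smul_const (spaceDir i)).const_add p
    rw [iteratedDeriv_succ, iterate_succ_apply']
    have hev : ∀ᶠ τ in 𝓝 t, p + τ • spaceDir i ∈ W :=
      (hline t).continuousAt.eventually_mem (hW.mem_nhds ht)
    have heq : iteratedDeriv k (fun t : ℂ => F (p + t • spaceDir i)) =ᶠ[𝓝 t]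
        fun τ => (dirDeriv i)^[k] F (p + τ • spaceDir i) := by
      filter_upwards [hev] with τ hτ using ih hτ
    rw [heq.deriv_eq]
    have hd := (analyticOnNhd_iterate_dirDeriv hF i k _ ht).differentiableAt.hasFDerivAt
    exact (hd.comp_hasDerivAt t (hline t)).deriv

/-- Cauchy's estimate in a single variable. -/
lemma norm_iterate_dirDeriv_le (hW : IsOpen W) (hF : AnalyticOnNhd ℂ F W) (i : Fin e) (k : ℕ)
    {p : ParamSpace e} {ρ M : ℝ} (hρ : 0 < ρ)
    (h : ∀ t : ℂ, ‖t‖ ≤ ρ → p + t • spaceDir i ∈ W ∧ ‖F (p + t • spaceDir i)‖ ≤ M) :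
    ‖(dirDeriv i)^[k] F p‖ ≤ k.factorial * M / ρ ^ k := by
  have h0 : p + (0 : ℂ) • spaceDir i ∈ W := (h 0 (by simpa using hρ.le)).1
  have := iteratedDeriv_line hW hF i k h0
  rw [zero_smul, add_zero] at this
  rw [← this]
  refine Complex.norm_iteratedDeriv_le_of_forall_mem_sphere_norm_le k hρ ?_ fun t ht => ?_
  · refine DifferentiableOn.diffContOnCl fun t ht => ?_
    rw [closure_ball _ hρ.ne', mem_closedBall_zero_iff] at ht
    have hd := (hF _ (h t ht).1).differentiableAt
    refine (hd.comp t (f := fun t : ℂ => p + t • spaceDir i) ?_).differentiableWithinAt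
    fun_prop
  · exact (h t (mem_sphere_zero_iff_norm.1 ht).le).2

/-- Cauchy's estimate for mixed partial derivatives, with a crude constant. -/
lemma exists_norm_mixedDeriv_le (hW : IsOpen W) (hF : AnalyticOnNhd ℂ F W) (α : Fin e → ℕ) :
    ∃ C : ℝ, ∃ N : ℕ, 0 ≤ C ∧ ∀ (s : Fin (e + 1) → ℂ) (c : ℂ) (z₀ : Fin e → ℂ) (R M : ℝ), 0 < R →
      (∀ z, ‖z - z₀‖ ≤ R → (s, c, z) ∈ W ∧ ‖F (s, c, z)‖ ≤ M) →
      ‖mixedDeriv α F (s, c, z₀)‖ ≤ C * M / R ^ N := by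
  have key : ∀ l : List (Fin e), ∃ C : ℝ, ∃ N : ℕ, 0 ≤ C ∧
      ∀ (s : Fin (e + 1) → ℂ) (c : ℂ) (z₀ : Fin e → ℂ) (R M : ℝ), 0 < R →
      (∀ z, ‖z - z₀‖ ≤ R → (s, c, z) ∈ W ∧ ‖F (s, c, z)‖ ≤ M) →
      ∀ z, ‖z - z₀‖ ≤ R / 2 ^ l.length →
        ‖l.foldr (fun i g => (dirDeriv i)^[α i] g) F (s, c, z)‖ ≤ C * M / R ^ N := by
    intro l
    induction l with
    | nil =>
      exact ⟨1, 0, zero_le_one, fun s c z₀ R M _ h z hz => by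
        simpa using (h z (by simpa using hz)).2⟩
    | cons i l ih =>
      obtain ⟨C, N, hC, ih⟩ := ih
      refine ⟨(α i).factorial * C * (2 ^ (l.length + 1)) ^ α i, N + α i, by positivity, ?_⟩
      intro s c z₀ R M hR h z hz
      have hlen : (i :: l).length = l.length + 1 := rfl
      rw [hlen] at hz
      have hρ : 0 < R / 2 ^ (l.length + 1) := by positivity
      have hle : R / 2 ^ (l.length + 1) + R / 2 ^ (l.length + 1) = R / 2 ^ l.length := by
        rw [pow_succ]; field_simp; norm_num
      have hstep := norm_iterate_dirDeriv_le hW (analyticOnNhd_foldr_dirDeriv hF l α) i (α i)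
        (p := (s, c, z)) hρ (M := C * M / R ^ N) fun t ht => by
          have hp : ((s, c, z) : ParamSpace e) + t • spaceDir i =
              (s, c, z + t • Pi.single i 1) := by
            simp [spaceDir]
          have hn : ‖t • (Pi.single i 1 : Fin e → ℂ)‖ ≤ R / 2 ^ (l.length + 1) := by
            rw [norm_smul, Pi.norm_single, norm_one, mul_one]
            exact ht
          have hz' : ‖z + t • Pi.single i 1 - z₀‖ ≤ R / 2 ^ l.length := by
            rw [add_sub_right_comm, ← hle]
            exact (norm_add_le _ _).trans (add_le_add hz hn)
          rw [hp]
          refine ⟨(h _ (hz'.trans (div_le_self hR.le (one_le_pow₀ (by norm_num))))).1, ?_⟩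
          exact ih s c z₀ R M hR h _ hz'
      refine hstep.trans_eq ?_
      rw [div_pow, pow_add]
      field_simp
      try ring
  obtain ⟨C, N, hC, h⟩ := key (List.finRange e)
  exact ⟨C, N, hC, fun s c z₀ R M hR hb => h s c z₀ R M hR hb z₀ (by simp; positivity)⟩

/-! ### Parametric integrals of integration-by-parts terms -/

lemma ae_partsMeasure_pos (n k : ℕ) : ∀ᵐ x ∂partsMeasure n k, x ∈ Ioc (0 : ℝ) (1 / 2) := by
  unfold partsMeasure
  split_ifs
  · exact (ae_dirac_iff (measurableSet_Ioc (a := (0 : ℝ)) (b := 1 / 2))).2 (by norm_num)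
  · rw [halfSegment, Measure.restrict_congr_set Ioc_ae_eq_Icc.symm]
    exact ae_restrict_mem measurableSet_Ioc

lemma ae_pi_partsMeasure {e : ℕ} (n β : Fin e → ℕ) :
    ∀ᵐ x ∂Measure.pi fun i => partsMeasure (n i) (β i), ∀ i, x i ∈ Ioc (0 : ℝ) (1 / 2) := by
  rw [ae_all_iff]
  exact fun i => (Measure.quasiMeasurePreserving_eval _ i).ae (ae_partsMeasure_pos (n i) (β i))

lemma norm_partsWeight_le {u u' : ℂ} (h : u'.re ≤ u.re) (n k : ℕ) {x : ℝ}
    (hx : x ∈ Ioc (0 : ℝ) (1 / 2)) : ‖partsWeight u n k x‖ ≤ ‖partsWeight u' n k x‖ := by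
  unfold partsWeight
  split_ifs
  · exact le_rfl
  · rw [Complex.norm_cpow_eq_rpow_re_of_pos hx.1, Complex.norm_cpow_eq_rpow_re_of_pos hx.1]
    refine Real.rpow_le_rpow_of_exponent_ge hx.1 (hx.2.trans (by norm_num)) ?_
    simpa using h

lemma differentiableAt_partsWeight {m : ℕ} {u : (Fin m → ℂ) → ℂ} {s : Fin m → ℂ}
    (hu : DifferentiableAt ℂ u s) (n k : ℕ) {x : ℝ} (hx : 0 < x) :
    DifferentiableAt ℂ (fun s => partsWeight (u s) n k x) s := by
  unfold partsWeight
  split_ifs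
  · exact differentiableAt_const _
  · exact ((hu.add_const _).add_const _).const_cpow (Or.inl (by exact_mod_cast hx.ne'))

/-- Holomorphy in `s` of the integral over `x₁ ∈ I` of the terms of the iterated integration by
parts in the variables `x₂, …, x_d`. -/
theorem analyticOnNhd_integral_partsIntegral {e : ℕ} {n β : Fin e → ℕ} {G : ParamSpace e → ℂ}
    {W : Set (ParamSpace e)} (hG : AnalyticOnNhd ℂ G W) {U : Set (Fin (e + 1) → ℂ)} (hU : IsOpen U)
    {I : Set ℝ} (hI : MeasurableSet I)
    (hmem : ∀ s ∈ U, ∀ c ∈ I, ∀ x ∈ halfCube (Fin e), realPoint s c x ∈ W)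
    {ρ : (Fin (e + 1) → ℂ) → ℝ → ℂ} (hρc : ∀ s ∈ U, ContinuousOn (ρ s) I)
    (hρd : ∀ c ∈ I, DifferentiableOn ℂ (fun s => ρ s c) U)
    {u : (Fin (e + 1) → ℂ) → Fin e → ℂ} (hud : ∀ i, Differentiable ℂ fun s => u s i)
    (hu : ∀ s ∈ U, ∀ i, -1 < (u s i + n i + 1).re)
    (hb : ∀ s₀ ∈ U, ∃ B : ℝ → ℝ, IntegrableOn B I ∧ ∃ V ∈ 𝓝 s₀, ∀ s ∈ V, ∀ c ∈ I,
      ∀ x ∈ halfCube (Fin e), ‖ρ s c * G (realPoint s c x)‖ ≤ B c) :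
    (∀ s ∈ U, IntegrableOn
      (fun c => ρ s c * partsIntegral n (u s) β fun x => G (realPoint s c x)) I) ∧
    AnalyticOnNhd ℂ (fun s => ∫ c in I, ρ s c *
      partsIntegral n (u s) β fun x => G (realPoint s c x)) U := by
  set ν := Measure.pi fun i => partsMeasure (n i) (β i) with hν
  set μ := (volume.restrict I).prod ν with hμ
  have hae2 := ae_pi_partsMeasure n β
  have haeμ : ∀ᵐ z ∂μ, z.1 ∈ I ∧ ∀ i, z.2 i ∈ Ioc (0 : ℝ) (1 / 2) :=
    (Measure.quasiMeasurePreserving_fst.ae (ae_restrict_mem hI)).and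
      (Measure.quasiMeasurePreserving_snd.ae hae2)
  have hcube : ∀ x : Fin e → ℝ, (∀ i, x i ∈ Ioc (0 : ℝ) (1 / 2)) → x ∈ halfCube (Fin e) :=
    fun x hx i _ => Ioc_subset_Icc_self (hx i)
  set Φ : (Fin (e + 1) → ℂ) → ℝ × (Fin e → ℝ) → ℂ := fun s z =>
    ρ s z.1 * ((∏ i, partsWeight (u s i) (n i) (β i) (z.2 i)) * G (realPoint s z.1 z.2)) with hΦ
  have hmeas : ∀ s ∈ U, AEStronglyMeasurable (Φ s) μ := by
    intro s hs
    have hρm : AEStronglyMeasurable (ρ s) (volume.restrict I) :=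
      (hρc s hs).aestronglyMeasurable hI
    have hwm : AEStronglyMeasurable (fun x : Fin e → ℝ =>
        ∏ i, partsWeight (u s i) (n i) (β i) (x i)) ν :=
      (Integrable.fintype_prod fun i => integrable_partsWeight (hu s hs i) (β i)).1
    have hrestr : μ.restrict (I ×ˢ halfCube (Fin e)) = μ :=
      Measure.restrict_eq_self_of_ae_mem (by
        filter_upwards [haeμ] with z hz using ⟨hz.1, hcube _ hz.2⟩)
    have hGm : AEStronglyMeasurable (fun z : ℝ × (Fin e → ℝ) => G (realPoint s z.1 z.2)) μ := by
      rw [← hrestr]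
      refine ContinuousOn.aestronglyMeasurable ?_ (hI.prod (measurableSet_halfCube _))
      have hc : Continuous fun z : ℝ × (Fin e → ℝ) => realPoint s z.1 z.2 :=
        continuous_realPoint.comp (continuous_const.prodMk continuous_id)
      exact hG.continuousOn.comp hc.continuousOn fun z hz => hmem s hs _ hz.1 _ hz.2
    exact hρm.comp_fst.mul (hwm.comp_snd.mul hGm)
  have hdiff : ∀ᵐ z ∂μ, DifferentiableOn ℂ (fun s => Φ s z) U := by
    filter_upwards [haeμ] with z hz s hs
    have h1 := hρd z.1 hz.1 s hs
    have h2 : DifferentiableAt ℂ (fun s => ∏ i, partsWeight (u s i) (n i) (β i) (z.2 i)) s :=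
      (HasFDerivAt.finsetProd fun i _ => (differentiableAt_partsWeight (hud i s) (n i) (β i)
        (hz.2 i).1).hasFDerivAt).differentiableAt
    have h3 : DifferentiableAt ℂ (fun s => G (realPoint s z.1 z.2)) s := by
      refine (hG _ (hmem s hs _ hz.1 _ (hcube _ hz.2))).differentiableAt.comp s
        (f := fun s => realPoint s z.1 z.2) ?_
      unfold realPoint
      fun_prop
    exact h1.mul (h2.mul h3).differentiableWithinAt
  have hbound : ∀ s₀ ∈ U, ∃ b : ℝ × (Fin e → ℝ) → ℝ, Integrable b μ ∧ ∃ V ∈ 𝓝 s₀,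
      ∀ᵐ z ∂μ, ∀ s ∈ V, ‖Φ s z‖ ≤ b z := by
    intro s₀ hs₀
    obtain ⟨B, hB, V, hV, hBV⟩ := hb s₀ hs₀
    -- an exponent halfway between the critical one and that of `s₀`
    set σ : Fin e → ℂ := fun i => (((u s₀ i).re - (n i + 2)) / 2 : ℝ) with hσ
    have hσ1 : ∀ i, -1 < (σ i + n i + 1).re := fun i => by
      have := hu s₀ hs₀ i
      simp only [hσ, Complex.add_re, Complex.ofReal_re, Complex.natCast_re,
        Complex.one_re] at this ⊢
      linarith
    have hσ2 : ∀ i, (σ i).re < (u s₀ i).re := fun i => by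
      have := hu s₀ hs₀ i
      simp only [hσ, Complex.add_re, Complex.ofReal_re, Complex.natCast_re,
        Complex.one_re] at this ⊢
      linarith
    refine ⟨fun z => B z.1 * ∏ i, ‖partsWeight (σ i) (n i) (β i) (z.2 i)‖, ?_,
      V ∩ {s | ∀ i, (σ i).re < (u s i).re}, inter_mem hV ?_, ?_⟩
    · exact Integrable.mul_prod hB
        (Integrable.fintype_prod fun i => (integrable_partsWeight (hσ1 i) (β i)).norm)
    · have : ∀ i, ∀ᶠ s in 𝓝 s₀, (σ i).re < (u s i).re := fun i =>
        (Complex.continuous_re.comp (hud i).continuous).continuousAt.eventually_const_lt (hσ2 i)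
      exact eventually_all.2 this
    · filter_upwards [haeμ] with z hz s hs
      have h1 := hBV s hs.1 z.1 hz.1 z.2 (hcube _ hz.2)
      have h2 : ‖∏ i, partsWeight (u s i) (n i) (β i) (z.2 i)‖ ≤
          ∏ i, ‖partsWeight (σ i) (n i) (β i) (z.2 i)‖ := by
        rw [norm_prod]
        exact Finset.prod_le_prod (fun i _ => norm_nonneg _) fun i _ =>
          norm_partsWeight_le (hs.2 i).le _ _ (hz.2 i)
      have h3 : Φ s z = (ρ s z.1 * G (realPoint s z.1 z.2)) *
          ∏ i, partsWeight (u s i) (n i) (β i) (z.2 i) := by simp only [hΦ]; ring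
      rw [h3, norm_mul]
      exact mul_le_mul h1 h2 (norm_nonneg _) ((norm_nonneg _).trans h1)
  have hint : ∀ s ∈ U, Integrable (Φ s) μ := by
    intro s hs
    obtain ⟨b, hb, V, hV, hbV⟩ := hbound s hs
    refine hb.mono' (hmeas s hs) ?_
    filter_upwards [hbV] with z hz using hz s (mem_of_mem_nhds hV)
  have hinner : ∀ s c, ∫ x, Φ s (c, x) ∂ν =
      ρ s c * partsIntegral n (u s) β fun x => G (realPoint s c x) := fun s c => by
    rw [partsIntegral, ← integral_const_mul]
  refine ⟨fun s hs => ?_, ?_⟩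
  · have := (hint s hs).integral_prod_left
    simp only [hinner] at this
    exact this
  · refine (analyticOnNhd_integral hU hmeas hdiff hbound).congr hU fun s hs => ?_
    have := integral_prod _ (hint s hs)
    simp only [hinner] at this
    exact this

/-! ### Holomorphy of integrals of the function `F` -/

lemma analyticAt_tailSum {e : ℕ} (i : Fin (e + 1)) (s : Fin (e + 1) → ℂ) :
    AnalyticAt ℂ (fun s : Fin (e + 1) → ℂ => tailSum s i) s :=
  Finset.analyticAt_fun_sum _ fun l _ =>
    (ContinuousLinearMap.proj (R := ℂ) (φ := fun _ : Fin (e + 1) => ℂ) l).analyticAt s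

lemma analyticAt_coord {m : ℕ} (i : Fin m) (s : Fin m → ℂ) :
    AnalyticAt ℂ (fun s : Fin m → ℂ => s i) s :=
  (ContinuousLinearMap.proj (R := ℂ) (φ := fun _ : Fin m => ℂ) i).analyticAt s

lemma analyticAt_uExp {e : ℕ} (a : Fin e → Fin 2) (i : Fin e) (s : Fin (e + 1) → ℂ) :
    AnalyticAt ℂ (fun s => uExp s a i) s := by
  unfold uExp
  split_ifs
  · exact (((analyticAt_tailSum _ s).sub analyticAt_const).add analyticAt_const).sub
      analyticAt_const
  · exact (analyticAt_coord _ s).sub analyticAt_const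

lemma analyticAt_vExp {e : ℕ} (a : Fin e → Fin 2) (i : Fin e) (s : Fin (e + 1) → ℂ) :
    AnalyticAt ℂ (fun s => vExp s a i) s := by
  unfold vExp
  split_ifs
  · exact (analyticAt_coord _ s).sub analyticAt_const
  · exact (((analyticAt_tailSum _ s).sub analyticAt_const).add analyticAt_const).sub
      analyticAt_const

lemma isOpen_region {e : ℕ} (n : Fin (e + 1) → ℕ) : IsOpen (region n) := by
  have h1 : IsOpen {s : Fin (e + 1) → ℂ | ∀ i : Fin (e + 1),
      ((e : ℝ) + 1) - ((i : ℝ) + 1) - (n i : ℝ) < (tailSum s i).re} := by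
    simp only [Set.ofPred_forall]
    exact isOpen_iInter_of_finite fun i =>
      isOpen_lt continuous_const (Complex.continuous_re.comp (continuous_tailSum i))
  have h2 : IsOpen {s : Fin (e + 1) → ℂ | ∀ i : Fin e,
      -(n i.succ : ℝ) - 1 < (s i.castSucc).re} := by
    simp only [Set.ofPred_forall]
    exact isOpen_iInter_of_finite fun i =>
      isOpen_lt continuous_const (Complex.continuous_re.comp (continuous_apply _))
  exact h1.inter h2

lemma uExp_re_of_mem_region {e : ℕ} {n : Fin (e + 1) → ℕ} {s : Fin (e + 1) → ℂ}
    (hs : s ∈ region n) (a : Fin e → Fin 2) (i : Fin e) :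
    -1 < (uExp s a i + n i.succ + 1).re := by
  have h1 := hs.1 i.succ
  have h2 := hs.2 i
  unfold uExp
  split_ifs
  · simp only [Complex.add_re, Complex.sub_re, Complex.natCast_re, Complex.one_re,
      Complex.re_ofNat, Fin.val_succ] at h1 ⊢
    push_cast at h1
    linarith
  · simp only [Complex.add_re, Complex.sub_re, Complex.natCast_re, Complex.one_re]
    linarith

/-- Integrals of the function `F` over `x₁`, for functions which extend holomorphically in all
variables: existence, and the expression through functions that are holomorphic on the region. -/
theorem exists_integral_bigF_eq {e : ℕ} {n : Fin (e + 1) → ℕ}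
    {F : (Fin e → Fin 2) → ParamSpace e → ℂ} {W : (Fin e → Fin 2) → Set (ParamSpace e)}
    (hW : ∀ a, IsOpen (W a)) (hF : ∀ a, AnalyticOnNhd ℂ (F a) (W a))
    {I : Set ℝ} (hI : MeasurableSet I)
    {f : (Fin (e + 1) → ℂ) → (Fin e → Fin 2) → ℝ → (Fin e → ℝ) → ℂ}
    (hf : ∀ s a, ∀ c, RestrictsTo (F a) (W a) s c (f s a c))
    (hmem : ∀ s a, ∀ c ∈ I, ∀ x ∈ halfCube (Fin e), realPoint s c x ∈ W a)
    {ρ : (Fin (e + 1) → ℂ) → ℝ → ℂ} (hρc : ∀ s, ContinuousOn (ρ s) I)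
    (hρd : ∀ c ∈ I, Differentiable ℂ fun s => ρ s c)
    (hb : ∀ a β, ∀ s₀ ∈ region n, ∃ B : ℝ → ℝ, IntegrableOn B I ∧ ∃ V ∈ 𝓝 s₀, ∀ s ∈ V, ∀ c ∈ I,
      ∀ x ∈ halfCube (Fin e), ‖ρ s c * mixedDeriv β (F a) (realPoint s c x)‖ ≤ B c) :
    (∀ s ∈ region n, IntegrableOn (fun c => ρ s c * bigF n s (f s) c) I) ∧
    ∃ J : (Fin e → Fin 2) → (Fin e → ℕ) → (Fin (e + 1) → ℂ) → ℂ,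
      (∀ a β, AnalyticOnNhd ℂ (J a β) (region n)) ∧
      ∀ s ∈ region n, ∫ c in I, ρ s c * bigF n s (f s) c =
        ∑ a : Fin e → Fin 2, ∑ β ∈ partsIndex n,
          (∏ i, partsCoeff (uExp s a i) (n i.succ) (β i)) * J a β s := by
  have key := fun a β => analyticOnNhd_integral_partsIntegral (n := fun i => n i.succ) (β := β)
    (analyticOnNhd_mixedDeriv (hF a) β) (isOpen_region n) hI (fun s _ => hmem s a)
    (fun s _ => hρc s) (fun c hc => (hρd c hc).differentiableOn) (u := fun s => uExp s a)
    (fun i s => (analyticAt_uExp a i s).differentiableAt)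
    (fun s hs => uExp_re_of_mem_region hs a) (hb a β)
  have hmix : ∀ s a, ∀ c ∈ I, ∀ β, ∀ x ∈ halfCube (Fin e),
      mixedPartial β (f s a c) x = mixedDeriv β (F a) (realPoint s c x) := fun s a c hc β x hx =>
    restrictsTo_mixedPartial (hW a) (hF a) (hf s a c) β x (hmem s a c hc x hx)
  have hbig : ∀ s ∈ region n, ∀ c ∈ I, ρ s c * bigF n s (f s) c =
      ∑ a : Fin e → Fin 2, ∑ β ∈ partsIndex n,
        (∏ i, partsCoeff (uExp s a i) (n i.succ) (β i)) * (ρ s c *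
          partsIntegral (fun i => n i.succ) (uExp s a) β
            fun x => mixedDeriv β (F a) (realPoint s c x)) := by
    intro s hs c hc
    rw [bigF_eq (uExp_re_of_mem_region hs) fun a α x hx =>
      (contDiffAt_mixedPartial α (contDiffAt_of_restrictsTo (hW a) (hF a) (hf s a c)
        (hmem s a c hc x hx))).continuousAt.continuousWithinAt, Finset.mul_sum]
    refine Finset.sum_congr rfl fun a _ => ?_
    rw [Finset.mul_sum]
    refine Finset.sum_congr rfl fun β _ => ?_
    rw [mul_left_comm]
    congr 2
    refine integral_congr_ae ?_
    filter_upwards [ae_pi_mem_halfCube fun i => ae_partsMeasure (n i.succ) (β i)] with x hx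
    rw [hmix s a c hc β x hx]
  have hI2 : ∀ s ∈ region n, ∀ a, ∀ β, Integrable (fun c =>
      (∏ i, partsCoeff (uExp s a i) (n i.succ) (β i)) * (ρ s c *
        partsIntegral (fun i => n i.succ) (uExp s a) β
          fun x => mixedDeriv β (F a) (realPoint s c x))) (volume.restrict I) :=
    fun s hs a β => ((key a β).1 s hs).const_mul _
  refine ⟨fun s hs => ?_, fun a β s => ∫ c in I, ρ s c *
      partsIntegral (fun i => n i.succ) (uExp s a) β
        fun x => mixedDeriv β (F a) (realPoint s c x), fun a β => (key a β).2, fun s hs => ?_⟩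
  · refine IntegrableOn.congr_fun ?_ (fun c hc => (hbig s hs c hc).symm) hI
    exact integrable_finsetSum _ fun a _ => integrable_finsetSum _ fun β _ => hI2 s hs a β
  · rw [setIntegral_congr_fun hI fun c hc => hbig s hs c hc,
      integral_finsetSum _ fun a _ => integrable_finsetSum _ fun β _ => hI2 s hs a β]
    refine Finset.sum_congr rfl fun a _ => ?_
    rw [integral_finsetSum _ fun β _ => hI2 s hs a β]
    exact Finset.sum_congr rfl fun β _ => integral_const_mul _ _

/-! ### The functions `φ_a` -/

/-- The complex version of `tVar`. -/
def tVarC {e : ℕ} (a : Fin e → Fin 2) (z : Fin e → ℂ) (i : Fin e) : ℂ :=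
  if a i = 0 then z i else 1 - z i

lemma tVarC_ofReal {e : ℕ} (a : Fin e → Fin 2) (x : Fin e → ℝ) (i : Fin e) :
    tVarC a (fun i => (x i : ℂ)) i = (tVar a x i : ℂ) := by
  unfold tVarC tVar
  split_ifs <;> simp

lemma analyticAt_space {e : ℕ} (i : Fin e) (p : ParamSpace e) :
    AnalyticAt ℂ (fun p : ParamSpace e => p.2.2 i) p :=
  ((ContinuousLinearMap.proj (R := ℂ) (φ := fun _ : Fin e => ℂ) i).comp
    ((ContinuousLinearMap.snd ℂ ℂ (Fin e → ℂ)).comp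
      (ContinuousLinearMap.snd ℂ (Fin (e + 1) → ℂ) (ℂ × (Fin e → ℂ))))).analyticAt p

lemma analyticAt_tVarC {e : ℕ} (a : Fin e → Fin 2) (i : Fin e) (p : ParamSpace e) :
    AnalyticAt ℂ (fun p : ParamSpace e => tVarC a p.2.2 i) p := by
  have h := analyticAt_space i p
  unfold tVarC
  split_ifs
  · exact h
  · exact analyticAt_const.sub h

lemma analyticAt_one_sub_cpow {e : ℕ} (a : Fin e → Fin 2) (i : Fin e) {p : ParamSpace e}
    (hp : 1 - p.2.2 i ∈ Complex.slitPlane) :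
    AnalyticAt ℂ (fun p : ParamSpace e => (1 - p.2.2 i) ^ vExp p.1 a i) p := by
  have h := analyticAt_space i p
  exact (analyticAt_const.sub h).cpow ((analyticAt_vExp a i p.1).comp analyticAt_fst) hp

lemma mem_Icc_of_halfCube {e : ℕ} {x : Fin e → ℝ} (hx : x ∈ halfCube (Fin e)) (i : Fin e) :
    x i ∈ Icc (0 : ℝ) (1 / 2) := hx i (mem_univ i)

lemma tVar_mem_Icc {e : ℕ} {x : Fin e → ℝ} (hx : x ∈ halfCube (Fin e)) (a : Fin e → Fin 2)
    (i : Fin e) : tVar a x i ∈ Icc (0 : ℝ) 1 := by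
  obtain ⟨h0, h1⟩ := mem_Icc_of_halfCube hx i
  unfold tVar
  split_ifs <;> constructor <;> linarith

lemma one_sub_mem_slitPlane {e : ℕ} {x : Fin e → ℝ} (hx : x ∈ halfCube (Fin e)) (i : Fin e) :
    1 - (x i : ℂ) ∈ Complex.slitPlane := by
  refine Or.inl ?_
  have := (mem_Icc_of_halfCube hx i).2
  simp only [Complex.sub_re, Complex.one_re, Complex.ofReal_re]
  linarith

/-- The domain of the holomorphic extension of `φ_a`. -/
def phiDomain {e : ℕ} (a : Fin e → Fin 2) : Set (ParamSpace e) :=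
  {p | ‖p.2.1‖ < toddRadius e ∧ ∀ i, ‖tVarC a p.2.2 i‖ < toddRadius e ∧
    1 - p.2.2 i ∈ Complex.slitPlane}

/-- The holomorphic extension of `φ_a`. -/
noncomputable def phiC {e : ℕ} (n : Fin (e + 1) → ℕ) (a : Fin e → Fin 2) (p : ParamSpace e) : ℂ :=
  (∏ i, (1 - p.2.2 i) ^ vExp p.1 a i) * toddRem (n 0 + 1) p.2.1 (tVarC a p.2.2)

lemma isOpen_phiDomain {e : ℕ} (a : Fin e → Fin 2) : IsOpen (phiDomain a) := by
  have h : phiDomain a = {p : ParamSpace e | ‖p.2.1‖ < toddRadius e} ∩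
      ⋂ i, ({p : ParamSpace e | ‖tVarC a p.2.2 i‖ < toddRadius e} ∩
        (fun p : ParamSpace e => 1 - p.2.2 i) ⁻¹' Complex.slitPlane) := by
    ext p
    simp [phiDomain]
  rw [h]
  refine IsOpen.inter (isOpen_lt (continuous_fst.comp continuous_snd).norm continuous_const) ?_
  refine isOpen_iInter_of_finite fun i => IsOpen.inter (isOpen_lt ?_ continuous_const)
    (Complex.isOpen_slitPlane.preimage (by fun_prop))
  exact continuous_norm.comp (continuous_iff_continuousAt.2 fun p =>
    (analyticAt_tVarC a i p).continuousAt)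

lemma analyticOnNhd_phiC {e : ℕ} (n : Fin (e + 1) → ℕ) (a : Fin e → Fin 2) :
    AnalyticOnNhd ℂ (phiC n a) (phiDomain a) := by
  intro p hp
  refine (Finset.analyticAt_fun_prod _ fun i _ => analyticAt_one_sub_cpow a i (hp.2 i).2).mul ?_
  have hq : AnalyticAt ℂ (fun p : ParamSpace e =>
      (Fin.cons p.2.1 (tVarC a p.2.2) : Fin (e + 1) → ℂ)) p := by
    rw [analyticAt_pi_iff]
    intro i
    refine Fin.cases ?_ (fun j => ?_) i
    · exact analyticAt_fst.comp analyticAt_snd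
    · exact analyticAt_tVarC a j p
  have hmem : (Fin.cons p.2.1 (tVarC a p.2.2) : Fin (e + 1) → ℂ) ∈ ball 0 (toddRadius e) := by
    rw [mem_ball_zero_iff, pi_norm_lt_iff (zero_lt_one.trans (one_lt_toddRadius e))]
    intro i
    refine Fin.cases ?_ (fun j => ?_) i
    · exact hp.1
    · exact (hp.2 j).1
  exact (analyticOnNhd_toddRem e (n 0 + 1) _ hmem).comp_of_eq hq rfl

lemma realPoint_mem_phiDomain {e : ℕ} (s : Fin (e + 1) → ℂ) (a : Fin e → Fin 2) {c : ℝ}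
    (hc : c ∈ Icc (0 : ℝ) 1) {x : Fin e → ℝ} (hx : x ∈ halfCube (Fin e)) :
    realPoint s c x ∈ phiDomain a := by
  have h1 : ∀ {y : ℝ}, y ∈ Icc (0 : ℝ) 1 → ‖(y : ℂ)‖ < toddRadius e := fun {y} hy => by
    rw [Complex.norm_real, Real.norm_of_nonneg hy.1]
    exact hy.2.trans_lt (one_lt_toddRadius e)
  refine ⟨h1 hc, fun i => ⟨?_, one_sub_mem_slitPlane hx i⟩⟩
  rw [realPoint, tVarC_ofReal]
  exact h1 (tVar_mem_Icc hx a i)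

lemma restrictsTo_phi {e : ℕ} (n : Fin (e + 1) → ℕ) (s : Fin (e + 1) → ℂ) (a : Fin e → Fin 2)
    (c : ℝ) : RestrictsTo (phiC n a) (phiDomain a) s c (phi n s a c) := by
  intro x _
  rw [phi, phiC, toddRem]
  have h : tVarC a (realPoint s c x).2.2 = fun i => (tVar a x i : ℂ) := funext fun i =>
    tVarC_ofReal a x i
  rw [h]
  simp only [phiTerm_eq, realPoint, Complex.ofReal_sub, Complex.ofReal_one]

lemma summable_phiTerm {e : ℕ} (n : Fin (e + 1) → ℕ) (a : Fin e → Fin 2) {c : ℝ}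
    (hc : c ∈ Icc (0 : ℝ) 1) {x : Fin e → ℝ} (hx : x ∈ halfCube (Fin e)) :
    Summable (phiTerm n a c x) := by
  have hp := realPoint_mem_phiDomain 0 a hc hx
  simp only [funext fun k => phiTerm_eq n a c x k]
  refine summable_toddRem (n 0 + 1) hp.1.le fun i => ?_
  rw [← tVarC_ofReal]
  exact (hp.2 i).1.le

/-- The exponent of `x₁` in the integral over `[0, 1]` has real part `> -1`. -/
lemma phi_exponent_re {e : ℕ} {n : Fin (e + 1) → ℕ} {s : Fin (e + 1) → ℂ} (hs : s ∈ region n) :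
    -1 < (tailSum s 0 - ((e : ℂ) + 1) + (n 0 : ℂ)).re := by
  have h1 := hs.1 0
  simp only [Complex.add_re, Complex.sub_re, Complex.natCast_re, Complex.one_re,
    Fin.val_zero, Nat.cast_zero] at h1 ⊢
  linarith

/-- On `[0, 1] × [0, 1/2]^(d-1)` the derivatives of `φ_a` are bounded by compactness, locally
uniformly in `s`. -/
lemma exists_phi_bound {e : ℕ} {n : Fin (e + 1) → ℕ} (a : Fin e → Fin 2) (β : Fin e → ℕ)
    {s₀ : Fin (e + 1) → ℂ} (hs₀ : s₀ ∈ region n) :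
    ∃ B : ℝ → ℝ, IntegrableOn B (Ioc 0 1) ∧ ∃ V ∈ 𝓝 s₀, ∀ s ∈ V, ∀ c ∈ Ioc (0 : ℝ) 1,
      ∀ x ∈ halfCube (Fin e), ‖(c : ℂ) ^ (tailSum s 0 - ((e : ℂ) + 1) + (n 0 : ℂ)) *
        mixedDeriv β (phiC n a) (realPoint s c x)‖ ≤ B c := by
  set τ : (Fin (e + 1) → ℂ) → ℂ := fun s => tailSum s 0 - ((e : ℂ) + 1) + (n 0 : ℂ) with hτ
  have hτ0 : -1 < (τ s₀).re := phi_exponent_re hs₀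
  have hcomp : IsCompact (closedBall s₀ 1 ×ˢ (Icc (0 : ℝ) 1 ×ˢ halfCube (Fin e))) :=
    (isCompact_closedBall s₀ 1).prod (isCompact_Icc.prod (isCompact_halfCube _))
  obtain ⟨C, hC⟩ := hcomp.exists_bound_of_continuousOn
    (f := fun q => mixedDeriv β (phiC n a) (realPoint q.1 q.2.1 q.2.2))
    ((analyticOnNhd_mixedDeriv (analyticOnNhd_phiC n a) β).continuousOn.comp
      continuous_realPoint.continuousOn fun q hq =>
        realPoint_mem_phiDomain q.1 a hq.2.1 hq.2.2)
  set σ : ℝ := ((τ s₀).re - 1) / 2 with hσ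
  have hcont : Continuous fun s => (τ s).re := by
    simp only [hτ]
    have := continuous_tailSum (e := e) 0
    fun_prop
  have hC0 : 0 ≤ C := (norm_nonneg _).trans (hC (s₀, 0, fun _ => 0)
    ⟨mem_closedBall_self zero_le_one, by norm_num, fun i _ => by norm_num⟩)
  refine ⟨fun c => c ^ σ * C, ?_, closedBall s₀ 1 ∩ {s | σ < (τ s).re},
    inter_mem (closedBall_mem_nhds _ one_pos)
      (hcont.continuousAt.eventually_const_lt (by rw [hσ]; linarith)), ?_⟩
  · have := (intervalIntegral.intervalIntegrable_rpow' (a := 0) (b := 1)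
      (show -1 < σ by rw [hσ]; linarith)).mul_const C
    exact (intervalIntegrable_iff_integrableOn_Ioc_of_le zero_le_one).1 this
  · intro s hs c hc x hx
    rw [norm_mul, Complex.norm_cpow_eq_rpow_re_of_pos hc.1]
    refine mul_le_mul (Real.rpow_le_rpow_of_exponent_ge hc.1 hc.2 hs.2.le)
      (hC (s, c, x) ⟨hs.1, Ioc_subset_Icc_self hc, hx⟩) (norm_nonneg _)
      (Real.rpow_nonneg hc.1.le _)

theorem exists_integral_phiIntegrand_eq {e : ℕ} (n : Fin (e + 1) → ℕ) :
    (∀ s ∈ region n, IntegrableOn (phiIntegrand n s) (Ioc 0 1)) ∧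
    ∃ J : (Fin e → Fin 2) → (Fin e → ℕ) → (Fin (e + 1) → ℂ) → ℂ,
      (∀ a β, AnalyticOnNhd ℂ (J a β) (region n)) ∧
      ∀ s ∈ region n, ∫ c in Ioc (0 : ℝ) 1, phiIntegrand n s c =
        ∑ a : Fin e → Fin 2, ∑ β ∈ partsIndex n,
          (∏ i, partsCoeff (uExp s a i) (n i.succ) (β i)) * J a β s := by
  refine exists_integral_bigF_eq isOpen_phiDomain (analyticOnNhd_phiC n) measurableSet_Ioc
    (f := fun s => phi n s) (fun s a c => restrictsTo_phi n s a c)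
    (fun s a c hc x hx => realPoint_mem_phiDomain s a (Ioc_subset_Icc_self hc) hx)
    (ρ := fun s c => (c : ℂ) ^ (tailSum s 0 - ((e : ℂ) + 1) + (n 0 : ℂ)))
    (fun s c hc => ?_) (fun c hc s => ?_) fun a β s₀ hs₀ => exists_phi_bound a β hs₀
  · exact (Complex.continuousAt_ofReal_cpow_const _ _ (Or.inr hc.1.ne')).continuousWithinAt
  · exact (((differentiable_tailSum 0 s).sub_const _).add_const _).const_cpow
      (Or.inl (by exact_mod_cast hc.1.ne'))

/-! ### The functions `ψ_a` -/

/-- The domain of the holomorphic extension of `ψ_a`. -/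
def psiDomain {e : ℕ} (a : Fin e → Fin 2) : Set (ParamSpace e) :=
  {p | ∀ i, 1 - p.2.2 i ∈ Complex.slitPlane ∧
    p.2.1 * ∏ l ∈ Finset.Iic i, tVarC a p.2.2 l ∈ toddDomain}

/-- The holomorphic extension of `ψ_a`. -/
noncomputable def psiC {e : ℕ} (a : Fin e → Fin 2) (p : ParamSpace e) : ℂ :=
  ∏ i, ((1 - p.2.2 i) ^ vExp p.1 a i * toddC (p.2.1 * ∏ l ∈ Finset.Iic i, tVarC a p.2.2 l))

lemma analyticAt_mul_prod_tVarC {e : ℕ} (a : Fin e → Fin 2) (i : Fin e) (p : ParamSpace e) :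
    AnalyticAt ℂ (fun p : ParamSpace e => p.2.1 * ∏ l ∈ Finset.Iic i, tVarC a p.2.2 l) p :=
  (((ContinuousLinearMap.fst ℂ ℂ (Fin e → ℂ)).comp
    (ContinuousLinearMap.snd ℂ (Fin (e + 1) → ℂ) (ℂ × (Fin e → ℂ)))).analyticAt p).mul
    (Finset.analyticAt_fun_prod _ fun l _ => analyticAt_tVarC a l p)

lemma isOpen_psiDomain {e : ℕ} (a : Fin e → Fin 2) : IsOpen (psiDomain a) := by
  have h : psiDomain a = ⋂ i, ((fun p : ParamSpace e => 1 - p.2.2 i) ⁻¹' Complex.slitPlane ∩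
      (fun p : ParamSpace e => p.2.1 * ∏ l ∈ Finset.Iic i, tVarC a p.2.2 l) ⁻¹' toddDomain) := by
    ext p
    simp [psiDomain]
  rw [h]
  refine isOpen_iInter_of_finite fun i =>
    (Complex.isOpen_slitPlane.preimage (by fun_prop)).inter (isOpen_toddDomain.preimage ?_)
  exact continuous_iff_continuousAt.2 fun p => (analyticAt_mul_prod_tVarC a i p).continuousAt

lemma analyticOnNhd_psiC {e : ℕ} (a : Fin e → Fin 2) :
    AnalyticOnNhd ℂ (psiC a) (psiDomain a) := fun p hp =>
  Finset.analyticAt_fun_prod _ fun i _ => (analyticAt_one_sub_cpow a i (hp i).1).mul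
    ((analyticAt_toddC (hp i).2).comp_of_eq (analyticAt_mul_prod_tVarC a i p) rfl)

lemma mul_prod_tVarC_realPoint {e : ℕ} (a : Fin e → Fin 2) (c : ℝ) (x : Fin e → ℝ) (i : Fin e) :
    (c : ℂ) * ∏ l ∈ Finset.Iic i, tVarC a (fun i => (x i : ℂ)) l =
      ((c * ∏ l ∈ Finset.Iic i, tVar a x l : ℝ) : ℂ) := by
  push_cast
  simp only [tVarC_ofReal]

lemma realPoint_mem_psiDomain {e : ℕ} (s : Fin (e + 1) → ℂ) (a : Fin e → Fin 2) (c : ℝ)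
    {x : Fin e → ℝ} (hx : x ∈ halfCube (Fin e)) : realPoint s c x ∈ psiDomain a := by
  refine fun i => ⟨one_sub_mem_slitPlane hx i, ?_⟩
  rw [realPoint, mul_prod_tVarC_realPoint]
  exact mem_toddDomain (by rw [Complex.ofReal_im, abs_zero]; positivity)

lemma restrictsTo_psi {e : ℕ} (s : Fin (e + 1) → ℂ) (a : Fin e → Fin 2) (c : ℝ) :
    RestrictsTo (psiC a) (psiDomain a) s c (psi s a c) := by
  intro x _
  rw [psi, psiC]
  refine Finset.prod_congr rfl fun i _ => ?_
  simp only [realPoint, mul_prod_tVarC_realPoint, toddC_ofReal, Complex.ofReal_sub,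
    Complex.ofReal_one]

/-- `y / (e^y - 1)` grows at most linearly near the positive half line. -/
lemma exists_norm_toddC_le : ∃ C : ℝ, 1 ≤ C ∧ ∀ w₀ : ℝ, 0 ≤ w₀ → ∀ w : ℂ, ‖w - w₀‖ ≤ 1 →
    w ∈ toddDomain ∧ ‖toddC w‖ ≤ C * (1 + w₀) := by
  have hdom : ∀ w : ℂ, |w.im| ≤ 1 → w ∈ toddDomain := fun w hw =>
    mem_toddDomain (hw.trans_lt (by linarith [Real.pi_gt_three]))
  have hcomp : IsCompact (closedBall (0 : ℂ) 3 ∩ {w | |w.im| ≤ 1}) :=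
    (isCompact_closedBall _ _).inter_right
      (isClosed_le (continuous_abs.comp Complex.continuous_im) continuous_const)
  obtain ⟨C, hC⟩ := hcomp.exists_bound_of_continuousOn (f := toddC)
    fun w hw => (analyticAt_toddC (hdom w hw.2)).continuousAt.continuousWithinAt
  refine ⟨max C 1, le_max_right _ _, fun w₀ hw₀ w hw => ?_⟩
  have him : |w.im| ≤ 1 := by
    have := (Complex.abs_im_le_norm (w - w₀)).trans hw
    simpa using this
  have hnorm : ‖w‖ ≤ 1 + w₀ := by
    calc ‖w‖ = ‖(w - w₀) + w₀‖ := by rw [sub_add_cancel]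
      _ ≤ ‖w - w₀‖ + ‖(w₀ : ℂ)‖ := norm_add_le _ _
      _ ≤ 1 + w₀ := by rw [Complex.norm_real, Real.norm_of_nonneg hw₀]; linarith
  refine ⟨hdom w him, ?_⟩
  rcases le_total w₀ 2 with h2 | h2
  · have h1 := hC w ⟨mem_closedBall_zero_iff.2 (by linarith), him⟩
    calc ‖toddC w‖ ≤ max C 1 * 1 := by rw [mul_one]; exact h1.trans (le_max_left _ _)
      _ ≤ max C 1 * (1 + w₀) := by gcongr; linarith
  · have hre : 1 ≤ w.re := by
      have := (Complex.abs_re_le_norm (w - w₀)).trans hw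
      rw [Complex.sub_re, Complex.ofReal_re, abs_le] at this
      linarith [this.1]
    have hexp : 1 ≤ ‖Complex.exp w - 1‖ := by
      have h3 := norm_sub_norm_le (Complex.exp w) 1
      rw [Complex.norm_exp, norm_one] at h3
      have h4 := Real.add_one_le_exp w.re
      linarith
    have hw0 : w ≠ 0 := fun h => by rw [h, Complex.zero_re] at hre; linarith
    rw [toddC, if_neg hw0, norm_div]
    calc ‖w‖ / ‖Complex.exp w - 1‖ ≤ ‖w‖ := div_le_self (norm_nonneg _) hexp
      _ ≤ 1 * (1 + w₀) := by rw [one_mul]; exact hnorm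
      _ ≤ max C 1 * (1 + w₀) := by gcongr; exact le_max_right _ _

lemma norm_prod_sub_prod_le {ι : Type*} (T : Finset ι) {f g : ι → ℂ} {R : ℝ} (hR : R ≤ 1)
    (hg : ∀ i ∈ T, ‖g i‖ ≤ 1) (hfg : ∀ i ∈ T, ‖f i - g i‖ ≤ R) :
    ‖∏ i ∈ T, f i - ∏ i ∈ T, g i‖ ≤ 2 ^ T.card * R - R := by
  classical
  induction T using Finset.induction_on with
  | empty => simp
  | insert i T hi ih =>
    have h1 := ih (fun j hj => hg j (Finset.mem_insert_of_mem hj))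
      fun j hj => hfg j (Finset.mem_insert_of_mem hj)
    have h2 := hg i (Finset.mem_insert_self _ _)
    have h3 := hfg i (Finset.mem_insert_self _ _)
    have h4 : ‖∏ j ∈ T, g j‖ ≤ 1 := by
      rw [norm_prod]
      exact Finset.prod_le_one (fun _ _ => norm_nonneg _) fun j hj =>
        hg j (Finset.mem_insert_of_mem hj)
    have h5 : ‖f i‖ ≤ 2 := by
      calc ‖f i‖ = ‖(f i - g i) + g i‖ := by rw [sub_add_cancel]
        _ ≤ _ := norm_add_le _ _
        _ ≤ 2 := by linarith
    rw [Finset.prod_insert hi, Finset.prod_insert hi, Finset.card_insert_of_notMem hi, pow_succ]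
    calc ‖f i * ∏ j ∈ T, f j - g i * ∏ j ∈ T, g j‖
        = ‖f i * (∏ j ∈ T, f j - ∏ j ∈ T, g j) + (f i - g i) * ∏ j ∈ T, g j‖ := by ring_nf
      _ ≤ ‖f i‖ * ‖∏ j ∈ T, f j - ∏ j ∈ T, g j‖ + ‖f i - g i‖ * ‖∏ j ∈ T, g j‖ := by
        rw [← norm_mul, ← norm_mul]; exact norm_add_le _ _
      _ ≤ 2 * (2 ^ T.card * R - R) + R * 1 := by
        have hR0 : 0 ≤ R := (norm_nonneg _).trans h3
        gcongr
      _ = 2 ^ T.card * 2 * R - R := by ring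

/-- The disc of centre `3/4` and radius `1/2` contains `1 - z` whenever `z` is at distance at most
`1/4` from `[0, 1/2]`. -/
lemma exists_cpow_bound {e : ℕ} (a : Fin e → Fin 2) (s₀ : Fin (e + 1) → ℂ) :
    ∃ C : ℝ, 1 ≤ C ∧ ∀ s ∈ closedBall s₀ 1, ∀ w ∈ closedBall (3 / 4 : ℂ) (1 / 2), ∀ i,
      w ∈ Complex.slitPlane ∧ ‖w ^ vExp s a i‖ ≤ C := by
  have hslit : ∀ w ∈ closedBall (3 / 4 : ℂ) (1 / 2), w ∈ Complex.slitPlane := by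
    intro w hw
    rw [mem_closedBall, dist_eq_norm] at hw
    have h := (Complex.abs_re_le_norm _).trans hw
    have h34 : (3 / 4 : ℂ).re = 3 / 4 := by norm_num
    rw [Complex.sub_re, h34, abs_le] at h
    exact Or.inl (by linarith [h.1])
  have hcomp : IsCompact (closedBall s₀ 1 ×ˢ closedBall (3 / 4 : ℂ) (1 / 2)) :=
    (isCompact_closedBall _ _).prod (isCompact_closedBall _ _)
  have h : ∀ i, ∃ C : ℝ, ∀ q ∈ closedBall s₀ 1 ×ˢ closedBall (3 / 4 : ℂ) (1 / 2),
      ‖q.2 ^ vExp q.1 a i‖ ≤ C := fun i => by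
    refine hcomp.exists_bound_of_continuousOn fun q hq => ContinuousAt.continuousWithinAt ?_
    exact continuousAt_snd.cpow
      ((analyticAt_vExp a i q.1).continuousAt.comp continuousAt_fst) (hslit _ hq.2)
  choose C hC using h
  have hnonneg : 0 ≤ ∑ i, |C i| := Finset.sum_nonneg fun i _ => abs_nonneg (C i)
  refine ⟨1 + ∑ i, |C i|, by linarith, fun s hs w hw i =>
    ⟨hslit w hw, (hC i (s, w) ⟨hs, hw⟩).trans ?_⟩⟩
  have := Finset.single_le_sum (fun j _ => abs_nonneg (C j)) (Finset.mem_univ i)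
  linarith [le_abs_self (C i)]

/-- The extension of `ψ_a` grows polynomially in `x₁` on polydiscs of radius proportional to
`1 / x₁`. -/
lemma exists_norm_psiC_le {e : ℕ} (a : Fin e → Fin 2) (s₀ : Fin (e + 1) → ℂ) :
    ∃ C : ℝ, 0 ≤ C ∧ ∀ s ∈ closedBall s₀ 1, ∀ c : ℝ, 1 ≤ c → ∀ x ∈ halfCube (Fin e),
      ∀ z : Fin e → ℂ, ‖z - fun i => (x i : ℂ)‖ ≤ (4 * 2 ^ e)⁻¹ / c →
        (s, (c : ℂ), z) ∈ psiDomain a ∧ ‖psiC a (s, (c : ℂ), z)‖ ≤ C * c ^ e := by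
  obtain ⟨C₁, hC₁, h₁⟩ := exists_cpow_bound a s₀
  obtain ⟨C₂, hC₂, h₂⟩ := exists_norm_toddC_le
  refine ⟨(C₁ * (C₂ * 2)) ^ e, by positivity, fun s hs c hc x hx z hz => ?_⟩
  have hc0 : 0 < c := zero_lt_one.trans_le hc
  have hR : (4 * 2 ^ e : ℝ)⁻¹ / c ≤ 1 / 4 := by
    have h1 : (1 : ℝ) ≤ 2 ^ e := one_le_pow₀ (by norm_num)
    calc (4 * 2 ^ e : ℝ)⁻¹ / c ≤ (4 * 2 ^ e : ℝ)⁻¹ := div_le_self (by positivity) hc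
      _ ≤ (4 : ℝ)⁻¹ := by gcongr; linarith
      _ = 1 / 4 := by norm_num
  have hzi : ∀ i, ‖z i - x i‖ ≤ (4 * 2 ^ e)⁻¹ / c := fun i => by
    have := norm_le_pi_norm (z - fun i => (x i : ℂ)) i
    exact this.trans hz
  have hball : ∀ i, 1 - z i ∈ closedBall (3 / 4 : ℂ) (1 / 2) := fun i => by
    rw [mem_closedBall, dist_eq_norm]
    have hx' := mem_Icc_of_halfCube hx i
    have h1 : ‖((1 / 4 - x i : ℝ) : ℂ)‖ ≤ 1 / 4 := by
      rw [Complex.norm_real, Real.norm_eq_abs, abs_le]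
      constructor <;> linarith [hx'.1, hx'.2]
    calc ‖1 - z i - 3 / 4‖ = ‖((1 / 4 - x i : ℝ) : ℂ) - (z i - x i)‖ := by
          congr 1; push_cast; ring
      _ ≤ ‖((1 / 4 - x i : ℝ) : ℂ)‖ + ‖z i - x i‖ := norm_sub_le _ _
      _ ≤ 1 / 2 := by linarith [hzi i]
  have htvar : ∀ i, ‖tVarC a z i - tVar a x i‖ ≤ (4 * 2 ^ e)⁻¹ / c := fun i => by
    have h := hzi i
    unfold tVarC tVar
    split_ifs
    · exact h
    · rw [show (1 : ℂ) - z i - ((1 - x i : ℝ) : ℂ) = -(z i - x i) by push_cast; ring, norm_neg]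
      exact h
  have hprod : ∀ i : Fin e, ‖(c : ℂ) * ∏ l ∈ Finset.Iic i, tVarC a z l -
      ((c * ∏ l ∈ Finset.Iic i, tVar a x l : ℝ) : ℂ)‖ ≤ 1 := fun i => by
    have hcard : (Finset.Iic i).card ≤ e := by
      simp
    have h := norm_prod_sub_prod_le (Finset.Iic i) (f := tVarC a z) (g := fun l => (tVar a x l : ℂ))
      (hR.trans (by norm_num)) (fun l _ => by
        rw [Complex.norm_real, Real.norm_of_nonneg (tVar_mem_Icc hx a l).1]
        exact (tVar_mem_Icc hx a l).2) fun l _ => htvar l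
    push_cast
    rw [← mul_sub, norm_mul, Complex.norm_real, Real.norm_of_nonneg hc0.le]
    calc c * ‖∏ l ∈ Finset.Iic i, tVarC a z l - ∏ l ∈ Finset.Iic i, (tVar a x l : ℂ)‖
        ≤ c * (2 ^ (Finset.Iic i).card * ((4 * 2 ^ e)⁻¹ / c) - (4 * 2 ^ e)⁻¹ / c) := by gcongr
      _ ≤ c * (2 ^ e * ((4 * 2 ^ e)⁻¹ / c)) := by
        gcongr
        have h1 : (0 : ℝ) ≤ (4 * 2 ^ e)⁻¹ / c := by positivity
        have h2 : (2 : ℝ) ^ (Finset.Iic i).card ≤ 2 ^ e := pow_le_pow_right₀ (by norm_num) hcard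
        nlinarith
      _ = 1 / 4 := by field_simp
      _ ≤ 1 := by norm_num
  have hnn : ∀ i : Fin e, 0 ≤ c * ∏ l ∈ Finset.Iic i, tVar a x l ∧
      c * ∏ l ∈ Finset.Iic i, tVar a x l ≤ c := fun i => by
    have h0 : ∀ l, 0 ≤ tVar a x l := fun l => (tVar_mem_Icc hx a l).1
    exact ⟨mul_nonneg hc0.le (Finset.prod_nonneg fun l _ => h0 l), mul_le_of_le_one_right hc0.le
      (Finset.prod_le_one (fun l _ => h0 l) fun l _ => (tVar_mem_Icc hx a l).2)⟩
  refine ⟨fun i => ⟨(h₁ s hs _ (hball i) i).1, (h₂ _ (hnn i).1 _ (hprod i)).1⟩, ?_⟩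
  rw [psiC, norm_prod]
  calc ∏ i, ‖(1 - z i) ^ vExp s a i * toddC ((c : ℂ) * ∏ l ∈ Finset.Iic i, tVarC a z l)‖
      ≤ ∏ _i : Fin e, C₁ * (C₂ * 2) * c := by
        refine Finset.prod_le_prod (fun _ _ => norm_nonneg _) fun i _ => ?_
        rw [norm_mul, mul_assoc]
        refine mul_le_mul (h₁ s hs _ (hball i) i).2 ?_ (norm_nonneg _) (zero_le_one.trans hC₁)
        refine (h₂ _ (hnn i).1 _ (hprod i)).2.trans ?_
        rw [mul_assoc]
        gcongr
        linarith [(hnn i).2]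
    _ = (C₁ * (C₂ * 2)) ^ e * c ^ e := by
        rw [Finset.prod_const, Finset.card_univ, Fintype.card_fin, mul_pow]

/-- Cauchy's estimate bounds the derivatives of `ψ_a` by a power of `x₁`, which is integrable against
`e^{-x₁}`. -/
lemma exists_psi_bound {e : ℕ} (a : Fin e → Fin 2) (β : Fin e → ℕ) (s₀ : Fin (e + 1) → ℂ) :
    ∃ B : ℝ → ℝ, IntegrableOn B (Ioi 1) ∧ ∃ V ∈ 𝓝 s₀, ∀ s ∈ V, ∀ c ∈ Ioi (1 : ℝ),
      ∀ x ∈ halfCube (Fin e),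
      ‖(c : ℂ) ^ (tailSum s 0 - ((e : ℂ) + 1)) / ((Real.exp c - 1 : ℝ) : ℂ) *
        mixedDeriv β (psiC a) (realPoint s c x)‖ ≤ B c := by
  set τ : (Fin (e + 1) → ℂ) → ℂ := fun s => tailSum s 0 - ((e : ℂ) + 1) with hτ
  obtain ⟨C, hC, hb⟩ := exists_norm_psiC_le a s₀
  obtain ⟨K, N, hK, hcauchy⟩ := exists_norm_mixedDeriv_le (isOpen_psiDomain a)
    (analyticOnNhd_psiC a) β
  obtain ⟨M, hM⟩ := exists_nat_gt (τ s₀).re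
  set A : ℝ := 2 * (K * C * (4 * 2 ^ e) ^ N) with hA
  have hcont : Continuous fun s => (τ s).re := by
    simp only [hτ]
    have := continuous_tailSum (e := e) 0
    fun_prop
  refine ⟨fun c => A * (Real.exp (-c) * c ^ (((M + (e + N) : ℕ) : ℝ) + 1 - 1)), ?_,
    closedBall s₀ 1 ∩ {s | (τ s).re < M}, inter_mem (closedBall_mem_nhds _ one_pos)
      (hcont.continuousAt.eventually_lt_const hM), ?_⟩
  · exact ((Real.GammaIntegral_convergent (by positivity)).mono_set
      (Ioi_subset_Ioi zero_le_one)).const_mul _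
  · intro s hs c hc x hx
    have hc1 : (1 : ℝ) ≤ c := hc.le
    have hc0 : 0 < c := zero_lt_one.trans_le hc1
    have h1 : ‖mixedDeriv β (psiC a) (realPoint s c x)‖ ≤
        K * C * (4 * 2 ^ e) ^ N * c ^ (e + N) := by
      have := hcauchy s c (fun i => (x i : ℂ)) ((4 * 2 ^ e)⁻¹ / c) (C * c ^ e) (by positivity)
        fun z hz => hb s hs.1 c hc1 x hx z hz
      refine this.trans_eq ?_
      rw [div_pow, inv_pow, pow_add]
      field_simp
    have h2 : ‖(c : ℂ) ^ τ s‖ ≤ c ^ M := by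
      rw [Complex.norm_cpow_eq_rpow_re_of_pos hc0, ← Real.rpow_natCast]
      exact Real.rpow_le_rpow_of_exponent_le hc1 hs.2.le
    have h3 : (Real.exp c - 1)⁻¹ ≤ 2 * Real.exp (-c) := by
      have h4 := Real.add_one_le_exp c
      rw [Real.exp_neg, ← div_eq_mul_inv, inv_le_comm₀ (by linarith) (by positivity), inv_div]
      linarith
    have h5 : 0 < Real.exp c - 1 := by linarith [Real.add_one_le_exp c]
    rw [norm_mul, norm_div, Complex.norm_real, Real.norm_of_nonneg h5.le, div_eq_mul_inv]
    simp only [add_sub_cancel_right, Real.rpow_natCast]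
    calc ‖(c : ℂ) ^ τ s‖ * (Real.exp c - 1)⁻¹ * ‖mixedDeriv β (psiC a) (realPoint s c x)‖
        ≤ c ^ M * (2 * Real.exp (-c)) * (K * C * (4 * 2 ^ e) ^ N * c ^ (e + N)) := by
          gcongr
      _ = A * (Real.exp (-c) * c ^ (M + (e + N))) := by rw [hA, pow_add c M]; ring

theorem exists_integral_psiIntegrand_eq {e : ℕ} (n : Fin (e + 1) → ℕ) :
    (∀ s ∈ region n, IntegrableOn (psiIntegrand n s) (Ioi 1)) ∧
    ∃ J : (Fin e → Fin 2) → (Fin e → ℕ) → (Fin (e + 1) → ℂ) → ℂ,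
      (∀ a β, AnalyticOnNhd ℂ (J a β) (region n)) ∧
      ∀ s ∈ region n, ∫ c in Ioi (1 : ℝ), psiIntegrand n s c =
        ∑ a : Fin e → Fin 2, ∑ β ∈ partsIndex n,
          (∏ i, partsCoeff (uExp s a i) (n i.succ) (β i)) * J a β s := by
  refine exists_integral_bigF_eq isOpen_psiDomain analyticOnNhd_psiC measurableSet_Ioi
    (f := psi) (fun s a c => restrictsTo_psi s a c)
    (fun s a c hc x hx => realPoint_mem_psiDomain s a c hx)
    (ρ := fun s c => (c : ℂ) ^ (tailSum s 0 - ((e : ℂ) + 1)) / ((Real.exp c - 1 : ℝ) : ℂ))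
    (fun s c hc => ?_) (fun c hc s => ?_) fun a β s₀ _ => exists_psi_bound a β s₀
  · have hc0 : 0 < c := zero_lt_one.trans hc
    refine ContinuousAt.continuousWithinAt
      ((Complex.continuousAt_ofReal_cpow_const _ _ (Or.inr hc0.ne')).div ?_ ?_)
    · fun_prop
    · have : Real.exp c - 1 ≠ 0 := by linarith [Real.add_one_le_exp c]
      exact_mod_cast this
  · have hc0 : 0 < c := zero_lt_one.trans hc
    simp only [div_eq_mul_inv]
    exact (((differentiable_tailSum 0 s).sub_const _).const_cpow
      (Or.inl (by exact_mod_cast hc0.ne'))).mul_const _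

/-! ### The singular locus -/

lemma singular_bound_cast {e : ℕ} (i : Fin (e + 1)) :
    ((((e : ℤ) + 1) - ((i : ℤ) + 1) + 1 : ℤ) : ℂ) = (e : ℂ) + 1 - (i : ℂ) := by
  push_cast
  ring

/-- Membership in the singular locus, in terms of non-positive integers. -/
lemma mem_singularLocus {e : ℕ} {s : Fin (e + 1) → ℂ} :
    s ∈ singularLocus e ↔ ∃ i : Fin (e + 1),
      (∃ m : ℕ, tailSum s i - ((e : ℂ) + 1 - (i : ℂ)) = -(m : ℂ)) ∨ ∃ m : ℕ, s i = -(m : ℂ) := by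
  refine exists_congr fun i => or_congr ⟨?_, ?_⟩ ⟨?_, ?_⟩
  · rintro ⟨l, hl, h⟩
    obtain ⟨m, hm⟩ := Int.le.dest hl
    refine ⟨m, ?_⟩
    rw [h, ← singular_bound_cast, ← hm]
    push_cast
    ring
  · rintro ⟨m, h⟩
    refine ⟨((e : ℤ) + 1) - ((i : ℤ) + 1) + 1 - m, by omega, ?_⟩
    rw [sub_eq_iff_eq_add] at h
    rw [h]
    push_cast
    ring
  · rintro ⟨l, hl, h⟩
    obtain ⟨m, hm⟩ := Int.le.dest hl
    refine ⟨m, ?_⟩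
    rw [h, show l = -(m : ℤ) by omega]
    push_cast
    ring
  · rintro ⟨m, h⟩
    exact ⟨-(m : ℤ), by omega, by rw [h]; push_cast; ring⟩

lemma analyticAt_inv_Gamma {E : Type*} [NormedAddCommGroup E] [NormedSpace ℂ E] {g : E → ℂ} {z : E}
    (hg : AnalyticAt ℂ g z) : AnalyticAt ℂ (fun w => (Complex.Gamma (g w))⁻¹) z :=
  (Complex.differentiable_one_div_Gamma.analyticAt (g z)).comp hg

/-- An entire function whose zero set is the singular locus. -/
noncomputable def locusFun {e : ℕ} (s : Fin (e + 1) → ℂ) : ℂ :=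
  ∏ i : Fin (e + 1), ((Complex.Gamma (tailSum s i - ((e : ℂ) + 1 - (i : ℂ))))⁻¹ *
    (Complex.Gamma (s i))⁻¹)

lemma locusFun_eq_zero_iff {e : ℕ} {s : Fin (e + 1) → ℂ} :
    locusFun s = 0 ↔ s ∈ singularLocus e := by
  rw [locusFun, Finset.prod_eq_zero_iff, mem_singularLocus]
  simp only [Finset.mem_univ, true_and, mul_eq_zero, inv_eq_zero, Complex.Gamma_eq_zero_iff]

lemma analyticAt_locusFun {e : ℕ} (s : Fin (e + 1) → ℂ) :
    AnalyticAt ℂ (locusFun : (Fin (e + 1) → ℂ) → ℂ) s :=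
  Finset.analyticAt_fun_prod _ fun i _ =>
    (analyticAt_inv_Gamma ((analyticAt_tailSum i s).sub analyticAt_const)).mul
      (analyticAt_inv_Gamma (analyticAt_coord i s))

lemma isClosed_singularLocus (e : ℕ) : IsClosed (singularLocus e) := by
  have h : singularLocus e = locusFun ⁻¹' {0} := by
    ext s
    exact locusFun_eq_zero_iff.symm
  rw [h]
  exact isClosed_singleton.preimage
    (continuous_iff_continuousAt.2 fun s => (analyticAt_locusFun s).continuousAt)

lemma tailSum_add_const {e : ℕ} (s : Fin (e + 1) → ℂ) (t : ℂ) (i : Fin (e + 1)) :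
    tailSum (fun l => s l + t) i = tailSum s i + ((e : ℂ) + 1 - (i : ℂ)) * t := by
  rw [tailSum, Finset.sum_add_distrib, Finset.sum_const, Fin.card_Ici, nsmul_eq_mul,
    Nat.cast_sub (by omega), tailSum]
  push_cast
  ring

lemma succ_sub_ne_zero {e : ℕ} (i : Fin (e + 1)) : (e : ℂ) + 1 - (i : ℂ) ≠ 0 := by
  have h := i.2
  rw [sub_ne_zero]
  exact_mod_cast h.ne'

/-- A line in the diagonal direction meets the singular locus in a countable set. -/
lemma countable_line_inter_singularLocus {e : ℕ} (s : Fin (e + 1) → ℂ) :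
    {t : ℂ | (fun l => s l + t) ∈ singularLocus e}.Countable := by
  have h : {t : ℂ | (fun l => s l + t) ∈ singularLocus e} ⊆ ⋃ i : Fin (e + 1), ⋃ m : ℕ,
      {(-(m : ℂ) - (tailSum s i - ((e : ℂ) + 1 - (i : ℂ)))) / ((e : ℂ) + 1 - (i : ℂ)),
        -(m : ℂ) - s i} := by
    intro t ht
    obtain ⟨i, ⟨m, hm⟩ | ⟨m, hm⟩⟩ := mem_singularLocus.1 ht
    · refine mem_iUnion.2 ⟨i, mem_iUnion.2 ⟨m, Or.inl ?_⟩⟩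
      rw [tailSum_add_const] at hm
      rw [eq_div_iff (succ_sub_ne_zero i), ← hm]
      ring
    · refine mem_iUnion.2 ⟨i, mem_iUnion.2 ⟨m, Or.inr ?_⟩⟩
      rw [mem_singleton_iff, ← hm]
      ring
  refine Set.Countable.mono h (countable_iUnion fun i => countable_iUnion fun m => ?_)
  exact (Set.toFinite _).countable

lemma not_eventually_locusFun_eq_zero {e : ℕ} (s : Fin (e + 1) → ℂ) :
    ¬ ∀ᶠ w in 𝓝 s, locusFun w = 0 := by
  intro h
  have hc : Continuous fun t : ℂ => fun l : Fin (e + 1) => s l + t := by fun_prop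
  have h0 : ∀ᶠ t in 𝓝 (0 : ℂ), locusFun (fun l => s l + t) = 0 :=
    (hc.tendsto' 0 s (by simp)).eventually h
  have h1 : {t : ℂ | (fun l => s l + t) ∈ singularLocus e} ∈ 𝓝 (0 : ℂ) := by
    filter_upwards [h0] with t ht using locusFun_eq_zero_iff.1 ht
  obtain ⟨t, ht, ht'⟩ :=
    ((countable_line_inter_singularLocus s).dense_compl ℂ).inter_nhds_nonempty h1
  exact ht ht'

/-! ### Functions that are meromorphic, with singularities on the singular locus -/

/-- The function `f` is meromorphic near `z`, and holomorphic near `z` if `z` is not on the singular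
locus. -/
def RegularOff {e : ℕ} (f : (Fin (e + 1) → ℂ) → ℂ) (z : Fin (e + 1) → ℂ) : Prop :=
  MeromorphicNear f z ∧ (z ∉ singularLocus e → AnalyticAt ℂ f z)

section RegularOff

variable {e : ℕ} {f g : (Fin (e + 1) → ℂ) → ℂ} {z : Fin (e + 1) → ℂ}

lemma _root_.AnalyticAt.regularOff (hf : AnalyticAt ℂ f z) : RegularOff f z :=
  ⟨hf.meromorphicNear, fun _ => hf⟩

lemma RegularOff.add (hf : RegularOff f z) (hg : RegularOff g z) :
    RegularOff (fun w => f w + g w) z :=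
  ⟨hf.1.add hg.1, fun h => (hf.2 h).add (hg.2 h)⟩

lemma RegularOff.mul (hf : RegularOff f z) (hg : RegularOff g z) :
    RegularOff (fun w => f w * g w) z :=
  ⟨hf.1.mul hg.1, fun h => (hf.2 h).mul (hg.2 h)⟩

lemma RegularOff.sum {ι : Type*} {T : Finset ι} {F : ι → (Fin (e + 1) → ℂ) → ℂ}
    (h : ∀ i ∈ T, RegularOff (F i) z) : RegularOff (fun w => ∑ i ∈ T, F i w) z :=
  ⟨.sum fun i hi => (h i hi).1, fun hz => Finset.analyticAt_fun_sum _ fun i hi => (h i hi).2 hz⟩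

lemma RegularOff.prod {ι : Type*} {T : Finset ι} {F : ι → (Fin (e + 1) → ℂ) → ℂ}
    (h : ∀ i ∈ T, RegularOff (F i) z) : RegularOff (fun w => ∏ i ∈ T, F i w) z :=
  ⟨.prod fun i hi => (h i hi).1, fun hz => Finset.analyticAt_fun_prod _ fun i hi => (h i hi).2 hz⟩

lemma RegularOff.inv (hf : AnalyticAt ℂ f z) (h : z ∉ singularLocus e → f z ≠ 0) :
    RegularOff (fun w => (f w)⁻¹) z :=
  ⟨hf.meromorphicNear_inv, fun hz => hf.inv (h hz)⟩

lemma RegularOff.Gamma (hf : AnalyticAt ℂ f z)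
    (h : z ∉ singularLocus e → ∀ m : ℕ, f z ≠ -(m : ℂ)) :
    RegularOff (fun w => Complex.Gamma (f w)) z := by
  have := RegularOff.inv (analyticAt_inv_Gamma hf) fun hz =>
    inv_ne_zero (Complex.Gamma_ne_zero (h hz))
  simpa only [inv_inv] using this

lemma RegularOff.congr (hf : RegularOff f z) (h : ∀ᶠ w in 𝓝 z, g w = f w) : RegularOff g z := by
  refine ⟨hf.1.congr_of_ne_zero (analyticAt_locusFun z) (not_eventually_locusFun_eq_zero z)
    (h.mono fun w hw _ => hw), fun hz => (hf.2 hz).congr (h.mono fun w hw => hw.symm)⟩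

end RegularOff

lemma uExp_add_one_ne {e : ℕ} {s : Fin (e + 1) → ℂ} (hs : s ∉ singularLocus e)
    (a : Fin e → Fin 2) (i : Fin e) (m : ℕ) : uExp s a i + 1 ≠ -(m : ℂ) := by
  intro h
  apply hs
  rw [mem_singularLocus]
  unfold uExp at h
  split_ifs at h
  · refine ⟨i.succ, Or.inl ⟨m, ?_⟩⟩
    rw [← h, Fin.val_succ]
    push_cast
    ring
  · refine ⟨i.castSucc, Or.inr ⟨m, ?_⟩⟩
    rw [← h]
    ring

lemma ascPochhammer_eval_ne_zero {u : ℂ} (hu : ∀ m : ℕ, u ≠ -(m : ℂ)) (k : ℕ) :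
    (ascPochhammer ℂ k).eval u ≠ 0 := by
  induction k with
  | zero => simp
  | succ k ih =>
    rw [ascPochhammer_succ_eval]
    exact mul_ne_zero ih fun h => hu k (eq_neg_of_add_eq_zero_left h)

lemma analyticAt_ascPochhammer {E : Type*} [NormedAddCommGroup E] [NormedSpace ℂ E] {g : E → ℂ}
    {z : E} (hg : AnalyticAt ℂ g z) (k : ℕ) :
    AnalyticAt ℂ (fun w => (ascPochhammer ℂ k).eval (g w)) z :=
  ((ascPochhammer ℂ k).differentiable.analyticAt (g z)).comp hg

lemma regularOff_partsCoeff {e : ℕ} (a : Fin e → Fin 2) (i : Fin e) (n k : ℕ)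
    (z : Fin (e + 1) → ℂ) : RegularOff (fun s => partsCoeff (uExp s a i) n k) z := by
  have hu := analyticAt_uExp a i z
  have hinv : ∀ k, RegularOff (fun s => ((ascPochhammer ℂ k).eval (uExp s a i + 1))⁻¹) z := fun k =>
    RegularOff.inv (analyticAt_ascPochhammer (hu.add analyticAt_const) k) fun hz =>
      ascPochhammer_eval_ne_zero (uExp_add_one_ne hz a i) k
  have hconst : ∀ c : ℂ, RegularOff (fun _ => c) z := fun c => analyticAt_const.regularOff
  unfold partsCoeff
  split_ifs
  · refine ((hconst _).mul (hinv _)).mul (AnalyticAt.regularOff ?_)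
    exact analyticAt_const.cpow ((hu.add analyticAt_const).add analyticAt_const)
      (Or.inl (by norm_num))
  · exact (hconst _).mul (hinv _)

lemma regularOff_bernoulliSum {e : ℕ} (n : Fin (e + 1) → ℕ) (z : Fin (e + 1) → ℂ) :
    RegularOff (bernoulliSum n) z := by
  have hconst : ∀ c : ℂ, RegularOff (fun _ => c) z := fun c => analyticAt_const.regularOff
  refine RegularOff.sum fun k _ => RegularOff.sum fun p _ => ((hconst _).mul ?_).mul
    (RegularOff.prod fun i _ => ?_)
  · simp only [one_div]
    refine RegularOff.inv
      (((analyticAt_tailSum 0 z).sub analyticAt_const).add analyticAt_const) fun hz h => hz ?_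
    rw [mem_singularLocus]
    refine ⟨0, Or.inl ⟨k, ?_⟩⟩
    rw [← eq_neg_of_add_eq_zero_left h]
    simp
  · have hx : AnalyticAt ℂ (fun s : Fin (e + 1) → ℂ => tailSum s i.succ - ((e : ℂ) + 1) +
        ((i : ℂ) + 2) + ((tailSum p i.succ : ℕ) : ℂ) - 1) z :=
      ((((analyticAt_tailSum _ z).sub analyticAt_const).add analyticAt_const).add
        analyticAt_const).sub analyticAt_const
    have hy := analyticAt_coord i.castSucc z
    simp only [betaFun, div_eq_mul_inv]
    refine ((RegularOff.Gamma hx fun hz m hm => hz ?_).mul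
      (RegularOff.Gamma hy fun hz m hm => hz ?_)).mul
      (analyticAt_inv_Gamma (hx.add hy)).regularOff
    · rw [mem_singularLocus]
      refine ⟨i.succ, Or.inl ⟨m + tailSum p i.succ, ?_⟩⟩
      rw [Fin.val_succ]
      push_cast
      linear_combination hm
    · exact mem_singularLocus.2 ⟨i.castSucc, Or.inr ⟨m, hm⟩⟩

/-- The explicit expression for the continuation. -/
noncomputable def continuationFormula {e : ℕ} (n : Fin (e + 1) → ℕ) (s : Fin (e + 1) → ℂ) : ℂ :=
  1 / (∏ i, Complex.Gamma (s i)) * bernoulliSum n s +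
    1 / (∏ i, Complex.Gamma (s i)) * (∫ x₁ in (0 : ℝ)..1, phiIntegrand n s x₁) +
    1 / (∏ i, Complex.Gamma (s i)) * (∫ x₁ in Ioi (1 : ℝ), psiIntegrand n s x₁)

lemma regularOff_continuationFormula {e : ℕ} (n : Fin (e + 1) → ℕ) {z : Fin (e + 1) → ℂ}
    (hz : z ∈ region n) : RegularOff (continuationFormula n) z := by
  have hG : RegularOff (fun s : Fin (e + 1) → ℂ => 1 / ∏ i, Complex.Gamma (s i)) z := by
    simp only [one_div, ← Finset.prod_inv_distrib]
    exact (Finset.analyticAt_fun_prod _ fun i _ =>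
      analyticAt_inv_Gamma (analyticAt_coord i z)).regularOff
  have hJ : ∀ {J : (Fin e → Fin 2) → (Fin e → ℕ) → (Fin (e + 1) → ℂ) → ℂ},
      (∀ a β, AnalyticOnNhd ℂ (J a β) (region n)) →
      RegularOff (fun s => ∑ a : Fin e → Fin 2, ∑ β ∈ partsIndex n,
        (∏ i, partsCoeff (uExp s a i) (n i.succ) (β i)) * J a β s) z := fun {J} h =>
    RegularOff.sum fun a _ => RegularOff.sum fun β _ =>
      (RegularOff.prod fun i _ => regularOff_partsCoeff a i _ _ z).mul (h a β z hz).regularOff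
  have hev := (isOpen_region n).mem_nhds hz
  obtain ⟨-, J₁, hJ₁, h₁⟩ := exists_integral_phiIntegrand_eq n
  obtain ⟨-, J₂, hJ₂, h₂⟩ := exists_integral_psiIntegrand_eq n
  refine ((hG.mul (regularOff_bernoulliSum n z)).add (hG.mul ((hJ hJ₁).congr ?_))).add
    (hG.mul ((hJ hJ₂).congr ?_))
  · filter_upwards [hev] with s hs
    rw [intervalIntegral.integral_of_le zero_le_one, h₁ s hs]
  · filter_upwards [hev] with s hs using h₂ s hs

lemma expressionExists {e : ℕ} (n : Fin (e + 1) → ℕ) {s : Fin (e + 1) → ℂ} (hs : s ∈ region n) :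
    ExpressionExists n s := by
  have hu := uExp_re_of_mem_region hs
  have hphi : ∀ a, ∀ c ∈ Icc (0 : ℝ) 1, ∀ x ∈ halfCube (Fin e),
      ContDiffAt ℝ (⊤ : ℕ∞) (phi n s a c) x := fun a c hc x hx =>
    contDiffAt_of_restrictsTo (isOpen_phiDomain a) (analyticOnNhd_phiC n a)
      (restrictsTo_phi n s a c) (realPoint_mem_phiDomain s a hc hx)
  have hpsi : ∀ a, ∀ c : ℝ, ∀ x ∈ halfCube (Fin e),
      ContDiffAt ℝ (⊤ : ℕ∞) (psi s a c) x := fun a c x hx =>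
    contDiffAt_of_restrictsTo (isOpen_psiDomain a) (analyticOnNhd_psiC a)
      (restrictsTo_psi s a c) (realPoint_mem_psiDomain s a c hx)
  refine ⟨fun a c hc => ⟨fun x hx => ⟨summable_phiTerm n a hc hx, hphi a c hc x hx⟩,
      fun S α hα => (integral_innerIntegrand hα (hu a) fun x hx => ?_).1⟩,
    fun a c _ => ⟨hpsi a c, fun S α hα => (integral_innerIntegrand hα (hu a) fun x hx => ?_).1⟩,
    (exists_integral_phiIntegrand_eq n).1 s hs, (exists_integral_psiIntegrand_eq n).1 s hs⟩
  · exact (contDiffAt_mixedPartial α (hphi a c hc x hx)).continuousAt.continuousWithinAt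
  · exact (contDiffAt_mixedPartial α (hpsi a c x hx)).continuousAt.continuousWithinAt

/-! ### The explicit expression in the domain `Re s_j > 1` -/

lemma zetaPow_tVar {e : ℕ} (s : Fin (e + 1) → ℂ) (a : Fin e → Fin 2) (x : Fin e → ℝ) :
    zetaPow s (tVar a x) =
      (∏ i, (x i : ℂ) ^ uExp s a i) * ∏ i, ((1 - x i : ℝ) : ℂ) ^ vExp s a i := by
  rw [zetaPow, ← Finset.prod_mul_distrib]
  refine Finset.prod_congr rfl fun i _ => ?_
  unfold tVar uExp vExp
  by_cases h : a i = 0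
  · simp [h]
  · simp [h, mul_comm]

lemma lt_re_tailSum {e : ℕ} {s : Fin (e + 1) → ℂ} (hs : ∀ i, 1 < (s i).re) (i : Fin (e + 1)) :
    (e : ℝ) + 1 - i < (tailSum s i).re := by
  have h : ∑ _l ∈ Finset.Ici i, (1 : ℝ) < ∑ l ∈ Finset.Ici i, (s l).re :=
    Finset.sum_lt_sum_of_nonempty ⟨i, by simp⟩ fun l _ => hs l
  rw [Finset.sum_const, Fin.card_Ici, nsmul_eq_mul, Nat.cast_sub (by omega), mul_one] at h
  rw [re_tailSum, tailSum]
  exact_mod_cast h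

lemma mem_convergenceRegion_of_one_lt {e : ℕ} {s : Fin (e + 1) → ℂ} (hs : ∀ i, 1 < (s i).re) :
    s ∈ convergenceRegion e := mem_convergenceRegion.2 (lt_re_tailSum hs)

lemma notMem_singularLocus_of_one_lt {e : ℕ} {s : Fin (e + 1) → ℂ} (hs : ∀ i, 1 < (s i).re) :
    s ∉ singularLocus e := by
  rw [mem_singularLocus]
  rintro ⟨i, ⟨m, hm⟩ | ⟨m, hm⟩⟩
  · have h1 := lt_re_tailSum hs i
    have h2 := congrArg Complex.re hm
    simp only [Complex.sub_re, Complex.add_re, Complex.natCast_re, Complex.one_re,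
      Complex.neg_re] at h2
    linarith [Nat.cast_nonneg (α := ℝ) m]
  · have h1 := hs i
    rw [hm, Complex.neg_re, Complex.natCast_re] at h1
    linarith [Nat.cast_nonneg (α := ℝ) m]

lemma mem_region_of_one_lt {e : ℕ} {s : Fin (e + 1) → ℂ} (hs : ∀ i, 1 < (s i).re)
    (n : Fin (e + 1) → ℕ) : s ∈ region n := by
  refine ⟨fun i => ?_, fun i => ?_⟩
  · linarith [lt_re_tailSum hs i, Nat.cast_nonneg (α := ℝ) (n i)]
  · linarith [hs i.castSucc, Nat.cast_nonneg (α := ℝ) (n i.succ)]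

lemma uExp_re_of_one_lt {e : ℕ} {s : Fin (e + 1) → ℂ} (hs : ∀ i, 1 < (s i).re)
    (a : Fin e → Fin 2) (i : Fin e) : -1 < (uExp s a i).re := by
  unfold uExp
  split_ifs
  · have := lt_re_tailSum hs i.succ
    simp only [Complex.add_re, Complex.sub_re, Complex.natCast_re, Complex.one_re,
      Complex.re_ofNat, Fin.val_succ] at this ⊢
    push_cast at this
    linarith
  · rw [Complex.sub_re, Complex.one_re]
    linarith [hs i.castSucc]

lemma integral_beta {u v : ℂ} (hu : 0 < u.re) (hv : 0 < v.re) :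
    Integrable (fun x : ℝ => (x : ℂ) ^ (u - 1) * ((1 - x : ℝ) : ℂ) ^ (v - 1)) unitSegment ∧
    ∫ x : ℝ, (x : ℂ) ^ (u - 1) * ((1 - x : ℝ) : ℂ) ^ (v - 1) ∂unitSegment = betaFun u v := by
  have h1 := Complex.betaIntegral_convergent hu hv
  have h2 := Complex.Gamma_mul_Gamma_eq_betaIntegral hu hv
  have h3 : unitSegment = volume.restrict (Ioc 0 1) := Measure.restrict_congr_set Ioo_ae_eq_Ioc
  have h4 : Complex.Gamma (u + v) ≠ 0 :=
    Complex.Gamma_ne_zero_of_re_pos (by rw [Complex.add_re]; linarith)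
  rw [h3]
  push_cast
  refine ⟨(intervalIntegrable_iff_integrableOn_Ioc_of_le zero_le_one).1 h1, ?_⟩
  rw [betaFun, h2, mul_div_cancel_left₀ _ h4, Complex.betaIntegral,
    intervalIntegral.integral_of_le zero_le_one]

lemma integral_zetaPow_mul_monomial {e : ℕ} {s : Fin (e + 1) → ℂ} (hs : ∀ i, 1 < (s i).re)
    (p : Fin (e + 1) → ℕ) :
    Integrable (fun x : Fin e → ℝ => zetaPow s x * ∏ i : Fin e, (x i : ℂ) ^ tailSum p i.succ)
      (unitCube e) ∧
    ∫ x : Fin e → ℝ, zetaPow s x * ∏ i : Fin e, (x i : ℂ) ^ tailSum p i.succ ∂unitCube e =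
      ∏ i : Fin e, betaFun
        (tailSum s i.succ - ((e : ℂ) + 1) + ((i : ℂ) + 2) + ((tailSum p i.succ : ℕ) : ℂ) - 1)
        (s i.castSucc) := by
  set X : Fin e → ℂ := fun i =>
    tailSum s i.succ - ((e : ℂ) + 1) + ((i : ℂ) + 2) + ((tailSum p i.succ : ℕ) : ℂ) - 1 with hX
  have hX0 : ∀ i, 0 < (X i).re := fun i => by
    have := lt_re_tailSum hs i.succ
    simp only [hX, Complex.add_re, Complex.sub_re, Complex.natCast_re, Complex.one_re,
      Complex.re_ofNat, Fin.val_succ] at this ⊢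
    push_cast at this ⊢
    linarith [Nat.cast_nonneg (α := ℝ) (tailSum p i.succ)]
  have hbeta := fun i => integral_beta (hX0 i) (zero_lt_one.trans (hs i.castSucc))
  have hae : (fun x : Fin e → ℝ => ∏ i, ((x i : ℂ) ^ (X i - 1) *
      ((1 - x i : ℝ) : ℂ) ^ (s i.castSucc - 1))) =ᵐ[unitCube e]
      fun x => zetaPow s x * ∏ i : Fin e, (x i : ℂ) ^ tailSum p i.succ := by
    filter_upwards [ae_unitCube e] with x hx
    rw [zetaPow, ← Finset.prod_mul_distrib]
    refine Finset.prod_congr rfl fun i _ => ?_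
    have hxi : (x i : ℂ) ≠ 0 := by exact_mod_cast (hx i).1.ne'
    have hexp : X i - 1 = uExp s 0 i + (tailSum p i.succ : ℕ) := by
      simp only [hX, uExp, Pi.zero_apply, if_true]
      ring
    have hv : vExp s 0 i = s i.castSucc - 1 := by simp [vExp]
    rw [hexp, Complex.cpow_add _ _ hxi, Complex.cpow_natCast, hv]
    ring
  refine ⟨(Integrable.fintype_prod fun i => (hbeta i).1).congr hae, ?_⟩
  rw [← integral_congr_ae hae, integral_fintype_prod_eq_prod (𝕜 := ℂ)
    (f := fun i (x : ℝ) => (x : ℂ) ^ (X i - 1) * ((1 - x : ℝ) : ℂ) ^ (s i.castSucc - 1))]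
  exact Finset.prod_congr rfl fun i _ => (hbeta i).2

/-- The integral of a Taylor coefficient is a sum of products of beta functions. -/
lemma integral_zetaPow_mul_toddPoly {e : ℕ} {s : Fin (e + 1) → ℂ} (hs : ∀ i, 1 < (s i).re)
    (k : ℕ) :
    Integrable (fun x : Fin e → ℝ => zetaPow s x * toddPoly k fun i => (x i : ℂ)) (unitCube e) ∧
    ∫ x : Fin e → ℝ, zetaPow s x * toddPoly k (fun i => (x i : ℂ)) ∂unitCube e =
      ∑ p ∈ Finset.piAntidiag (Finset.univ : Finset (Fin (e + 1))) k, bernoulliCoeff p *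
        ∏ i : Fin e, betaFun
          (tailSum s i.succ - ((e : ℂ) + 1) + ((i : ℂ) + 2) + ((tailSum p i.succ : ℕ) : ℂ) - 1)
          (s i.castSucc) := by
  have h : (fun x : Fin e → ℝ => zetaPow s x * toddPoly k fun i => (x i : ℂ)) =
      fun x => ∑ p ∈ Finset.piAntidiag (Finset.univ : Finset (Fin (e + 1))) k,
        bernoulliCoeff p * (zetaPow s x * ∏ i : Fin e, (x i : ℂ) ^ tailSum p i.succ) := by
    ext x
    rw [toddPoly, Finset.mul_sum]
    exact Finset.sum_congr rfl fun p _ => by ring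
  have hI := fun p => integral_zetaPow_mul_monomial hs p
  rw [h]
  refine ⟨integrable_finsetSum _ fun p _ => (hI p).1.const_mul _, ?_⟩
  rw [integral_finsetSum _ fun p _ => (hI p).1.const_mul _]
  refine Finset.sum_congr rfl fun p _ => ?_
  rw [integral_const_mul, (hI p).2]

lemma integral_Ioc_cpow {r : ℂ} (hr : 0 < r.re) :
    IntegrableOn (fun c : ℝ => (c : ℂ) ^ (r - 1)) (Ioc 0 1) ∧
    ∫ c : ℝ in Ioc 0 1, (c : ℂ) ^ (r - 1) = 1 / r := by
  have hr1 : -1 < (r - 1).re := by rw [Complex.sub_re, Complex.one_re]; linarith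
  refine ⟨(intervalIntegrable_iff_integrableOn_Ioc_of_le zero_le_one).1
    (intervalIntegral.intervalIntegrable_cpow' hr1), ?_⟩
  have hr0 : r ≠ 0 := fun h => by simp [h] at hr
  rw [← intervalIntegral.integral_of_le zero_le_one, integral_cpow (Or.inl hr1), sub_add_cancel,
    Complex.ofReal_one, Complex.ofReal_zero, Complex.one_cpow, Complex.zero_cpow hr0, sub_zero]

lemma toddProd_tVar {e : ℕ} (a : Fin e → Fin 2) {c : ℝ} (hc : c ≠ 0) (x : Fin e → ℝ) :
    toddProd (c : ℂ) (fun i => (tVar a x i : ℂ)) = c / ((Real.exp c - 1 : ℝ) : ℂ) *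
      ∏ i : Fin e, (todd (c * ∏ l ∈ Finset.Iic i, tVar a x l) : ℂ) := by
  rw [toddProd, toddC_ofReal, todd, if_neg hc, Complex.ofReal_div]
  congr 1
  refine Finset.prod_congr rfl fun i _ => ?_
  rw [← toddC_ofReal]
  push_cast
  rfl

/-- For `x₁ > 1` the inner integral of the integral representation is the integrand with `ψ_a`. -/
lemma integral_zetaKernel_of_one_lt {e : ℕ} (n : Fin (e + 1) → ℕ) {s : Fin (e + 1) → ℂ}
    (hs : ∀ i, 1 < (s i).re) {c : ℝ} (hc : 1 < c)
    (hI : Integrable (fun x => zetaKernel s (c, x)) (unitCube e)) :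
    ∫ x, zetaKernel s (c, x) ∂unitCube e = psiIntegrand n s c := by
  have hc0 : (c : ℂ) ≠ 0 := by exact_mod_cast (zero_lt_one.trans hc).ne'
  rw [integral_unitCube_eq_sum hI, psiIntegrand, bigF_eq_sum_integral (uExp_re_of_one_lt hs)
    fun a x hx => contDiffAt_of_restrictsTo (isOpen_psiDomain a) (analyticOnNhd_psiC a)
      (restrictsTo_psi s a c) (realPoint_mem_psiDomain s a c hx), Finset.mul_sum]
  refine Finset.sum_congr rfl fun a _ => ?_
  rw [← integral_const_mul]
  refine integral_congr_ae (Eventually.of_forall fun x => ?_)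
  simp only [zetaKernel]
  rw [zetaPow_tVar, toddProd_tVar a (zero_lt_one.trans hc).ne', psi, Finset.prod_mul_distrib,
    Complex.cpow_sub _ 1 hc0, Complex.cpow_one]
  field_simp

/-- For `x₁ ≤ 1` the inner integral of the integral representation is a Taylor polynomial in `x₁`
plus the integrand with `φ_a`. -/
lemma integral_zetaKernel_of_le_one {e : ℕ} (n : Fin (e + 1) → ℕ) {s : Fin (e + 1) → ℂ}
    (hs : ∀ i, 1 < (s i).re) {c : ℝ} (hc : c ∈ Ioc (0 : ℝ) 1)
    (hI : Integrable (fun x => zetaKernel s (c, x)) (unitCube e)) :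
    ∫ x, zetaKernel s (c, x) ∂unitCube e =
      ∑ k ∈ Finset.range (n 0 + 1), (c : ℂ) ^ (tailSum s 0 - ((e : ℂ) + 1) + k - 1) *
        (∫ x : Fin e → ℝ, zetaPow s x * toddPoly k (fun i => (x i : ℂ)) ∂unitCube e) +
      phiIntegrand n s c := by
  have hc0 : (c : ℂ) ≠ 0 := by exact_mod_cast hc.1.ne'
  have hcr : ‖(c : ℂ)‖ ≤ toddRadius e := by
    rw [Complex.norm_real, Real.norm_of_nonneg hc.1.le]
    exact hc.2.trans (one_lt_toddRadius e).le
  set τ : ℂ := tailSum s 0 - ((e : ℂ) + 1) with hτ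
  set R : (Fin e → ℝ) → ℂ := fun x => zetaPow s x * toddRem (n 0 + 1) c fun i => (x i : ℂ) with hR
  have hpow : ∀ k : ℕ, (c : ℂ) ^ (τ + k - 1) = (c : ℂ) ^ (τ - 1) * (c : ℂ) ^ k := fun k => by
    rw [add_sub_right_comm, Complex.cpow_add _ _ hc0, Complex.cpow_natCast]
  have hsum : Integrable (fun x : Fin e → ℝ => ∑ k ∈ Finset.range (n 0 + 1),
      (c : ℂ) ^ (τ + k - 1) * (zetaPow s x * toddPoly k fun i => (x i : ℂ))) (unitCube e) :=
    integrable_finsetSum _ fun k _ => (integral_zetaPow_mul_toddPoly hs k).1.const_mul _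
  have hae : (fun x => zetaKernel s (c, x)) =ᵐ[unitCube e] fun x =>
      ∑ k ∈ Finset.range (n 0 + 1), (c : ℂ) ^ (τ + k - 1) *
        (zetaPow s x * toddPoly k fun i => (x i : ℂ)) + (c : ℂ) ^ (τ + n 0) * R x := by
    filter_upwards [ae_unitCube e] with x hx
    have hx' : ∀ i, ‖(x i : ℂ)‖ ≤ toddRadius e := fun i => by
      rw [Complex.norm_real, Real.norm_of_nonneg (hx i).1.le]
      exact (hx i).2.le.trans (one_lt_toddRadius e).le
    have hlast : (c : ℂ) ^ (τ + n 0) = (c : ℂ) ^ (τ - 1) * (c : ℂ) ^ (n 0 + 1) := by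
      rw [← hpow (n 0 + 1)]
      congr 1
      push_cast
      ring
    rw [zetaKernel, toddProd_eq (n 0 + 1) hcr hx', hlast, mul_add, mul_add, Finset.mul_sum,
      Finset.mul_sum]
    congr 1
    · refine Finset.sum_congr rfl fun k _ => ?_
      rw [hpow]
      ring
    · rw [hR]
      ring
  have hRI : Integrable (fun x => (c : ℂ) ^ (τ + n 0) * R x) (unitCube e) := by
    have := (hI.congr hae).sub hsum
    simpa [Pi.sub_def] using this
  have hcpow : (c : ℂ) ^ (τ + n 0) ≠ 0 := by
    rw [Ne, Complex.cpow_eq_zero_iff]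
    exact fun h => hc0 h.1
  have hRI' : Integrable R (unitCube e) := (integrable_const_mul_iff (IsUnit.mk0 _ hcpow) R).1 hRI
  rw [integral_congr_ae hae, integral_add hsum hRI,
    integral_finsetSum _ fun k _ => (integral_zetaPow_mul_toddPoly hs k).1.const_mul _]
  congr 1
  · exact Finset.sum_congr rfl fun k _ => integral_const_mul _ _
  · rw [phiIntegrand, integral_const_mul, integral_unitCube_eq_sum hRI',
      bigF_eq_sum_integral (uExp_re_of_one_lt hs) fun a x hx =>
        contDiffAt_of_restrictsTo (isOpen_phiDomain a) (analyticOnNhd_phiC n a)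
          (restrictsTo_phi n s a c) (realPoint_mem_phiDomain s a (Ioc_subset_Icc_self hc) hx)]
    congr 1
    refine Finset.sum_congr rfl fun a _ => integral_congr_ae (Eventually.of_forall fun x => ?_)
    simp only [hR]
    rw [zetaPow_tVar, phi, toddRem, mul_assoc]
    simp only [phiTerm_eq]

/-- The explicit expression agrees with the sum of the series if `Re s_j > 1` for all `j`. -/
theorem continuationFormula_eq_of_one_lt {e : ℕ} (n : Fin (e + 1) → ℕ) {s : Fin (e + 1) → ℂ}
    (hs : ∀ i, 1 < (s i).re) : continuationFormula n s = ∑' m, zetaTerm s m := by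
  obtain ⟨hK, hKeq⟩ := integral_zetaKernel (fun i => zero_lt_one.trans (hs i))
    (mem_convergenceRegion_of_one_lt hs)
  set g : ℝ → ℂ := fun c => ∫ x, zetaKernel s (c, x) ∂unitCube e with hg
  have hgI : IntegrableOn g (Ioi 0) := hK.integral_prod_left
  have hfub : ∫ z, zetaKernel s z ∂(halfLine.prod (unitCube e)) =
      (∫ c in Ioc (0 : ℝ) 1, g c) + ∫ c in Ioi (1 : ℝ), g c := by
    rw [integral_prod _ hK, ← setIntegral_union Ioc_disjoint_Ioi_same measurableSet_Ioi
      (hgI.mono_set Ioc_subset_Ioi_self) (hgI.mono_set (Ioi_subset_Ioi zero_le_one)),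
      Ioc_union_Ioi_eq_Ioi zero_le_one]
  have hae : ∀ᵐ c ∂volume.restrict (Ioi (0 : ℝ)),
      Integrable (fun x => zetaKernel s (c, x)) (unitCube e) := hK.prod_right_ae
  have hpsi : ∫ c in Ioi (1 : ℝ), g c = ∫ c in Ioi (1 : ℝ), psiIntegrand n s c := by
    refine integral_congr_ae ?_
    filter_upwards [ae_restrict_of_ae_restrict_of_subset (Ioi_subset_Ioi zero_le_one) hae,
      ae_restrict_mem measurableSet_Ioi] with c hI hc
    exact integral_zetaKernel_of_one_lt n hs hc hI
  have hre : ∀ k : ℕ, 0 < (tailSum s 0 - ((e : ℂ) + 1) + k).re := fun k => by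
    have := lt_re_tailSum hs 0
    simp only [Complex.add_re, Complex.sub_re, Complex.natCast_re, Complex.one_re,
      Fin.val_zero, Nat.cast_zero] at this ⊢
    linarith [Nat.cast_nonneg (α := ℝ) k]
  have hphi : ∫ c in Ioc (0 : ℝ) 1, g c =
      bernoulliSum n s + ∫ c in Ioc (0 : ℝ) 1, phiIntegrand n s c := by
    have h1 : ∫ c in Ioc (0 : ℝ) 1, g c = ∫ c in Ioc (0 : ℝ) 1,
        (∑ k ∈ Finset.range (n 0 + 1), (c : ℂ) ^ (tailSum s 0 - ((e : ℂ) + 1) + k - 1) *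
          (∫ x : Fin e → ℝ, zetaPow s x * toddPoly k (fun i => (x i : ℂ)) ∂unitCube e) +
        phiIntegrand n s c) := by
      refine integral_congr_ae ?_
      filter_upwards [ae_restrict_of_ae_restrict_of_subset Ioc_subset_Ioi_self hae,
        ae_restrict_mem measurableSet_Ioc] with c hI hc
      exact integral_zetaKernel_of_le_one n hs hc hI
    have h2 : ∀ k : ℕ, IntegrableOn (fun c : ℝ =>
        (c : ℂ) ^ (tailSum s 0 - ((e : ℂ) + 1) + k - 1) *
          (∫ x : Fin e → ℝ, zetaPow s x * toddPoly k (fun i => (x i : ℂ)) ∂unitCube e))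
        (Ioc 0 1) := fun k => (integral_Ioc_cpow (hre k)).1.mul_const _
    rw [h1, integral_add (integrable_finsetSum _ fun k _ => h2 k)
      ((exists_integral_phiIntegrand_eq n).1 s (mem_region_of_one_lt hs n)),
      integral_finsetSum _ fun k _ => h2 k]
    congr 1
    refine Finset.sum_congr rfl fun k _ => ?_
    rw [integral_mul_const, (integral_Ioc_cpow (hre k)).2, (integral_zetaPow_mul_toddPoly hs k).2,
      Finset.mul_sum]
    exact Finset.sum_congr rfl fun p _ => by ring
  have hGamma : ∏ i, Complex.Gamma (s i) ≠ 0 := Finset.prod_ne_zero_iff.2 fun i _ =>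
    Complex.Gamma_ne_zero_of_re_pos (zero_lt_one.trans (hs i))
  rw [continuationFormula, intervalIntegral.integral_of_le zero_le_one, ← mul_add, ← mul_add,
    ← hphi, ← hpsi, ← hfub, hKeq, one_div, inv_mul_cancel_left₀ hGamma]

/-! ### The continuation -/

/-- The explicit expression agrees with the sum of the series wherever both make sense, by the
identity theorem on complex lines in the diagonal direction. -/
theorem continuationFormula_eq {e : ℕ} {n : Fin (e + 1) → ℕ} {s : Fin (e + 1) → ℂ}
    (hs : s ∈ region n) (hsD : s ∈ convergenceRegion e) (hsS : s ∉ singularLocus e) :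
    continuationFormula n s = ∑' m, zetaTerm s m := by
  set L : ℂ → Fin (e + 1) → ℂ := fun t l => s l + t with hL
  have hLan : ∀ t, AnalyticAt ℂ L t := fun t => by
    rw [analyticAt_pi_iff]
    exact fun i => analyticAt_const.add analyticAt_id
  have hL0 : L 0 = s := by simp [hL]
  -- near `0`, the line stays in both regions, and these are stable under increasing `Re t`
  obtain ⟨ε, hε, hεL⟩ : ∃ ε > 0, L (-ε : ℝ) ∈ region n ∩ convergenceRegion e := by
    have hev : ∀ᶠ t in 𝓝 (0 : ℂ), L t ∈ region n ∩ convergenceRegion e :=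
      (hLan 0).continuousAt.eventually_mem
        (((isOpen_region n).inter (isOpen_convergenceRegion e)).mem_nhds
          (by rw [hL0]; exact ⟨hs, hsD⟩))
    have hc : Tendsto (fun ε : ℝ => ((-ε : ℝ) : ℂ)) (𝓝[>] 0) (𝓝 0) := by
      have : Continuous fun ε : ℝ => ((-ε : ℝ) : ℂ) := by fun_prop
      exact (this.tendsto' 0 0 (by simp)).mono_left nhdsWithin_le_nhds
    obtain ⟨ε, h1, h2⟩ := ((hc.eventually hev).and self_mem_nhdsWithin).exists
    exact ⟨ε, h2, h1⟩
  have htail : ∀ t : ℂ, -ε < t.re → ∀ i,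
      (tailSum (L (-ε : ℝ)) i).re ≤ (tailSum (L t) i).re := fun t ht i => by
    rw [re_tailSum, re_tailSum]
    refine Finset.sum_le_sum fun l _ => ?_
    simp only [hL, Complex.add_re, Complex.ofReal_re]
    linarith
  have hmem : ∀ t : ℂ, -ε < t.re → L t ∈ region n ∩ convergenceRegion e := by
    intro t ht
    refine ⟨⟨fun i => (hεL.1.1 i).trans_le (htail t ht i), fun i => (hεL.1.2 i).trans_le ?_⟩,
      fun i => (hεL.2 i).trans_le (htail t ht i)⟩
    simp only [hL, Complex.add_re, Complex.ofReal_re]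
    linarith
  set T : Set ℂ := {t | L t ∈ singularLocus e} with hT
  have hpre := isPreconnected_halfPlane_diff_countable (-ε) (countable_line_inter_singularLocus s)
  have hf : AnalyticOnNhd ℂ (fun t => continuationFormula n (L t)) ({t : ℂ | -ε < t.re} \ T) :=
    fun t ht => ((regularOff_continuationFormula n (hmem t ht.1).1).2 ht.2).comp_of_eq (hLan t) rfl
  have hg : AnalyticOnNhd ℂ (fun t => ∑' m, zetaTerm (L t) m) ({t : ℂ | -ε < t.re} \ T) :=
    fun t ht => (analyticOnNhd_tsum_zetaTerm e _ (hmem t ht.1).2).comp_of_eq (hLan t) rfl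
  obtain ⟨M, hM⟩ : ∃ M : ℝ, ∀ i, 1 - (s i).re < M := by
    obtain ⟨M, hM⟩ := (Set.finite_range fun i => 1 - (s i).re).bddAbove
    exact ⟨M + 1, fun i => (hM ⟨i, rfl⟩).trans_lt (lt_add_one M)⟩
  have hlarge : ∀ t : ℂ, M < t.re → ∀ i, 1 < (L t i).re := fun t ht i => by
    simp only [hL, Complex.add_re]
    linarith [hM i]
  set t₀ : ℂ := ((|M| + 1 : ℝ) : ℂ) with ht₀
  have ht₀M : M < t₀.re := by
    rw [ht₀, Complex.ofReal_re]
    linarith [le_abs_self M]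
  have ht₀mem : t₀ ∈ {t : ℂ | -ε < t.re} \ T := by
    refine ⟨?_, notMem_singularLocus_of_one_lt (hlarge t₀ ht₀M)⟩
    simp only [ht₀, mem_ofPred_eq, Complex.ofReal_re]
    linarith [abs_nonneg M]
  have heq := hf.eqOn_of_preconnected_of_eventuallyEq hg hpre ht₀mem (by
    filter_upwards [Complex.continuous_re.continuousAt.eventually_const_lt ht₀M] with t ht
    exact continuationFormula_eq_of_one_lt n (hlarge t ht))
  have h0 := heq (x := 0) ⟨by simpa using hε, by simpa [hT, hL0] using hsS⟩
  simpa only [hL0] using h0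

open scoped Classical in
/-- The continuation: the sum of the series on its domain of absolute convergence, the explicit
expression elsewhere. -/
noncomputable def continuation {e : ℕ} (n : Fin (e + 1) → ℕ) (s : Fin (e + 1) → ℂ) : ℂ :=
  if s ∈ convergenceRegion e then ∑' m, zetaTerm s m else continuationFormula n s

lemma continuation_eq {e : ℕ} {n : Fin (e + 1) → ℕ} {s : Fin (e + 1) → ℂ}
    (hs : s ∈ region n) (hsS : s ∉ singularLocus e) :
    continuation n s = continuationFormula n s := by
  unfold continuation
  split_ifs with hD
  · exact (continuationFormula_eq hs hD hsS).symm
  · rfl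

lemma isMeromorphicOn_continuation {e : ℕ} (n : Fin (e + 1) → ℕ) :
    IsMeromorphicOn (continuation n) (region n) := by
  intro z hz
  refine (regularOff_continuationFormula n hz).1.congr_of_ne_zero (analyticAt_locusFun z)
    (not_eventually_locusFun_eq_zero z) ?_
  filter_upwards [(isOpen_region n).mem_nhds hz] with w hw hH
  exact continuation_eq hw fun h => hH (locusFun_eq_zero_iff.2 h)

lemma analyticOnNhd_continuation {e : ℕ} (n : Fin (e + 1) → ℕ) :
    AnalyticOnNhd ℂ (continuation n) (region n \ singularLocus e) := by
  intro z hz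
  refine ((regularOff_continuationFormula n hz.1).2 hz.2).congr ?_
  filter_upwards [((isOpen_region n).sdiff (isClosed_singularLocus e)).mem_nhds hz] with w hw
  exact (continuation_eq hw.1 hw.2).symm

lemma hasSum_continuation {e : ℕ} (n : Fin (e + 1) → ℕ) {s : Fin (e + 1) → ℂ}
    (hs : s ∈ convergenceRegion e) : HasSum (zetaTerm s) (continuation n s) := by
  rw [continuation, if_pos hs]
  exact (summable_norm_zetaTerm hs).of_norm.hasSum

end EulerZagier

theorem theorem1 (e : ℕ) (he : 1 ≤ e) (n : Fin (e + 1) → ℕ) :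
    ∃ Z : (Fin (e + 1) → ℂ) → ℂ,
      EulerZagier.IsMeromorphicOn Z (EulerZagier.region n) ∧
      (∀ s ∈ EulerZagier.region n ∩ EulerZagier.convergenceRegion e,
        HasSum (EulerZagier.zetaTerm s) (Z s)) ∧
      AnalyticOnNhd ℂ Z (EulerZagier.region n \ EulerZagier.singularLocus e) ∧
      ∀ s ∈ EulerZagier.region n \ EulerZagier.singularLocus e,
        EulerZagier.ExpressionExists n s ∧
        Z s =
          1 / (∏ i, Complex.Gamma (s i)) * EulerZagier.bernoulliSum n s +
          1 / (∏ i, Complex.Gamma (s i)) *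
            (∫ x₁ in (0 : ℝ)..1, EulerZagier.phiIntegrand n s x₁) +
          1 / (∏ i, Complex.Gamma (s i)) *
            (∫ x₁ in Set.Ioi (1 : ℝ), EulerZagier.psiIntegrand n s x₁) := by
  exact ⟨EulerZagier.continuation n, EulerZagier.isMeromorphicOn_continuation n,
    fun s hs => EulerZagier.hasSum_continuation n hs.2, EulerZagier.analyticOnNhd_continuation n,
    fun s hs => ⟨EulerZagier.expressionExists n hs.1, EulerZagier.continuation_eq hs.1 hs.2⟩⟩
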